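/- Let $K$ be an algebraically closed field of characteristic $0$, let $U=\operatorname{Spec}A$ be a nonsingular affine surface over $K$ with local coordinates $x_1,x_2$ (i.e. $(x_1,x_2)\colon U\to\mathbb A^2$ is étale), let $o\in U$ be a point with $x_1(o)=x_2(o)=0$, and let $T\subseteq\mathbb A^1$ be an open neighbourhood of $0$. *The monster tower.* Let $S(0)=U$ and $\mathcal B(0)=TU$. For $k\ge 1$ let $S(k)=\mathbb P\mathcal B(k-1)$, with projection $\pi_k\colon S(k)\to S(k-1)$, and let $\mathcal B(k)\subset TS(k)$ be the focal bundle, whose fibre at a point $(q,\ell)$ ($\ell$ a line in $\mathcal B(k-1)_q$) is $\{v: d\pi_k(v)\in\ell\}$. *Charts and the points $N$.* For each word $p_1\cdots p_k$ in the letters $1,2$ there are a chart $\mathcal C(p_1\cdots p_k)\subseteq S(k)$ and functions $x_1(p_1\cdots p_k)$, $x_2(p_1\cdots p_k)$ on it. For the empty word these are $U$ and $x_1,x_2$. Write $p'=p_1\cdots p_{k-1}$, $j=p_k$, $\{i,j\}=\{1,2\}$. Then $\mathcal C(p'j)$ consists of the points $(q,\ell)$ with $q\in\mathcal C(p')$ such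 that $dx_j(p')$ does not vanish on $\ell$, and $x_j(p'j)=x_j(p')$, $x_i(p'j)=dx_i(p')/dx_j(p')$. The origin of $\mathcal C(p_1\cdots p_k)$, i.e. the point of this chart lying over $o$ at which all the coordinates $x_i(p_1\cdots p_m)$, $0\le m\le k$, vanish, is denoted $N(p_1\cdots p_k)$. *Prolongation of the nodal curve.* The lift to $S(k)$ of a curve $C$ in $S(k-1)$ is the closure of the set of points $(q,T_qC)$ with $q$ a nonsingular point of $C$. For $t\in T$, $t\ne0$, let $X(k)_t\subset S(k)$ be the $k$-fold iterated lift of the curve $x_1x_2=t$ in $U$. Let $\mathcal X(k)\subset S(k)\times T$ be the closure of $\{(q,t): t\neq 0,\ q\in X(k)_t\}$ (equivalently, with its reduced structure, the unique extension to a flat family over $T$), and let $X(k)_0$ be its fibre over $t=0$. The irreducible components of $X(k)_0$, with their reduced structure, are called the twigs at level $k$. **Theorem.** Let $k\ge1$ and let $p_1\cdots p_k$ be a word in the letters $1,2$. The points $N(p_1\cdots p_k)\in S(k)$ and $N(p_1\cdots p_{k-1})\in S(k-1)$ exist and are unique, and exactly two twigs at level $k$ pass through $N(p_1\cdots p_k)$.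 One of them (the *emergent* twig) is mapped by $\pi_k$ onto the single point $N(p_1\cdots p_{k-1})$. The image under $\pi_k$ of the other one (the *retained* twig) is a twig at level $k-1$, and $\pi_k$ restricts to an isomorphism of varieties from the retained twig onto this image. -/

import Mathlib

open Topology
open scoped LinearAlgebra.Projectivization

universe u v

noncomputable section

namespace Monster

/-! ### Spaces with functions

Classical varieties over `K` are treated as sets of points together with a Zariski topology and
`K`-valued regular functions.  Such a structure is presented by a family `gen` of generating local
functions `(D, f)`: `D` is declared to be open, and `f` to be regular on `D` (the values of `f`
outside `D` are irrelevant).  Regular functions are those which are locally obtained from the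
generators and the constants by sums, products and inverses of nonvanishing functions. -/

/-- A space with `K`-valued functions, presented by generating local functions. -/
structure FunSpace (K : Type u) where
  carrier : Type v
  gen : Set (Set carrier × (carrier → K))

namespace FunSpace

variable {K : Type u} [Field K]

/-- `X.Local D f`: the function `f` on the open set `D` is an expression in the generators, i.e. it
is built from generators and constants by sums and products (on the intersection of the domains)
and by inversion (on the set where the function does not vanish). -/
inductive Local (X : FunSpace.{u, v} K) : Set X.carrier → (X.carrier → K) → Prop
  | gen {D : Set X.carrier} {f : X.carrier → K} : (D, f) ∈ X.gen → Local X D f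
  | const (c : K) : Local X Set.univ (fun _ => c)
  | add {D E : Set X.carrier} {f g : X.carrier → K} :
      Local X D f → Local X E g → Local X (D ∩ E) (fun y => f y + g y)
  | mul {D E : Set X.carrier} {f g : X.carrier → K} :
      Local X D f → Local X E g → Local X (D ∩ E) (fun y => f y * g y)
  | inv {D : Set X.carrier} {f : X.carrier → K} :
      Local X D f → Local X (D ∩ {y | f y ≠ 0}) (fun y => (f y)⁻¹)

/-- The Zariski topology: generated by the domains of all local functions (this includes the sets
where a local function does not vanish). -/
instance (X : FunSpace.{u, v} K) : TopologicalSpace X.carrier :=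
  TopologicalSpace.generateFrom {D | ∃ f, X.Local D f}

/-- The functions which are regular at `x`, i.e. equal to a local function near `x`. Their values
away from `x` are arbitrary; passing to germs at `x` gives the local ring of `X` at `x`. -/
def regAt (X : FunSpace.{u, v} K) (x : X.carrier) : Subalgebra K (X.carrier → K) where
  carrier := {f | ∃ D g, X.Local D g ∧ x ∈ D ∧ ∀ y ∈ D, f y = g y}
  mul_mem' := by
    rintro a b ⟨D, f, hf, hx, h⟩ ⟨E, g, hg, hx', h'⟩
    refine ⟨_, _, hf.mul hg, ⟨hx, hx'⟩, fun y hy => ?_⟩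
    simp [h y hy.1, h' y hy.2]
  add_mem' := by
    rintro a b ⟨D, f, hf, hx, h⟩ ⟨E, g, hg, hx', h'⟩
    refine ⟨_, _, hf.add hg, ⟨hx, hx'⟩, fun y hy => ?_⟩
    simp [h y hy.1, h' y hy.2]
  algebraMap_mem' := fun c => ⟨_, _, Local.const c, Set.mem_univ x, fun _ _ => rfl⟩

/-- Linear functionals on the functions regular at `x`; tangent vectors are the derivations among
them. -/
abbrev Functional (X : FunSpace.{u, v} K) (x : X.carrier) : Type (max u v) :=
  Module.Dual K (X.regAt x)

/-- The Zariski tangent space at `x`: the `K`-valued point derivations. (A point derivation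
automatically depends only on the germ at `x`, since the indicator function of a neighbourhood
of `x` is an idempotent.) -/
def tangent (X : FunSpace.{u, v} K) (x : X.carrier) : Submodule K (X.Functional x) where
  carrier := {D | ∀ f g : X.regAt x, D (f * g) = f.1 x * D g + g.1 x * D f}
  add_mem' := by
    intro a b ha hb f g
    simp only [LinearMap.add_apply, ha f g, hb f g]
    ring
  zero_mem' := by intro f g; simp
  smul_mem' := by
    intro c a ha f g
    simp only [LinearMap.smul_apply, ha f g, smul_eq_mul]
    ring

open Classical in
/-- The derivative `df(w)` of a function `f` in the direction `w` at a point where `f` is regular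
(and `0` otherwise). -/
def dirDeriv {X : FunSpace.{u, v} K} {x : X.carrier} (w : X.Functional x) (f : X.carrier → K) : K :=
  if h : f ∈ X.regAt x then w ⟨f, h⟩ else 0

/-- The tangent space at `x` of a subset `C`: the tangent vectors killing every function that is
regular at `x` and vanishes on `C` near `x`. -/
def tangentTo (X : FunSpace.{u, v} K) (C : Set X.carrier) (x : X.carrier) :
    Submodule K (X.Functional x) where
  carrier := {w | w ∈ X.tangent x ∧
    ∀ f : X.regAt x, (∀ᶠ y in 𝓝[C] x, f.1 y = 0) → w f = 0}
  add_mem' := by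
    rintro a b ⟨ha, ha'⟩ ⟨hb, hb'⟩
    exact ⟨add_mem ha hb, fun f hf => by simp [ha' f hf, hb' f hf]⟩
  zero_mem' := ⟨zero_mem _, fun f _ => by simp⟩
  smul_mem' := by
    rintro c a ⟨ha, ha'⟩
    exact ⟨Submodule.smul_mem _ c ha, fun f hf => by simp [ha' f hf]⟩

/-- The product of `X` with a subset `T` of the affine line. -/
def prodLine (X : FunSpace.{u, v} K) (T : Set K) : FunSpace.{u, max u v} K where
  carrier := X.carrier × T
  gen := {P | ∃ D f, X.Local D f ∧ P = (Prod.fst ⁻¹' D, fun z => f z.1)} ∪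
    {(Set.univ, fun z => (z.2 : K))}

/-- `φ` restricts to a morphism on the subset `Z` (with its reduced induced structure): it is
continuous on `Z`, and it pulls regular functions back to functions on `Z` which are locally
restrictions of regular functions. -/
def IsMorphismOn {X Y : FunSpace.{u, v} K} (φ : X.carrier → Y.carrier) (Z : Set X.carrier) :
    Prop :=
  ContinuousOn φ Z ∧
    ∀ x ∈ Z, ∀ g ∈ Y.regAt (φ x), ∃ h ∈ X.regAt x, ∀ᶠ y in 𝓝[Z] x, g (φ y) = h y

/-- `φ` restricts to an isomorphism from `Z` onto `Z'` (both with the reduced induced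
structure). -/
def IsIsomorphismOn {X Y : FunSpace.{u, v} K} (φ : X.carrier → Y.carrier) (Z : Set X.carrier)
    (Z' : Set Y.carrier) : Prop :=
  IsMorphismOn φ Z ∧ Set.MapsTo φ Z Z' ∧
    ∃ ψ : Y.carrier → X.carrier, IsMorphismOn ψ Z' ∧ Set.MapsTo ψ Z' Z ∧ Set.InvOn ψ φ Z Z'

end FunSpace

open FunSpace

/-! ### Projectivized bundles and the focal bundle -/

/-- A space together with a linear subspace `B x` of each tangent space (a "subbundle" of the
tangent bundle; the ambient type of `B x` consists of functionals, and for all spaces constructed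
below `B x` lies in the tangent space). -/
structure Distribution (K : Type u) [Field K] where
  space : FunSpace.{u, v} K
  B : ∀ x : space.carrier, Submodule K (space.Functional x)

namespace Distribution

variable {K : Type u} [Field K]

/-- The points of the projectivization `ℙ(B)`: pairs of a point `x` and a line in `B x`. -/
abbrev Points (M : Distribution.{u, max u v} K) : Type (max u v) :=
  Σ x : M.space.carrier, ℙ K (M.B x)

/-- A nonzero vector on the line represented by a point of `ℙ(B)`. -/
def dir (M : Distribution.{u, max u v} K) (q : M.Points) : M.space.Functional q.1 :=
  (q.2.rep : M.B q.1)

/-- The line represented by a point of `ℙ(B)`, inside the tangent space. -/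
def line (M : Distribution.{u, max u v} K) (q : M.Points) :
    Submodule K (M.space.Functional q.1) :=
  q.2.submodule.map (M.B q.1).subtype

/-- The function `df/dg` on `ℙ(B)`: the ratio of `df` and `dg` along the line represented by `q`. It
is meaningful where `dg` does not vanish on this line. -/
def slope (M : Distribution.{u, max u v} K) (f g : M.space.carrier → K) (q : M.Points) : K :=
  dirDeriv (M.dir q) f / dirDeriv (M.dir q) g

/-- The total space of the projectivization `ℙ(B)`. Its regular functions are generated by the
pullbacks of regular functions `f`, and by the ratios `df/dg` on the open set where `dg` does not
vanish. -/
def proj (M : Distribution.{u, max u v} K) : FunSpace.{u, max u v} K where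
  carrier := M.Points
  gen := {P | ∃ D f, M.space.Local D f ∧ P = (Sigma.fst ⁻¹' D, fun q => f q.1)} ∪
    {P | ∃ D f E g, M.space.Local D f ∧ M.space.Local E g ∧
      P = ({q | q.1 ∈ D ∧ q.1 ∈ E ∧ dirDeriv (M.dir q) g ≠ 0}, M.slope f g)}

/-- The pullback of a regular function to `ℙ(B)` is regular. -/
theorem comp_fst_mem_regAt (M : Distribution.{u, max u v} K) (q : M.Points)
    (f : M.space.regAt q.1) : (fun r : M.Points => f.1 r.1) ∈ M.proj.regAt q := by
  obtain ⟨D, g, hg, hx, h⟩ := f.2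
  exact ⟨Sigma.fst ⁻¹' D, fun r => g r.1, Local.gen (Or.inl ⟨D, g, hg, rfl⟩), hx,
    fun y hy => h y.1 hy⟩

/-- The derivative `dπ` of the projection `π : ℙ(B) → M` at the point `q`. -/
def dproj (M : Distribution.{u, max u v} K) (q : M.Points) :
    M.proj.Functional q →ₗ[K] M.space.Functional q.1 where
  toFun w :=
    { toFun := fun f => w ⟨fun r : M.Points => f.1 r.1, M.comp_fst_mem_regAt q f⟩
      map_add' := fun f g => by rw [← map_add]; rfl
      map_smul' := fun c f => by rw [RingHom.id_apply, ← map_smul]; rfl }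
  map_add' _ _ := rfl
  map_smul' _ _ := rfl

/-- The projectivization `ℙ(B)` with its focal bundle: a tangent vector at `q` is focal if `dπ`
maps it into the line represented by `q`. -/
def next (M : Distribution.{u, max u v} K) : Distribution.{u, max u v} K where
  space := M.proj
  B q := M.proj.tangent q ⊓ (M.line q).comap (M.dproj q)

/-- The lift (prolongation) of a curve `C` to `ℙ(B)`: take the tangent line of `C` at each
nonsingular point (the tangent space is then one-dimensional), and then the closure. -/
def lift (M : Distribution.{u, max u v} K) (C : Set M.space.carrier) :
    Set M.next.space.carrier :=
  closure {q : M.next.space.carrier | q.1 ∈ C ∧ M.line q = M.space.tangentTo C q.1}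

end Distribution

/-! ### The monster tower over an affine surface -/

section Tower

variable (K : Type u) [Field K] (A : Type v) [CommRing A] [Algebra K A]

/-- The affine variety of `K`-points of the algebra `A`, with the elements of `A` as generating
functions. -/
def affine : FunSpace.{u, max u v} K where
  carrier := A →ₐ[K] K
  gen := {P | ∃ a : A, P = (Set.univ, fun y => y a)}

/-- The monster tower over the affine variety with coordinate ring `A`: the space `S(k)` together
with its focal bundle, starting with the tangent bundle. -/
def tower : ℕ → Distribution.{u, max u v} K
  | 0 => ⟨affine K A, (affine K A).tangent⟩
  | k + 1 => (tower k).next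

/-- The monster space `S(k)` at level `k`. -/
abbrev S (k : ℕ) : FunSpace.{u, max u v} K := (tower K A k).space

variable {K A}

/-- The projection from `S(k+1)` to `S(k)`. -/
def π (k : ℕ) (q : (S K A (k + 1)).carrier) : (S K A k).carrier :=
  Sigma.fst (β := fun y => ℙ K ((tower K A k).B y)) q

/-- The coordinates `x_i(p₁⋯p_k)` on `S(k)` (where `p = p₁⋯p_k` is a word in an alphabet of two
letters, and `x 0`, `x 1` are coordinates on the base): with `j` the last letter of `p` and `p'` the
rest of the word, the coordinate `x_j(p)` is the retained coordinate `x_j(p')`, and for the other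
index `i` it is the new coordinate `d x_i(p') / d x_j(p')`. -/
def coord (x : Fin 2 → A) : ∀ (k : ℕ), (Fin k → Fin 2) → Fin 2 → (S K A k).carrier → K
  | 0, _, i => fun y : A →ₐ[K] K => y (x i)
  | k + 1, p, i =>
    if i = p (Fin.last k) then fun q => coord x k (Fin.init p) i (π k q)
    else (tower K A k).slope (coord x k (Fin.init p) i) (coord x k (Fin.init p) (p (Fin.last k)))

/-- The domain of the chart `C(p₁⋯p_k)`: with `j` the last letter of `p` and `p'` the rest of the
word, it consists of the points over `C(p')` representing a line on which `d x_j(p')` does not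
vanish. -/
def chart (x : Fin 2 → A) : ∀ (k : ℕ), (Fin k → Fin 2) → Set (S K A k).carrier
  | 0, _ => Set.univ
  | k + 1, p => {q | π k q ∈ chart x k (Fin.init p) ∧
      dirDeriv ((tower K A k).dir q) (coord x k (Fin.init p) (p (Fin.last k))) ≠ 0}

/-- `IsNode x o k p q`: the point `q` is the origin `N(p₁⋯p_k)` of the chart `C(p₁⋯p_k)`, i.e. it
lies in this chart and over the point `o` of the base, and all its coordinates vanish. -/
def IsNode (x : Fin 2 → A) (o : A →ₐ[K] K) :
    ∀ (k : ℕ), (Fin k → Fin 2) → (S K A k).carrier → Prop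
  | 0, _, q => q = o
  | k + 1, p, q => IsNode x o k (Fin.init p) (π k q) ∧ q ∈ chart x (k + 1) p ∧
      ∀ i, coord x (k + 1) p i q = 0

/-- The `k`th prolongation of the curve `x₁ x₂ = t`. -/
def X (x : Fin 2 → A) (t : K) : ∀ k : ℕ, Set (S K A k).carrier
  | 0 => {y : A →ₐ[K] K | y (x 0) * y (x 1) = t}
  | k + 1 => (tower K A k).lift (X x t k)

/-- The total space of the family of `k`th prolongations inside `S(k) × T`: the closure (that is,
the flat extension over `t = 0`) of the family of the prolongations for `t ≠ 0`. -/
def family (x : Fin 2 → A) (T : Set K) (k : ℕ) : Set ((S K A k).prodLine T).carrier :=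
  closure {z : ((S K A k).prodLine T).carrier | (z.2 : K) ≠ 0 ∧ z.1 ∈ X x (z.2 : K) k}

/-- The `k`th prolongation of the nodal curve: the central member of the family. -/
def nodal (x : Fin 2 → A) (T : Set K) (k : ℕ) : Set (S K A k).carrier :=
  {q | ∃ h : (0 : K) ∈ T, ((q, ⟨0, h⟩) : (S K A k).carrier × T) ∈ family x T k}

/-- The twigs at level `k`: the irreducible components of the `k`th prolongation of the nodal
curve. -/
def IsTwig (x : Fin 2 → A) (T : Set K) (k : ℕ) (Z : Set (S K A k).carrier) : Prop :=
  Maximal (fun Y : Set (S K A k).carrier => IsIrreducible Y ∧ Y ⊆ nodal x T k) Z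

end Tower

end Monster

end

/-!
Each chart of the tower has a coordinate ring `R` with derivations dual to the coordinates, and in
it the total space of the family is the zero locus of an ideal which is stable under derivations of
the same kind and under an Euler field whose weights have opposite signs. For `t ≠ 0` the curves of
the family are the integral curves of this Euler field, so a prolonged curve satisfies
`weight j * X j * X = weight (j + 1) * X (j + 1)`, where `X` is the new coordinate; this relation
puts the prolonged family in the same form in the charts of the next level, with weights
`weight j` and `weight (j + 1) - weight j`.

The parameter of the family vanishes exactly where one of the two coordinates does, so near the
origin of a chart the central fibre consists of two branches, one for each coordinate. On passing
to the `j`th chart of the next level, the relation at the origin leaves `X` free, and the branch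
`X j = 0` of the new central fibre is the whole fibre over the origin: this is the emergent twig.
The branch on which the new coordinate `X` vanishes lies over the old branch `X (j + 1) = 0`, and
consists of its tangent lines: this is the retained twig.
-/

universe w

noncomputable section

namespace Monster

namespace FunSpace

variable {K : Type u} [Field K] {X : FunSpace.{u, v} K} {x : X.carrier}

theorem Local.isOpen {D : Set X.carrier} {f : X.carrier → K} (h : X.Local D f) : IsOpen D :=
  TopologicalSpace.isOpen_generateFrom_of_mem ⟨f, h⟩

theorem isTopologicalBasis_local (X : FunSpace.{u, v} K) :
    TopologicalSpace.IsTopologicalBasis {D : Set X.carrier | ∃ f, X.Local D f} := by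
  have h := TopologicalSpace.isTopologicalBasis_of_subbasis_of_inter
    (r := {D : Set X.carrier | ∃ f, X.Local D f}) rfl ?_
  · rwa [Set.insert_eq_of_mem] at h
    exact ⟨_, Local.const 0⟩
  · rintro D ⟨f, hf⟩ E ⟨g, hg⟩
    exact ⟨_, hf.add hg⟩

theorem exists_local_of_mem_nhds {U : Set X.carrier} (hU : U ∈ 𝓝 x) :
    ∃ D f, X.Local D f ∧ x ∈ D ∧ D ⊆ U := by
  obtain ⟨D, ⟨f, hf⟩, hx, hD⟩ := X.isTopologicalBasis_local.mem_nhds_iff.1 hU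
  exact ⟨D, f, hf, hx, hD⟩

theorem Local.mem_regAt {D : Set X.carrier} {f : X.carrier → K} (h : X.Local D f) (hx : x ∈ D) :
    f ∈ X.regAt x :=
  ⟨D, f, h, hx, fun _ _ => rfl⟩

theorem Local.exists_restrict {D U : Set X.carrier} {f : X.carrier → K} (h : X.Local D f)
    (hx : x ∈ D) (hU : U ∈ 𝓝 x) : ∃ E, X.Local E f ∧ x ∈ E ∧ E ⊆ U ∧ E ⊆ D := by
  obtain ⟨E, g, hg, hxE, hE⟩ := exists_local_of_mem_nhds hU
  have hfg := h.add ((Local.const (0 : K)).mul hg)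
  simp only [zero_mul, add_zero, Set.univ_inter] at hfg
  exact ⟨_, hfg, ⟨hx, hxE⟩, fun y hy => hE hy.2, fun y hy => hy.1⟩

theorem continuous_of_local_comp {Y : FunSpace.{u, w} K} {φ : X.carrier → Y.carrier}
    (h : ∀ {D f}, Y.Local D f → X.Local (φ ⁻¹' D) (f ∘ φ)) : Continuous φ :=
  continuous_generateFrom_iff.2 fun _ ⟨_, hf⟩ => (h hf).isOpen

theorem regAt_congr {f g : X.carrier → K} (hf : f ∈ X.regAt x) (h : ∀ᶠ y in 𝓝 x, f y = g y) :
    g ∈ X.regAt x := by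
  obtain ⟨D, a, ha, hx, hD⟩ := hf
  obtain ⟨E, hE, hxE, hEU, hED⟩ := ha.exists_restrict hx h
  exact ⟨E, a, hE, hxE, fun y hy => (hEU hy).symm.trans (hD y (hED hy))⟩

theorem inv_mem_regAt {f : X.carrier → K} (hf : f ∈ X.regAt x) (h0 : f x ≠ 0) :
    (fun y => (f y)⁻¹) ∈ X.regAt x := by
  obtain ⟨D, a, ha, hx, hD⟩ := hf
  exact ⟨_, _, ha.inv, ⟨hx, by rwa [Set.mem_ofPred_eq, ← hD x hx]⟩,
    fun y hy => congrArg _ (hD y hy.1)⟩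

theorem eventually_ne_zero {f : X.carrier → K} (hf : f ∈ X.regAt x) (h0 : f x ≠ 0) :
    ∀ᶠ y in 𝓝 x, f y ≠ 0 := by
  obtain ⟨D, a, ha, hx, hD⟩ := hf
  refine Filter.mem_of_superset (ha.inv.isOpen.mem_nhds ⟨hx, ?_⟩) fun y hy => ?_
  · rwa [Set.mem_ofPred_eq, ← hD x hx]
  · rw [Set.mem_ofPred_eq, hD y hy.1]; exact hy.2

theorem const_mem_regAt (c : K) : (fun _ => c) ∈ X.regAt x :=
  (Local.const c).mem_regAt (Set.mem_univ x)

theorem tangent_congr {w : X.Functional x} (hw : w ∈ X.tangent x) {f g : X.regAt x}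
    (h : ∀ᶠ y in 𝓝 x, f.1 y = g.1 y) : w f = w g := by
  classical
  obtain ⟨D, a, ha, hx, hD⟩ := exists_local_of_mem_nhds h
  have he : (fun y => if y ∈ D then (1 : K) else 0) ∈ X.regAt x :=
    regAt_congr (const_mem_regAt (1 : K))
      (Filter.mem_of_superset (ha.isOpen.mem_nhds hx) fun y hy => by simp [hy])
  have hmul : (f - g) * (⟨_, he⟩ : X.regAt x) = 0 := by
    ext y
    by_cases hy : y ∈ D
    · simp [sub_eq_zero.2 (show f.1 y = g.1 y from hD hy)]
    · simp [hy]
  have hfg : (f - g).1 x = 0 := by simpa using sub_eq_zero.2 (show f.1 x = g.1 x from hD hx)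
  have hleibniz := hw (f - g) ⟨_, he⟩
  rw [hmul, map_zero, hfg] at hleibniz
  simp only [hx, if_true, zero_mul, one_mul, zero_add] at hleibniz
  exact sub_eq_zero.1 (by rw [← map_sub]; exact hleibniz.symm)

theorem dirDeriv_eq (w : X.Functional x) {f : X.carrier → K} (hf : f ∈ X.regAt x) :
    dirDeriv w f = w ⟨f, hf⟩ := by
  rw [dirDeriv, dif_pos hf]

theorem dirDeriv_congr {w : X.Functional x} (hw : w ∈ X.tangent x) {f g : X.carrier → K}
    (hf : f ∈ X.regAt x) (h : ∀ᶠ y in 𝓝 x, f y = g y) : dirDeriv w f = dirDeriv w g := by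
  rw [dirDeriv_eq w hf, dirDeriv_eq w (regAt_congr hf h)]
  exact tangent_congr hw h

end FunSpace

/-! ### Fractional expressions of local functions -/

section Fraction

variable {K : Type u} [Field K] {W C R : Type*} [CommRing R] [Algebra K R]
  {ev : W → R →ₐ[K] K} {Ψ : W → C} {D E : Set C} {f g : C → K} {w : W} {a b a' b' : R}

/-- The pullback along `Ψ` of the function `f` with domain `D` is the fraction `a / b` near `w`,
where the elements of `R` are regarded as functions on `W` by means of `ev`. -/
structure IsFraction (ev : W → R →ₐ[K] K) (Ψ : W → C) (D : Set C) (f : C → K) (w : W)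
    (a b : R) : Prop where
  ne_zero : ev w b ≠ 0
  mem : ∀ z, ev z b ≠ 0 → Ψ z ∈ D
  eq : ∀ z, ev z b ≠ 0 → f (Ψ z) = ev z a / ev z b

theorem IsFraction.const (c : K) :
    IsFraction ev Ψ Set.univ (fun _ => c) w (algebraMap K R c) 1 :=
  ⟨by simp, fun _ _ => Set.mem_univ _, fun z _ => by simp⟩

theorem IsFraction.add (hf : IsFraction ev Ψ D f w a b) (hg : IsFraction ev Ψ E g w a' b') :
    IsFraction ev Ψ (D ∩ E) (fun y => f y + g y) w (a * b' + b * a') (b * b') := by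
  refine ⟨by simp [hf.ne_zero, hg.ne_zero], fun z hz => ?_, fun z hz => ?_⟩ <;>
    obtain ⟨hb, hb'⟩ := mul_ne_zero_iff.1 (map_mul (ev z) b b' ▸ hz)
  · exact ⟨hf.mem z hb, hg.mem z hb'⟩
  · simp only [hf.eq z hb, hg.eq z hb', map_add, map_mul, div_add_div _ _ hb hb']

theorem IsFraction.mul (hf : IsFraction ev Ψ D f w a b) (hg : IsFraction ev Ψ E g w a' b') :
    IsFraction ev Ψ (D ∩ E) (fun y => f y * g y) w (a * a') (b * b') := by
  refine ⟨by simp [hf.ne_zero, hg.ne_zero], fun z hz => ?_, fun z hz => ?_⟩ <;>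
    obtain ⟨hb, hb'⟩ := mul_ne_zero_iff.1 (map_mul (ev z) b b' ▸ hz)
  · exact ⟨hf.mem z hb, hg.mem z hb'⟩
  · simp only [hf.eq z hb, hg.eq z hb', map_mul, div_mul_div_comm]

theorem IsFraction.inv (hf : IsFraction ev Ψ D f w a b) (h0 : f (Ψ w) ≠ 0) :
    IsFraction ev Ψ (D ∩ {y | f y ≠ 0}) (fun y => (f y)⁻¹) w (b * b) (b * a) := by
  have ha : ev w a ≠ 0 := (div_ne_zero_iff.1 (hf.eq w hf.ne_zero ▸ h0)).1
  refine ⟨by simp [ha, hf.ne_zero], fun z hz => ?_, fun z hz => ?_⟩ <;>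
    obtain ⟨hb, hza⟩ := mul_ne_zero_iff.1 (map_mul (ev z) b a ▸ hz)
  · exact ⟨hf.mem z hb, by simpa only [Set.mem_ofPred_eq, hf.eq z hb] using div_ne_zero hza hb⟩
  · simp only [hf.eq z hb, map_mul, inv_div, mul_div_mul_left _ _ hb]

/-- The pullback along `Ψ` of the function `f` with domain `D` is a fraction near `w`. -/
def HasFraction (ev : W → R →ₐ[K] K) (Ψ : W → C) (D : Set C) (f : C → K) (w : W) : Prop :=
  ∃ a b, IsFraction ev Ψ D f w a b

theorem FunSpace.Local.hasFraction {X : FunSpace.{u, v} K} {Ψ : W → X.carrier}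
    (hgen : ∀ D f, (D, f) ∈ X.gen → Ψ w ∈ D → HasFraction ev Ψ D f w)
    {D : Set X.carrier} {f : X.carrier → K} (h : X.Local D f) (hw : Ψ w ∈ D) :
    HasFraction ev Ψ D f w := by
  induction h with
  | gen h => exact hgen _ _ h hw
  | const c => exact ⟨_, _, .const c⟩
  | add _ _ ihf ihg =>
    obtain ⟨⟨_, _, hf⟩, ⟨_, _, hg⟩⟩ := And.intro (ihf hw.1) (ihg hw.2)
    exact ⟨_, _, hf.add hg⟩
  | mul _ _ ihf ihg =>
    obtain ⟨⟨_, _, hf⟩, ⟨_, _, hg⟩⟩ := And.intro (ihf hw.1) (ihg hw.2)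
    exact ⟨_, _, hf.mul hg⟩
  | inv _ ih =>
    obtain ⟨_, _, hf⟩ := ih hw.1
    exact ⟨_, _, hf.inv hw.2⟩

end Fraction

/-! ### Points and derivations of finitely generated algebras -/

section Algebra

variable {K : Type u} [Field K] {R : Type*} [CommRing R] [Algebra K R]

/-- The zero locus of an ideal in the set of `K`-points of `R`. -/
def zeroLocus (K : Type u) [Field K] {R : Type*} [CommRing R] [Algebra K R] (I : Ideal R) :
    Set (R →ₐ[K] K) :=
  {y | ∀ a ∈ I, y a = 0}

theorem mem_zeroLocus_span {s : Set R} {y : R →ₐ[K] K} :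
    y ∈ zeroLocus K (Ideal.span s) ↔ ∀ a ∈ s, y a = 0 :=
  Ideal.span_le (I := RingHom.ker y)

theorem zeroLocus_radical (I : Ideal R) : zeroLocus K I.radical = zeroLocus K I :=
  Set.ext fun y => (RingHom.ker_isPrime y.toRingHom).radical_le_iff

theorem exists_mem_zeroLocus_ne_zero [IsAlgClosed K] [Algebra.FiniteType K R] {I : Ideal R} {f : R}
    (hf : f ∉ I.radical) : ∃ y ∈ zeroLocus K I, y f ≠ 0 := by
  have : IsJacobsonRing R := isJacobsonRing_of_finiteType (A := K)
  rw [Ideal.radical_eq_jacobson, Ideal.jacobson, Submodule.mem_sInf] at hf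
  push Not at hf
  obtain ⟨M, ⟨hIM, hM⟩, hfM⟩ := hf
  let _ : Field (R ⧸ M) := Ideal.Quotient.field M
  have : Module.Finite K (R ⧸ M) := finite_of_finite_type_of_isJacobsonRing K (R ⧸ M)
  let e := AlgEquiv.ofBijective (Algebra.ofId K (R ⧸ M))
    (IsAlgClosed.algebraMap_bijective_of_isIntegral (k := K))
  refine ⟨(e.symm : (R ⧸ M) →ₐ[K] K).comp (Ideal.Quotient.mkₐ K M), fun a ha => ?_, fun h => ?_⟩
  · have : Ideal.Quotient.mkₐ K M a = 0 := Ideal.Quotient.eq_zero_iff_mem.2 (hIM ha)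
    rw [AlgHom.comp_apply, this, map_zero]
  · exact hfM (Ideal.Quotient.eq_zero_iff_mem.1 ((map_eq_zero_iff _ e.symm.injective).1 h))

/-- Differential ideals, i.e. ideals stable under the derivation `θ`. -/
def IsStable (θ : Derivation K R R) (I : Ideal R) : Prop :=
  ∀ a ∈ I, θ a ∈ I

theorem isStable_bot (θ : Derivation K R R) : IsStable θ ⊥ := fun a ha => by
  rw [Ideal.mem_bot.1 ha, map_zero]
  exact zero_mem _

theorem IsStable.pow_mul_pow_mem [CharZero K] {θ : Derivation K R R} {I : Ideal R}
    (hI : IsStable θ I) {a : R} {m l : ℕ} (h : a ^ (m + 1) * θ a ^ l ∈ I) :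
    a ^ m * θ a ^ (l + 2) ∈ I := by
  have hcast : algebraMap K R ((m : K) + 1)⁻¹ * ((m : R) + 1) = 1 := by
    rw [show (m : R) + 1 = algebraMap K R ((m : K) + 1) by simp, ← map_mul,
      inv_mul_cancel₀ (Nat.cast_add_one_ne_zero m), map_one]
  have hmem : algebraMap K R ((m : K) + 1)⁻¹ * (θ a * θ (a ^ (m + 1) * θ a ^ l) -
      l * (a ^ (m + 1) * θ a ^ l) * θ (θ a)) ∈ I :=
    I.mul_mem_left _ (I.sub_mem (I.mul_mem_left _ (hI _ h))
      (I.mul_mem_right _ (I.mul_mem_left _ h)))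
  convert hmem using 1
  rcases l with _ | l
  · simp only [Derivation.leibniz, Derivation.leibniz_pow, smul_eq_mul, nsmul_eq_mul,
      Nat.cast_zero, pow_zero, Nat.add_sub_cancel, Derivation.map_one_eq_zero]
    push_cast
    linear_combination (-(a ^ m * θ a ^ 2)) * hcast
  · simp only [Derivation.leibniz, Derivation.leibniz_pow, smul_eq_mul, nsmul_eq_mul,
      Nat.add_sub_cancel]
    push_cast
    linear_combination (-(a ^ m * θ a ^ (l + 3))) * hcast

theorem IsStable.radical [CharZero K] {θ : Derivation K R R} {I : Ideal R} (hI : IsStable θ I) :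
    IsStable θ I.radical := by
  rintro a ⟨n, hn⟩
  suffices ∀ m l : ℕ, a ^ m * θ a ^ l ∈ I → θ a ∈ I.radical from this n 0 (by simpa using hn)
  intro m
  induction m with
  | zero => exact fun l h => ⟨l, by simpa using h⟩
  | succ m ih => exact fun l h => ih (l + 2) (hI.pow_mul_pow_mem h)

theorem IsStable.apply_eq_zero [IsAlgClosed K] [CharZero K] [Algebra.FiniteType K R]
    {θ : Derivation K R R} {I : Ideal R} (hI : IsStable θ I) {y : R →ₐ[K] K}
    (hy : y ∈ zeroLocus K I) {f c : R} (hc : y c ≠ 0)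
    (h : ∀ z ∈ zeroLocus K I, z c ≠ 0 → z f = 0) : y (θ f) = 0 := by
  have hcf : c * f ∈ I.radical := by
    by_contra h0
    obtain ⟨z, hz, hzcf⟩ := exists_mem_zeroLocus_ne_zero (K := K) h0
    rw [map_mul, mul_ne_zero_iff] at hzcf
    exact hzcf.2 (h z hz hzcf.1)
  have hθ : y (θ (c * f)) = 0 := by
    rw [← zeroLocus_radical] at hy
    exact hy _ (hI.radical _ hcf)
  rw [Derivation.leibniz, map_add, smul_eq_mul, smul_eq_mul, map_mul, map_mul, h y hy hc,
    zero_mul, add_zero] at hθ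
  exact (mul_eq_zero.1 hθ).resolve_left hc

theorem IsStable.mem_radical_of_mul_mem [CharZero K] {θ : Derivation K R R} {I : Ideal R}
    (hI : IsStable θ I) {x g : R} (hx : θ x = 1) (h : g * x ∈ I.radical) : g ∈ I.radical := by
  have hθ := hI.radical _ h
  rw [Derivation.leibniz, hx, smul_eq_mul, smul_eq_mul, mul_one] at hθ
  have hsq : g ^ 2 ∈ I.radical := by
    convert I.radical.sub_mem (I.radical.mul_mem_left g hθ) (I.radical.mul_mem_left (θ g) h) using 1
    ring
  exact Ideal.radical_isRadical I ⟨2, hsq⟩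

theorem exists_mul_pow_mem_of_mem_minimalPrimes {I P : Ideal R} (hP : P ∈ I.minimalPrimes) {f : R}
    (hf : f ∈ P) : ∃ s ∉ P, ∃ n : ℕ, s * f ^ n ∈ I := by
  have hprime : P.IsPrime := hP.1.1
  by_contra! h
  obtain ⟨Q, hQ, hIQ, hdis⟩ := Ideal.exists_le_prime_disjoint I
    (P.primeCompl ⊔ Submonoid.powers f) (by
      rw [Set.disjoint_left]
      intro a ha ha'
      obtain ⟨s, hs, t, ⟨n, rfl⟩, rfl⟩ := Submonoid.mem_sup.1 ha'
      exact h s hs n ha)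
  rw [Set.disjoint_left] at hdis
  have hQP : Q ≤ P := fun a ha => by
    by_contra h'
    exact hdis ha (Submonoid.mem_sup_left (show a ∈ P.primeCompl from h'))
  exact hdis (hP.2 ⟨hQ, hIQ⟩ hQP hf) (Submonoid.mem_sup_right (Submonoid.mem_powers f))

theorem IsStable.minimalPrime [CharZero K] {θ : Derivation K R R} {I P : Ideal R}
    (hI : IsStable θ I) (hP : P ∈ I.minimalPrimes) : IsStable θ P := by
  have hprime : P.IsPrime := hP.1.1
  intro f hf
  obtain ⟨s, hs, n, hn⟩ := exists_mul_pow_mem_of_mem_minimalPrimes hP hf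
  have hsf : s * f ∈ I.radical := by
    refine ⟨n + 1, ?_⟩
    rw [show (s * f) ^ (n + 1) = (s ^ n * f) * (s * f ^ n) by ring]
    exact I.mul_mem_left _ hn
  have hθ : θ (s * f) ∈ P := hprime.radical_le_iff.2 hP.1.2 (hI.radical _ hsf)
  rw [Derivation.leibniz, smul_eq_mul, smul_eq_mul] at hθ
  have hsθ : s * θ f ∈ P := by simpa using P.sub_mem hθ (P.mul_mem_right (θ s) hf)
  exact (hprime.mem_or_mem hsθ).resolve_left hs

/-- The tangent space of `Spec R` at the `K`-point `y`: the `K`-valued derivations of `R`, for the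
structure of an `R`-module on `K` given by `y`. -/
def pointDerivations (y : R →ₐ[K] K) : Submodule K (R →ₗ[K] K) where
  carrier := {d | ∀ a b, d (a * b) = y a * d b + y b * d a}
  add_mem' := by
    intro d e hd he a b
    simp only [LinearMap.add_apply, hd a b, he a b]
    ring
  zero_mem' := by intro a b; simp
  smul_mem' := by
    intro c d hd a b
    simp only [LinearMap.smul_apply, hd a b, smul_eq_mul]
    ring

theorem comp_mem_pointDerivations (y : R →ₐ[K] K) (θ : Derivation K R R) :
    y.toLinearMap ∘ₗ θ.toLinearMap ∈ pointDerivations y := fun a b => by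
  simp

variable {y : R →ₐ[K] K} {d : R →ₗ[K] K}

theorem pointDerivations_one (hd : d ∈ pointDerivations y) : d 1 = 0 := by
  simpa using hd 1 1

/-- The value of the point derivation `d` at the fraction `a / b`. -/
def quotientRule (y : R →ₐ[K] K) (d : R →ₗ[K] K) (a b : R) : K :=
  (y b * d a - y a * d b) / y b ^ 2

theorem quotientRule_one (hd : d ∈ pointDerivations y) (a : R) : quotientRule y d a 1 = d a := by
  simp [quotientRule, pointDerivations_one hd]

theorem quotientRule_smul (c : K) (a b : R) :
    quotientRule y d (c • a) b = c * quotientRule y d a b := by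
  simp only [quotientRule, map_smul, smul_eq_mul]
  ring

theorem quotientRule_add (hd : d ∈ pointDerivations y) {a b a' b' : R} (hb : y b ≠ 0)
    (hb' : y b' ≠ 0) : quotientRule y d (a * b' + b * a') (b * b') =
      quotientRule y d a b + quotientRule y d a' b' := by
  simp only [quotientRule, map_add, map_mul, hd _ _]
  field_simp
  ring

theorem quotientRule_mul (hd : d ∈ pointDerivations y) {a b a' b' : R} (hb : y b ≠ 0)
    (hb' : y b' ≠ 0) : quotientRule y d (a * a') (b * b') =
      y a / y b * quotientRule y d a' b' + y a' / y b' * quotientRule y d a b := by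
  simp only [quotientRule, map_mul, hd _ _]
  field_simp
  ring

theorem quotientRule_congr (hd : d ∈ pointDerivations y) {a b a' b' : R} (hb : y b ≠ 0)
    (hb' : y b' ≠ 0) (h : y (a * b' - a' * b) = 0) (h' : d (a * b' - a' * b) = 0) :
    quotientRule y d a b = quotientRule y d a' b' := by
  simp only [map_sub, map_mul, hd _ _] at h h'
  simp only [quotientRule]
  field_simp
  linear_combination (y b * y b') * h' - (y b * d b' + y b' * d b) * h

end Algebra

/-! ### Étale coordinates -/

section Etale

variable {K : Type u} [Field K] {A : Type*} [CommRing A] [Algebra K A] {σ : Type*} {x : σ → A}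

theorem exists_dual_derivations [DecidableEq σ]
    (hx : (MvPolynomial.aeval x : MvPolynomial σ K →ₐ[K] A).toRingHom.FormallyEtale) :
    ∃ δ : σ → Derivation K A A, ∀ a b, δ a (x b) = if a = b then 1 else 0 := by
  let P := MvPolynomial σ K
  let _ : Algebra P A := (MvPolynomial.aeval x : P →ₐ[K] A).toRingHom.toAlgebra
  have : IsScalarTower K P A := IsScalarTower.of_algebraMap_eq'
    (AlgHom.comp_algebraMap (MvPolynomial.aeval x : P →ₐ[K] A)).symm
  have : Algebra.FormallyEtale P A := hx
  let e := KaehlerDifferential.tensorKaehlerEquivOfFormallyEtale K P A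
  let partialDer (a : σ) : Derivation K P A :=
    MvPolynomial.mkDerivation K (fun b => if a = b then (1 : A) else 0)
  refine ⟨fun a => (((partialDer a).liftKaehlerDifferential.liftBaseChange A).comp
    e.symm.toLinearMap).compDer (KaehlerDifferential.D K A), fun a b => ?_⟩
  have he : e.symm (KaehlerDifferential.D K A (x b)) =
      TensorProduct.tmul P 1 (KaehlerDifferential.D K P (MvPolynomial.X b)) := by
    rw [← MvPolynomial.aeval_X (R := K) x b]
    exact KaehlerDifferential.tensorKaehlerEquivOfFormallyEtale_symm_D_algebraMap K P A _
  change LinearMap.liftBaseChange A _ (e.symm (KaehlerDifferential.D K A (x b))) = _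
  rw [he, LinearMap.liftBaseChange_tmul, one_smul, Derivation.liftKaehlerDifferential_comp_D]
  exact MvPolynomial.mkDerivation_X _ _ _

theorem pointDerivations_eq_zero
    (hx : (MvPolynomial.aeval x : MvPolynomial σ K →ₐ[K] A).toRingHom.FormallyUnramified)
    {y : A →ₐ[K] K} {d : A →ₗ[K] K} (hd : d ∈ pointDerivations y) (h0 : ∀ b, d (x b) = 0) :
    d = 0 := by
  let P := MvPolynomial σ K
  let _ : Algebra P A := (MvPolynomial.aeval x : P →ₐ[K] A).toRingHom.toAlgebra
  have : Algebra.FormallyUnramified P A := hx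
  let _ : Algebra A K := y.toRingHom.toAlgebra
  let _ : Algebra P K := (y.toRingHom.comp (algebraMap P A)).toAlgebra
  have : IsScalarTower P A K := IsScalarTower.of_algebraMap_eq' rfl
  have hP (p : P) : d (MvPolynomial.aeval x p) = 0 := by
    induction p using MvPolynomial.induction_on with
    | C c =>
      rw [MvPolynomial.aeval_C, Algebra.algebraMap_eq_smul_one, map_smul, pointDerivations_one hd,
        smul_zero]
    | add p q hp hq => rw [map_add, map_add, hp, hq, add_zero]
    | mul_X p b hp => rw [map_mul, hd, hp, MvPolynomial.aeval_X, h0, mul_zero, mul_zero, add_zero]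
  let dP : Derivation P A K :=
    { toFun := d
      map_add' := d.map_add
      map_smul' := fun p a => by
        change d (MvPolynomial.aeval x p * a) = y (MvPolynomial.aeval x p) * d a
        rw [hd, hP, mul_zero, add_zero]
      map_one_eq_zero' := pointDerivations_one hd
      leibniz' := hd }
  have hdP : dP = 0 := by
    rw [← dP.liftKaehlerDifferential_comp, Subsingleton.elim dP.liftKaehlerDifferential 0]
    rfl
  exact LinearMap.ext fun a => DFunLike.congr_fun hdP a

theorem pointDerivations_eq_sum [Fintype σ] [DecidableEq σ]
    (hx : (MvPolynomial.aeval x : MvPolynomial σ K →ₐ[K] A).toRingHom.FormallyUnramified)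
    {δ : σ → Derivation K A A} (hδ : ∀ a b, δ a (x b) = if a = b then 1 else 0)
    {y : A →ₐ[K] K} {d : A →ₗ[K] K} (hd : d ∈ pointDerivations y) (a : A) :
    d a = ∑ b, d (x b) * y (δ b a) := by
  have hmem : d - ∑ b, d (x b) • (y.toLinearMap ∘ₗ (δ b).toLinearMap) ∈ pointDerivations y :=
    sub_mem hd (sum_mem fun b _ => Submodule.smul_mem _ _ (comp_mem_pointDerivations y (δ b)))
  have hzero := pointDerivations_eq_zero hx hmem fun b => by simp [hδ]
  simpa [sub_eq_zero] using LinearMap.congr_fun hzero a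

end Etale

open FunSpace

/-! ### Charts -/

/-- An affine chart of a space with functions: the map `point` is an open embedding of the set of
`K`-points of a finitely generated algebra `R`, along which elements of `R` (extended by zero) are
regular and local functions are fractions. -/
structure AffineChart {K : Type u} [Field K] (S : FunSpace.{u, max u v} K) where
  R : Type v
  [commRing : CommRing R]
  [algebra : Algebra K R]
  [finiteType : Algebra.FiniteType K R]
  point : (R →ₐ[K] K) → S.carrier
  injective : Function.Injective point
  isOpen_range : IsOpen (Set.range point)
  extend_mem_regAt : ∀ a y, Function.extend point (fun z => z a) 0 ∈ S.regAt (point y)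
  hasFraction : ∀ {D f y}, S.Local D f → point y ∈ D → HasFraction (fun z => z) point D f y

namespace AffineChart

attribute [instance] AffineChart.commRing AffineChart.algebra AffineChart.finiteType

variable {K : Type u} [Field K] {S : FunSpace.{u, max u v} K} (Φ : AffineChart.{u, v} S)

/-- An element of the algebra of a chart as a function on the whole space, by extension by zero. -/
def ext (a : Φ.R) : S.carrier → K := Function.extend Φ.point (fun z => z a) 0

@[simp] theorem ext_apply (a : Φ.R) (y : Φ.R →ₐ[K] K) : Φ.ext a (Φ.point y) = y a :=
  Φ.injective.extend_apply _ _ _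

theorem ext_of_notMem (a : Φ.R) {q : S.carrier} (hq : q ∉ Set.range Φ.point) : Φ.ext a q = 0 :=
  Function.extend_apply' _ _ _ hq

theorem ext_mem_regAt (a : Φ.R) (y : Φ.R →ₐ[K] K) : Φ.ext a ∈ S.regAt (Φ.point y) :=
  Φ.extend_mem_regAt a y

/-- The elements of the algebra of a chart as regular functions at a point. -/
def reg (y : Φ.R →ₐ[K] K) : Φ.R →ₗ[K] S.regAt (Φ.point y) where
  toFun a := ⟨Φ.ext a, Φ.ext_mem_regAt a y⟩
  map_add' a b := by
    ext q
    by_cases hq : q ∈ Set.range Φ.point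
    · obtain ⟨z, rfl⟩ := hq
      simp
    · simp [Φ.ext_of_notMem _ hq]
  map_smul' c a := by
    ext q
    by_cases hq : q ∈ Set.range Φ.point
    · obtain ⟨z, rfl⟩ := hq
      simp
    · simp [Φ.ext_of_notMem _ hq]

@[simp] theorem reg_val (y : Φ.R →ₐ[K] K) (a : Φ.R) : (Φ.reg y a).1 = Φ.ext a := rfl

theorem reg_mul (y : Φ.R →ₐ[K] K) (a b : Φ.R) : Φ.reg y (a * b) = Φ.reg y a * Φ.reg y b := by
  ext q
  by_cases hq : q ∈ Set.range Φ.point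
  · obtain ⟨z, rfl⟩ := hq
    simp
  · simp [Φ.ext_of_notMem _ hq]

variable {Φ} {y : Φ.R →ₐ[K] K}

theorem eventually_of_forall {p : S.carrier → Prop} {b : Φ.R} (hb : y b ≠ 0)
    (h : ∀ z : Φ.R →ₐ[K] K, z b ≠ 0 → p (Φ.point z)) : ∀ᶠ q in 𝓝 (Φ.point y), p q := by
  filter_upwards [Φ.isOpen_range.mem_nhds ⟨y, rfl⟩,
    eventually_ne_zero (Φ.ext_mem_regAt b y) (by simpa using hb)]
  rintro _ ⟨z, rfl⟩ hz
  exact h z (by simpa using hz)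

theorem exists_of_eventually {p : S.carrier → Prop} (h : ∀ᶠ q in 𝓝 (Φ.point y), p q) :
    ∃ b : Φ.R, y b ≠ 0 ∧ ∀ z : Φ.R →ₐ[K] K, z b ≠ 0 → p (Φ.point z) := by
  obtain ⟨D, f, hf, hy, hD⟩ := exists_local_of_mem_nhds h
  obtain ⟨a, b, hab⟩ := Φ.hasFraction hf hy
  exact ⟨b, hab.ne_zero, fun z hz => hD (hab.mem z hz)⟩

theorem hasFraction_of_mem_regAt {f : S.carrier → K} (hf : f ∈ S.regAt (Φ.point y)) :
    HasFraction (fun z => z) Φ.point Set.univ f y := by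
  obtain ⟨D, g, hg, hy, hD⟩ := hf
  obtain ⟨a, b, hab⟩ := Φ.hasFraction hg hy
  exact ⟨a, b, hab.ne_zero, fun _ _ => Set.mem_univ _,
    fun z hz => (hD _ (hab.mem z hz)).trans (hab.eq z hz)⟩

theorem comp_reg_mem_pointDerivations {w : S.Functional (Φ.point y)}
    (hw : w ∈ S.tangent (Φ.point y)) : w ∘ₗ Φ.reg y ∈ pointDerivations y := fun a b => by
  rw [LinearMap.comp_apply, reg_mul, hw, reg_val, reg_val, ext_apply, ext_apply]
  rfl

theorem apply_eq_quotientRule {w : S.Functional (Φ.point y)} (hw : w ∈ S.tangent (Φ.point y))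
    (f : S.regAt (Φ.point y)) {D : Set S.carrier} {a b : Φ.R}
    (hab : IsFraction (fun z => z) Φ.point D f.1 y a b) :
    w f = quotientRule y (w ∘ₗ Φ.reg y) a b := by
  have hb : y b ≠ 0 := hab.ne_zero
  have hmul : w (f * Φ.reg y b) = w (Φ.reg y a) := by
    refine tangent_congr hw (eventually_of_forall hb fun z hz => ?_)
    simp only [MulMemClass.coe_mul, Pi.mul_apply, reg_val, ext_apply, hab.eq z hz]
    exact div_mul_cancel₀ _ hz
  rw [hw, reg_val, ext_apply, hab.eq y hb] at hmul
  simp only [quotientRule, LinearMap.comp_apply, ← hmul]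
  field_simp
  ring

theorem tangent_ext {w w' : S.Functional (Φ.point y)} (hw : w ∈ S.tangent (Φ.point y))
    (hw' : w' ∈ S.tangent (Φ.point y)) (h : ∀ a, w (Φ.reg y a) = w' (Φ.reg y a)) : w = w' := by
  have hreg : w ∘ₗ Φ.reg y = w' ∘ₗ Φ.reg y := LinearMap.ext h
  ext f
  obtain ⟨a, b, hab⟩ := hasFraction_of_mem_regAt f.2
  rw [apply_eq_quotientRule hw f hab, apply_eq_quotientRule hw' f hab, hreg]

variable {d : Φ.R →ₗ[K] K}

theorem quotientRule_eq_of_isFraction (hd : d ∈ pointDerivations y)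
    (hd0 : ∀ a b, y b ≠ 0 → (∀ z : Φ.R →ₐ[K] K, z b ≠ 0 → z a = 0) → d a = 0)
    {D D' : Set S.carrier} {f : S.carrier → K} {a b a' b' : Φ.R}
    (h : IsFraction (fun z => z) Φ.point D f y a b)
    (h' : IsFraction (fun z => z) Φ.point D' f y a' b') :
    quotientRule y d a b = quotientRule y d a' b' := by
  have hvanish (z : Φ.R →ₐ[K] K) (hz : z (b * b') ≠ 0) : z (a * b' - a' * b) = 0 := by
    obtain ⟨hb, hb'⟩ := mul_ne_zero_iff.1 (map_mul z b b' ▸ hz)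
    have heq := (h.eq z hb).symm.trans (h'.eq z hb')
    rw [div_eq_div_iff hb hb'] at heq
    simp [heq]
  have hbb' : y (b * b') ≠ 0 := by
    rw [map_mul]
    exact mul_ne_zero h.ne_zero h'.ne_zero
  exact quotientRule_congr hd h.ne_zero h'.ne_zero (hvanish y hbb') (hd0 _ _ hbb' hvanish)

theorem exists_tangent_of_pointDerivation (hd : d ∈ pointDerivations y)
    (hd0 : ∀ a b, y b ≠ 0 → (∀ z : Φ.R →ₐ[K] K, z b ≠ 0 → z a = 0) → d a = 0) :
    ∃ w ∈ S.tangent (Φ.point y), w ∘ₗ Φ.reg y = d := by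
  choose num den hfrac using fun f : S.regAt (Φ.point y) => hasFraction_of_mem_regAt f.2
  let w : S.Functional (Φ.point y) :=
    { toFun := fun f => quotientRule y d (num f) (den f)
      map_add' := fun f g => by
        rw [← quotientRule_add hd (hfrac f).ne_zero (hfrac g).ne_zero]
        exact quotientRule_eq_of_isFraction hd hd0 (hfrac (f + g)) ((hfrac f).add (hfrac g))
      map_smul' := fun c f => by
        rw [RingHom.id_apply, smul_eq_mul, ← quotientRule_smul]
        refine quotientRule_eq_of_isFraction hd hd0 (hfrac (c • f))
          ⟨(hfrac f).ne_zero, (hfrac f).mem, fun z hz => ?_⟩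
        simp [(hfrac f).eq z hz, mul_div_assoc] }
  refine ⟨w, fun f g => ?_, LinearMap.ext fun a => ?_⟩
  · rw [(hfrac f).eq y (hfrac f).ne_zero, (hfrac g).eq y (hfrac g).ne_zero]
    exact (quotientRule_eq_of_isFraction hd hd0 (hfrac (f * g)) ((hfrac f).mul (hfrac g))).trans
      (quotientRule_mul hd (hfrac f).ne_zero (hfrac g).ne_zero)
  · rw [← quotientRule_one hd a]
    exact quotientRule_eq_of_isFraction hd hd0 (hfrac (Φ.reg y a))
      (D' := Set.univ) ⟨by simp, fun _ _ => Set.mem_univ _, fun z _ => by simp⟩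

theorem exists_tangent [IsAlgClosed K] [CharZero K] (y : Φ.R →ₐ[K] K) (θ : Derivation K Φ.R Φ.R) :
    ∃ w ∈ S.tangent (Φ.point y), ∀ a, w (Φ.reg y a) = y (θ a) := by
  obtain ⟨w, hw, h⟩ := exists_tangent_of_pointDerivation (comp_mem_pointDerivations y θ)
    fun a b hb hab => (isStable_bot θ).apply_eq_zero (by simp [zeroLocus]) hb fun z _ => hab z
  exact ⟨w, hw, LinearMap.congr_fun h⟩

end AffineChart

/-- A chart of a space with a rank two distribution: an affine chart with coordinates `X` and dual
derivations `δ`, such that the vectors of the distribution are the tangent vectors which are linear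
combinations of the values of `δ`. -/
structure Chart {K : Type u} [Field K] (M : Distribution.{u, max u v} K) extends
    AffineChart.{u, v} M.space where
  X : Fin 2 → R
  δ : Fin 2 → Derivation K R R
  δ_X : ∀ a b, δ a (X b) = if a = b then 1 else 0
  B_le : ∀ q, M.B q ≤ M.space.tangent q
  mem_B_iff : ∀ {y w}, w ∈ M.space.tangent (point y) → (w ∈ M.B (point y) ↔
    ∀ a, w (toAffineChart.reg y a) = ∑ b, w (toAffineChart.reg y (X b)) * y (δ b a))

namespace Chart

open AffineChart

variable {K : Type u} [Field K] {M : Distribution.{u, max u v} K} {Φ : Chart.{u, v} M}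
  {y : Φ.R →ₐ[K] K}

theorem B_ext {w w' : M.space.Functional (Φ.point y)} (hw : w ∈ M.B (Φ.point y))
    (hw' : w' ∈ M.B (Φ.point y)) (h : ∀ b, w (Φ.reg y (Φ.X b)) = w' (Φ.reg y (Φ.X b))) :
    w = w' := by
  have ht := Φ.B_le _ hw
  have ht' := Φ.B_le _ hw'
  refine tangent_ext ht ht' fun a => ?_
  rw [(Φ.mem_B_iff ht).1 hw, (Φ.mem_B_iff ht').1 hw']
  simp only [h]

theorem exists_mem_B [IsAlgClosed K] [CharZero K] (y : Φ.R →ₐ[K] K) (c : Fin 2 → K) :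
    ∃ w ∈ M.B (Φ.point y), ∀ a, w (Φ.reg y a) = ∑ b, c b * y (Φ.δ b a) := by
  obtain ⟨w, hw, h⟩ := exists_tangent y (∑ b, c b • Φ.δ b)
  have h' : ∀ a, w (Φ.reg y a) = ∑ b, c b * y (Φ.δ b a) := fun a => by simp [h]
  exact ⟨w, (Φ.mem_B_iff hw).2 fun a => by simp [h', Φ.δ_X], h'⟩

end Chart

/-! ### Polynomial extensions -/

section Polynomial

variable {K : Type u} [Field K] {R : Type*} [CommRing R] [Algebra K R]

/-- The derivation of a polynomial ring acting on the coefficients. -/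
def coeffDer (d : Derivation K R R) : Derivation K (Polynomial R) (Polynomial R) :=
  PolynomialModule.equivPolynomialSelf.compDer d.mapCoeffs

@[simp] theorem coeffDer_C (d : Derivation K R R) (a : R) :
    coeffDer d (Polynomial.C a) = Polynomial.C (d a) := by
  change PolynomialModule.equivPolynomialSelf (d.mapCoeffs (Polynomial.C a)) = _
  simp

@[simp] theorem coeffDer_X (d : Derivation K R R) : coeffDer d Polynomial.X = 0 := by
  change PolynomialModule.equivPolynomialSelf (d.mapCoeffs Polynomial.X) = _
  simp

/-- The derivation of a polynomial ring with respect to the variable. -/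
def varDer : Derivation K (Polynomial R) (Polynomial R) :=
  (Polynomial.derivative' (R := R)).restrictScalars K

@[simp] theorem varDer_C (a : R) : varDer (K := K) (Polynomial.C a) = 0 :=
  Polynomial.derivative_C

@[simp] theorem varDer_X : varDer (K := K) (Polynomial.X : Polynomial R) = 1 :=
  Polynomial.derivative_X

/-- The point of `Spec R[X]` over the point `y` of `Spec R` at which the variable is `c`. -/
def extPt (y : R →ₐ[K] K) (c : K) : Polynomial R →ₐ[K] K :=
  Polynomial.eval₂AlgHom y c fun _ => Commute.all _ _

@[simp] theorem extPt_C (y : R →ₐ[K] K) (c : K) (a : R) : extPt y c (Polynomial.C a) = y a :=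
  Polynomial.eval₂_C _ _

@[simp] theorem extPt_X (y : R →ₐ[K] K) (c : K) : extPt y c Polynomial.X = c :=
  Polynomial.eval₂_X _ _

/-- The point of `Spec R` below a point of `Spec R[X]`. -/
def basePt (z : Polynomial R →ₐ[K] K) : R →ₐ[K] K := z.comp Polynomial.CAlgHom

@[simp] theorem apply_C (z : Polynomial R →ₐ[K] K) (a : R) : z (Polynomial.C a) = basePt z a :=
  rfl

@[simp] theorem basePt_extPt (y : R →ₐ[K] K) (c : K) : basePt (extPt y c) = y :=
  AlgHom.ext fun a => extPt_C y c a

@[simp] theorem extPt_basePt (z : Polynomial R →ₐ[K] K) :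
    extPt (basePt z) (z Polynomial.X) = z :=
  Polynomial.algHom_ext' (AlgHom.ext fun a => extPt_C _ _ a) (extPt_X _ _)

theorem pointDerivations_polynomial_ext {z : Polynomial R →ₐ[K] K} {d d' : Polynomial R →ₗ[K] K}
    (hd : d ∈ pointDerivations z) (hd' : d' ∈ pointDerivations z)
    (hC : ∀ a, d (Polynomial.C a) = d' (Polynomial.C a))
    (hX : d Polynomial.X = d' Polynomial.X) : d = d' := by
  ext1 P
  induction P using Polynomial.induction_on with
  | C a => exact hC a
  | add p q hp hq => rw [map_add, map_add, hp, hq]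
  | monomial n a h => rw [pow_succ, ← mul_assoc, hd, hd', h, hX]

end Polynomial

theorem eq_or_add_one_eq (j b : Fin 2) : j = b ∨ j + 1 = b := by
  revert j b; decide

theorem add_one_ne (j : Fin 2) : j + 1 ≠ j := by
  revert j; decide

theorem add_one_add_one (j : Fin 2) : j + 1 + 1 = j := by
  revert j; decide

theorem sum_fin_two_eq_add {N : Type*} [AddCommMonoid N] (j : Fin 2) (f : Fin 2 → N) :
    ∑ b, f b = f j + f (j + 1) := by
  obtain rfl | rfl := eq_or_add_one_eq 0 j
  · simp
  · rw [Fin.sum_univ_two, add_comm]; rfl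

theorem exists_fin_two_iff (j : Fin 2) {p : Fin 2 → Prop} : (∃ b, p b) ↔ p j ∨ p (j + 1) := by
  refine ⟨fun ⟨b, hb⟩ => ?_, fun h => h.elim (fun h => ⟨_, h⟩) fun h => ⟨_, h⟩⟩
  obtain rfl | rfl := eq_or_add_one_eq j b
  exacts [Or.inl hb, Or.inr hb]

/-! ### Lines in a distribution -/

section Lines

variable {K : Type u} [Field K] {M : Distribution.{u, max u v} K}

theorem dirDeriv_smul {X : FunSpace.{u, v} K} {x : X.carrier} (w : X.Functional x) (c : K)
    (f : X.carrier → K) : dirDeriv (c • w) f = c * dirDeriv w f := by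
  unfold dirDeriv
  split_ifs <;> simp

namespace Distribution

theorem dir_mem (q : M.Points) : M.dir q ∈ M.B q.1 := (q.2.rep : M.B q.1).2

theorem line_eq_span (q : M.Points) : M.line q = Submodule.span K {M.dir q} := by
  rw [line, Projectivization.submodule_eq, Submodule.map_span, Set.image_singleton]
  rfl

theorem exists_dir_eq_smul {x : M.space.carrier} (v : M.B x) (hv : v ≠ 0) :
    ∃ c : K, c ≠ 0 ∧ M.dir ⟨x, Projectivization.mk K v hv⟩ = c • (v : M.space.Functional x) := by
  obtain ⟨a, ha⟩ := Projectivization.exists_smul_eq_mk_rep K v hv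
  exact ⟨a, a.ne_zero, by rw [dir, ← ha]; rfl⟩

theorem line_mk {x : M.space.carrier} (v : M.B x) (hv : v ≠ 0) :
    M.line ⟨x, Projectivization.mk K v hv⟩ =
      Submodule.span K {(v : M.space.Functional x)} := by
  obtain ⟨c, hc, h⟩ := exists_dir_eq_smul v hv
  rw [line_eq_span, h]
  exact Submodule.span_singleton_smul_eq (IsUnit.mk0 c hc) _

theorem eq_mk_of_dir_eq_smul {x : M.space.carrier} (ℓ : ℙ K (M.B x)) (v : M.B x) (hv : v ≠ 0)
    {c : K} (h : M.dir ⟨x, ℓ⟩ = c • (v : M.space.Functional x)) :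
    ℓ = Projectivization.mk K v hv := by
  rw [← ℓ.mk_rep, Projectivization.mk_eq_mk_iff']
  exact ⟨c, Subtype.ext h.symm⟩

theorem points_ext {q r : M.Points} (h : q.1 = r.1) (hline : HEq (M.line q) (M.line r)) :
    q = r := by
  obtain ⟨x, ℓ⟩ := q
  obtain ⟨x', ℓ'⟩ := r
  obtain rfl : x = x' := h
  have hmap := eq_of_heq hline
  rw [line, line] at hmap
  obtain rfl : ℓ = ℓ' := Projectivization.submodule_injective (Submodule.map_injective_of_injective
    (Submodule.injective_subtype _) hmap)
  rfl

theorem dirDeriv_dir_mk_ne_zero_iff {x : M.space.carrier} (v : M.B x) (hv : v ≠ 0)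
    (f : M.space.carrier → K) : dirDeriv (M.dir ⟨x, Projectivization.mk K v hv⟩) f ≠ 0 ↔
      dirDeriv (v : M.space.Functional x) f ≠ 0 := by
  obtain ⟨c, hc, h⟩ := exists_dir_eq_smul v hv
  rw [h, dirDeriv_smul, mul_ne_zero_iff, and_iff_right hc]

theorem slope_mk {x : M.space.carrier} (v : M.B x) (hv : v ≠ 0) (f g : M.space.carrier → K) :
    M.slope f g ⟨x, Projectivization.mk K v hv⟩ =
      dirDeriv (v : M.space.Functional x) f / dirDeriv (v : M.space.Functional x) g := by
  obtain ⟨c, hc, h⟩ := exists_dir_eq_smul v hv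
  rw [slope, h, dirDeriv_smul, dirDeriv_smul, mul_div_mul_left _ _ hc]

theorem local_comp_fst {D : Set M.space.carrier} {f : M.space.carrier → K}
    (h : M.space.Local D f) : M.proj.Local (Sigma.fst ⁻¹' D) fun q : M.Points => f q.1 :=
  Local.gen (Or.inl ⟨D, f, h, rfl⟩)

theorem local_slope {D E : Set M.space.carrier} {f g : M.space.carrier → K}
    (h : M.space.Local D f) (h' : M.space.Local E g) :
    M.proj.Local {q : M.Points | q.1 ∈ D ∧ q.1 ∈ E ∧ dirDeriv (M.dir q) g ≠ 0} (M.slope f g) :=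
  Local.gen (Or.inr ⟨D, f, E, g, h, h', rfl⟩)

theorem continuous_fst : @Continuous M.proj.carrier M.space.carrier _ _ Sigma.fst :=
  continuous_of_local_comp local_comp_fst

theorem dirDeriv_dir_congr (hM : ∀ q, M.B q ≤ M.space.tangent q) {D : Set M.space.carrier}
    {f g : M.space.carrier → K} (hg : M.space.Local D g) (h : ∀ x ∈ D, f x = g x) {q : M.Points}
    (hq : q.1 ∈ D) : dirDeriv (M.dir q) f = dirDeriv (M.dir q) g :=
  dirDeriv_congr (hM _ (dir_mem q)) ⟨D, g, hg, hq, h⟩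
    (Filter.mem_of_superset (hg.isOpen.mem_nhds hq) h)

theorem eventually_dirDeriv_ne_zero (hM : ∀ q, M.B q ≤ M.space.tangent q)
    {q : M.proj.carrier} {f : M.space.carrier → K}
    (hf : f ∈ M.space.regAt (Sigma.fst q)) (h0 : dirDeriv (M.dir q) f ≠ 0) :
    ∀ᶠ r : M.proj.carrier in 𝓝 q, dirDeriv (M.dir r) f ≠ 0 := by
  obtain ⟨D, g, hg, hq, hD⟩ := hf
  refine Filter.mem_of_superset ((local_slope hg hg).isOpen.mem_nhds
    ⟨hq, hq, by rwa [← dirDeriv_dir_congr hM hg hD hq]⟩) ?_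
  rintro r ⟨hr, -, hr'⟩
  rwa [Set.mem_ofPred_eq, dirDeriv_dir_congr hM hg hD hr]

theorem slope_mem_regAt (hM : ∀ q, M.B q ≤ M.space.tangent q)
    {q : M.Points} {f g : M.space.carrier → K}
    (hf : f ∈ M.space.regAt q.1) (hg : g ∈ M.space.regAt q.1) (h0 : dirDeriv (M.dir q) g ≠ 0) :
    M.slope f g ∈ M.proj.regAt q := by
  obtain ⟨D, f', hf', hq, hD⟩ := hf
  obtain ⟨E, g', hg', hq', hE⟩ := hg
  refine ⟨_, _, local_slope hf' hg', ⟨hq, hq', by rwa [← dirDeriv_dir_congr hM hg' hE hq']⟩, ?_⟩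
  rintro r ⟨hr, hr', -⟩
  exact congrArg₂ (· / ·) (dirDeriv_dir_congr hM hf' hD hr) (dirDeriv_dir_congr hM hg' hE hr')

theorem dproj_mem_tangent {q : M.Points} {w : M.proj.Functional q} (hw : w ∈ M.proj.tangent q) :
    M.dproj q w ∈ M.space.tangent q.1 := fun f g =>
  hw ⟨_, M.comp_fst_mem_regAt q f⟩ ⟨_, M.comp_fst_mem_regAt q g⟩

theorem mem_next_B {q : M.Points} {w : M.proj.Functional q} (hw : w ∈ M.proj.tangent q) :
    w ∈ M.next.B q ↔ M.dproj q w ∈ M.line q :=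
  and_iff_right hw

end Distribution

end Lines

open Monster.Distribution AffineChart

/-! ### Charts of a projectivization -/

theorem IsFraction.congr {K : Type u} [Field K] {W C C' R : Type*} [CommRing R] [Algebra K R]
    {ev : W → R →ₐ[K] K} {Ψ : W → C} {Ψ' : W → C'} {D : Set C} {D' : Set C'} {f : C → K}
    {f' : C' → K} {w : W} {a b : R} (h : IsFraction ev Ψ D f w a b)
    (hD : ∀ z, Ψ z ∈ D → Ψ' z ∈ D') (hf : ∀ z, Ψ z ∈ D → f' (Ψ' z) = f (Ψ z)) :
    IsFraction ev Ψ' D' f' w a b :=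
  ⟨h.ne_zero, fun z hz => hD z (h.mem z hz),
    fun z hz => (hf z (h.mem z hz)).trans (h.eq z hz)⟩

namespace Chart

variable {K : Type u} [Field K] {M : Distribution.{u, max u v} K} (Φ : Chart.{u, v} M) (j : Fin 2)

/-- The coordinates of the `j`th chart of the projectivization: the `j`th coordinate is retained,
the other one is the slope. -/
def nextX (b : Fin 2) : Polynomial Φ.R :=
  if b = j then Polynomial.C (Φ.X j) else Polynomial.X

/-- The derivations dual to the coordinates of the `j`th chart of the projectivization. -/
def nextδ (b : Fin 2) : Derivation K (Polynomial Φ.R) (Polynomial Φ.R) :=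
  if b = j then coeffDer (Φ.δ j) + (Polynomial.X : Polynomial Φ.R) • coeffDer (Φ.δ (j + 1))
  else varDer

@[simp] theorem nextX_self : Φ.nextX j j = Polynomial.C (Φ.X j) := by simp [nextX]

@[simp] theorem nextX_add_one : Φ.nextX j (j + 1) = Polynomial.X := by simp [nextX]

theorem nextδ_self_C (a : Φ.R) : Φ.nextδ j j (Polynomial.C a) =
    Polynomial.C (Φ.δ j a) + Polynomial.X * Polynomial.C (Φ.δ (j + 1) a) := by simp [nextδ]

@[simp] theorem nextδ_self_X : Φ.nextδ j j Polynomial.X = 0 := by simp [nextδ]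

@[simp] theorem nextδ_add_one_C (a : Φ.R) : Φ.nextδ j (j + 1) (Polynomial.C a) = 0 := by
  simp [nextδ]

@[simp] theorem nextδ_add_one_X : Φ.nextδ j (j + 1) Polynomial.X = 1 := by
  simp [nextδ]

theorem nextδ_nextX (a b : Fin 2) : Φ.nextδ j a (Φ.nextX j b) = if a = b then 1 else 0 := by
  obtain rfl | rfl := eq_or_add_one_eq j a <;> obtain rfl | rfl := eq_or_add_one_eq j b <;>
    simp [nextδ_self_C, Φ.δ_X, (add_one_ne _).symm]

theorem forall_eq_sum_nextδ_iff {z : Polynomial Φ.R →ₐ[K] K} {d : Polynomial Φ.R →ₗ[K] K}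
    (hd : d ∈ pointDerivations z) :
    (∀ P, d P = ∑ b, d (Φ.nextX j b) * z (Φ.nextδ j b P)) ↔
      ∀ a, d (Polynomial.C a) = d (Polynomial.C (Φ.X j)) *
        (basePt z (Φ.δ j a) + z Polynomial.X * basePt z (Φ.δ (j + 1) a)) := by
  constructor
  · intro h a
    rw [h, sum_fin_two_eq_add j, nextX_self, nextδ_self_C, nextδ_add_one_C, map_zero, mul_zero,
      add_zero, map_add, map_mul, apply_C, apply_C]
  · intro h P
    have hmem : ∑ b, d (Φ.nextX j b) • (z.toLinearMap ∘ₗ (Φ.nextδ j b).toLinearMap) ∈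
        pointDerivations z :=
      sum_mem fun b _ => Submodule.smul_mem _ _ (comp_mem_pointDerivations z _)
    have heq := pointDerivations_polynomial_ext hd hmem
      (fun a => by simp [h a, sum_fin_two_eq_add j, nextδ_self_C, mul_comm (z Polynomial.X)])
      (by simp [sum_fin_two_eq_add j])
    exact (LinearMap.congr_fun heq P).trans (by simp)

variable [IsAlgClosed K] [CharZero K]

theorem exists_frame (y : Φ.R →ₐ[K] K) (c : K) :
    ∃ w : M.B (Φ.point y), ∀ a, w.1 (Φ.reg y a) = y (Φ.δ j a) + c * y (Φ.δ (j + 1) a) := by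
  obtain ⟨w, hw, h⟩ := exists_mem_B y fun b => if b = j then 1 else c
  refine ⟨⟨w, hw⟩, fun a => ?_⟩
  rw [h, sum_fin_two_eq_add j]
  simp

/-- The vector of the distribution with `j`th coordinate `1` and other coordinate `c`. -/
def frame (y : Φ.R →ₐ[K] K) (c : K) : M.B (Φ.point y) := (Φ.exists_frame j y c).choose

variable (y : Φ.R →ₐ[K] K) (c : K)

theorem frame_apply (a : Φ.R) :
    (Φ.frame j y c).1 (Φ.reg y a) = y (Φ.δ j a) + c * y (Φ.δ (j + 1) a) :=
  (Φ.exists_frame j y c).choose_spec a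

theorem frame_apply_X : (Φ.frame j y c).1 (Φ.reg y (Φ.X j)) = 1 := by
  rw [frame_apply, Φ.δ_X, Φ.δ_X]
  simp

theorem frame_apply_X_add_one : (Φ.frame j y c).1 (Φ.reg y (Φ.X (j + 1))) = c := by
  rw [frame_apply, Φ.δ_X, Φ.δ_X]
  simp [(add_one_ne _).symm]

theorem frame_ne_zero : Φ.frame j y c ≠ 0 := by
  intro h
  have hX := Φ.frame_apply_X j y c
  rw [h] at hX
  exact one_ne_zero hX.symm

theorem frame_mem_tangent : (Φ.frame j y c).1 ∈ M.space.tangent (Φ.point y) :=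
  Φ.B_le _ (Φ.frame j y c).2

variable {y c j}

theorem eq_smul_frame {w : M.space.Functional (Φ.point y)} (hw : w ∈ M.B (Φ.point y))
    (h : w (Φ.reg y (Φ.X (j + 1))) = w (Φ.reg y (Φ.X j)) * c) :
    w = w (Φ.reg y (Φ.X j)) • (Φ.frame j y c).1 := by
  refine B_ext hw (Submodule.smul_mem _ _ (Φ.frame j y c).2) fun b => ?_
  obtain rfl | rfl := eq_or_add_one_eq j b
  · simp [frame_apply_X]
  · simp [frame_apply_X_add_one, h]

theorem mem_span_frame_iff {w : M.space.Functional (Φ.point y)}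
    (hw : w ∈ M.space.tangent (Φ.point y)) : w ∈ Submodule.span K {(Φ.frame j y c).1} ↔
      ∀ a, w (Φ.reg y a) =
        w (Φ.reg y (Φ.X j)) * (y (Φ.δ j a) + c * y (Φ.δ (j + 1) a)) := by
  refine Submodule.mem_span_singleton.trans ⟨?_, fun h => ⟨w (Φ.reg y (Φ.X j)), ?_⟩⟩
  · rintro ⟨s, rfl⟩ a
    rw [LinearMap.smul_apply, LinearMap.smul_apply, frame_apply_X, frame_apply, smul_eq_mul,
      smul_eq_mul, mul_one]
  · refine tangent_ext (Submodule.smul_mem _ _ (Φ.frame_mem_tangent j y c)) hw fun a => ?_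
    rw [LinearMap.smul_apply, frame_apply, h a, smul_eq_mul]

variable (j)

/-- The parametrization of the `j`th chart of the projectivization. -/
abbrev nextPoint (z : Polynomial Φ.R →ₐ[K] K) : M.proj.carrier :=
  (⟨Φ.point (basePt z), Projectivization.mk K (Φ.frame j (basePt z) (z Polynomial.X))
    (Φ.frame_ne_zero _ _ _)⟩ : M.Points)

variable {j}

theorem nextPoint_extPt (y : Φ.R →ₐ[K] K) (c : K) : Φ.nextPoint j (extPt y c) =
    (⟨Φ.point y, Projectivization.mk K (Φ.frame j y c) (Φ.frame_ne_zero _ _ _)⟩ : M.Points) := by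
  have hcongr (y' : Φ.R →ₐ[K] K) (c' : K) (hy : y' = y) (hc : c' = c) :
      (⟨Φ.point y', Projectivization.mk K (Φ.frame j y' c') (Φ.frame_ne_zero _ _ _)⟩ : M.Points) =
        ⟨Φ.point y, Projectivization.mk K (Φ.frame j y c) (Φ.frame_ne_zero _ _ _)⟩ := by
    subst hy hc
    rfl
  exact hcongr _ _ (basePt_extPt y c) (extPt_X y c)

theorem eq_nextPoint {ℓ : ℙ K (M.B (Φ.point y))} (h : M.dir ⟨Φ.point y, ℓ⟩ (Φ.reg y (Φ.X j)) ≠ 0) :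
    (⟨Φ.point y, ℓ⟩ : M.Points) =
      Φ.nextPoint j (extPt y (M.dir ⟨Φ.point y, ℓ⟩ (Φ.reg y (Φ.X (j + 1))) /
        M.dir ⟨Φ.point y, ℓ⟩ (Φ.reg y (Φ.X j)))) := by
  have hdir := Φ.eq_smul_frame (dir_mem ⟨Φ.point y, ℓ⟩) (j := j) (mul_div_cancel₀ _ h).symm
  rw [nextPoint_extPt, ← eq_mk_of_dir_eq_smul ℓ _ (Φ.frame_ne_zero j y _) hdir]

theorem mem_range_nextPoint {q : M.proj.carrier} : q ∈ Set.range (Φ.nextPoint j) ↔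
    Sigma.fst q ∈ Set.range Φ.point ∧ dirDeriv (M.dir q) (Φ.ext (Φ.X j)) ≠ 0 := by
  constructor
  · rintro ⟨z, rfl⟩
    refine ⟨⟨_, rfl⟩, (dirDeriv_dir_mk_ne_zero_iff _ _ _).2 ?_⟩
    rw [dirDeriv_eq _ (Φ.ext_mem_regAt _ _)]
    exact ne_of_eq_of_ne (Φ.frame_apply_X _ _ _) one_ne_zero
  · obtain ⟨x, ℓ⟩ := q
    rintro ⟨⟨y, hy⟩, h⟩
    change Φ.point y = x at hy
    subst hy
    rw [dirDeriv_eq _ (Φ.ext_mem_regAt _ _)] at h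
    exact ⟨_, (Φ.eq_nextPoint h).symm⟩

theorem slope_nextPoint (z : Polynomial Φ.R →ₐ[K] K) :
    M.slope (Φ.ext (Φ.X (j + 1))) (Φ.ext (Φ.X j)) (Φ.nextPoint j z) = z Polynomial.X := by
  refine (slope_mk _ _ _ _).trans ?_
  rw [dirDeriv_eq _ (Φ.ext_mem_regAt _ _), dirDeriv_eq _ (Φ.ext_mem_regAt _ _)]
  exact (congrArg₂ _ (Φ.frame_apply_X_add_one _ _ _) (Φ.frame_apply_X _ _ _)).trans (div_one _)

theorem nextPoint_injective : Function.Injective (Φ.nextPoint j) := by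
  intro z z' h
  have hbase : basePt z = basePt z' := Φ.injective (congrArg (fun q : M.Points => q.1) h)
  have hX : z Polynomial.X = z' Polynomial.X := by
    rw [← Φ.slope_nextPoint, h, Φ.slope_nextPoint]
  rw [← extPt_basePt z, hbase, hX, extPt_basePt]

theorem isOpen_range_nextPoint : IsOpen (Set.range (Φ.nextPoint j)) := by
  rw [isOpen_iff_mem_nhds]
  intro q hq
  have hq' := Φ.mem_range_nextPoint.1 hq
  obtain ⟨z, rfl⟩ := hq
  filter_upwards [continuous_fst.continuousAt.preimage_mem_nhds
      (Φ.isOpen_range.mem_nhds hq'.1),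
    eventually_dirDeriv_ne_zero Φ.B_le (Φ.ext_mem_regAt (Φ.X j) (basePt z)) hq'.2] with r h1 h2
  exact Φ.mem_range_nextPoint.2 ⟨h1, h2⟩

theorem extend_nextPoint_mem_regAt (P : Polynomial Φ.R) (z : Polynomial Φ.R →ₐ[K] K) :
    Function.extend (Φ.nextPoint j) (fun z => z P) 0 ∈ M.proj.regAt (Φ.nextPoint j z) := by
  have hev : ∀ᶠ q in 𝓝 (Φ.nextPoint j z), q ∈ Set.range (Φ.nextPoint j) :=
    Φ.isOpen_range_nextPoint.mem_nhds ⟨z, rfl⟩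
  have happly (P z) : Function.extend (Φ.nextPoint j) (fun z => z P) 0 (Φ.nextPoint j z) = z P :=
    Φ.nextPoint_injective.extend_apply _ _ _
  induction P using Polynomial.induction_on with
  | C a =>
    refine regAt_congr (M.comp_fst_mem_regAt (Φ.nextPoint j z) (Φ.reg (basePt z) a)) ?_
    filter_upwards [hev]
    rintro _ ⟨z', rfl⟩
    rw [happly]
    exact Φ.ext_apply a (basePt z')
  | add p q hp hq =>
    refine regAt_congr (add_mem hp hq) ?_
    filter_upwards [hev]
    rintro _ ⟨z', rfl⟩
    rw [Pi.add_apply, happly, happly, happly, map_add]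
  | monomial n a h =>
    have hX : M.slope (Φ.ext (Φ.X (j + 1))) (Φ.ext (Φ.X j)) ∈ M.proj.regAt (Φ.nextPoint j z) :=
      slope_mem_regAt Φ.B_le (Φ.ext_mem_regAt _ (basePt z)) (Φ.ext_mem_regAt _ (basePt z))
        (Φ.mem_range_nextPoint.1 ⟨z, rfl⟩).2
    refine regAt_congr (mul_mem h hX) ?_
    filter_upwards [hev]
    rintro _ ⟨z', rfl⟩
    refine (congrArg₂ (· * ·) (happly _ z') (Φ.slope_nextPoint z')).trans ?_
    rw [happly, pow_succ, ← mul_assoc, map_mul _ _ Polynomial.X]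

theorem isFraction_dirDeriv_frame {D : Set M.space.carrier} {f : M.space.carrier → K}
    (hf : M.space.Local D f) {z : Polynomial Φ.R →ₐ[K] K} {a b : Φ.R}
    (hab : IsFraction (fun y => y) Φ.point D f (basePt z) a b) :
    IsFraction (fun z => z) (fun z => z) {z | Φ.point (basePt z) ∈ D}
      (fun z => dirDeriv (Φ.frame j (basePt z) (z Polynomial.X)).1 f) z
      (Polynomial.C b * Φ.nextδ j j (Polynomial.C a) -
        Polynomial.C a * Φ.nextδ j j (Polynomial.C b)) (Polynomial.C b ^ 2) := by
  have hb {z : Polynomial Φ.R →ₐ[K] K} (hz : z (Polynomial.C b ^ 2) ≠ 0) : basePt z b ≠ 0 :=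
    fun h => hz (by simp [h])
  refine ⟨by simpa using hab.ne_zero, fun z hz => hab.mem _ (hb hz), fun z hz => ?_⟩
  have habz : IsFraction (fun y => y) Φ.point D f (basePt z) a b := ⟨hb hz, hab.mem, hab.eq⟩
  rw [dirDeriv_eq _ (hf.mem_regAt (hab.mem _ (hb hz))),
    apply_eq_quotientRule (Φ.frame_mem_tangent _ _ _) _ habz]
  simp only [quotientRule, LinearMap.comp_apply, frame_apply, nextδ_self_C, map_sub, map_mul,
    map_add, map_pow, apply_C]

theorem hasFraction_nextPoint {D : Set M.proj.carrier} {f : M.proj.carrier → K}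
    {z : Polynomial Φ.R →ₐ[K] K} (h : M.proj.Local D f) (hz : Φ.nextPoint j z ∈ D) :
    HasFraction (fun z => z) (Φ.nextPoint j) D f z := by
  refine h.hasFraction ?_ hz
  rintro _ _ (⟨D, f, hf, hDf⟩ | ⟨D, f, E, g, hf, hg, hDf⟩) hzD <;>
    obtain ⟨rfl, rfl⟩ := Prod.mk.inj hDf
  · obtain ⟨a, b, hab⟩ := Φ.hasFraction hf hzD
    exact ⟨Polynomial.C a, Polynomial.C b, hab.ne_zero, fun z' => hab.mem (basePt z'),
      fun z' => hab.eq (basePt z')⟩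
  · obtain ⟨hzD, hzE, hzg⟩ := hzD
    obtain ⟨a, b, hab⟩ := Φ.hasFraction hf hzD
    obtain ⟨a', b', hab'⟩ := Φ.hasFraction hg hzE
    have hinv := (Φ.isFraction_dirDeriv_frame hg hab').inv
      ((dirDeriv_dir_mk_ne_zero_iff _ _ _).1 hzg)
    refine ⟨_, _, ((Φ.isFraction_dirDeriv_frame (j := j) hf hab).mul hinv).congr ?_ ?_⟩
    · rintro z' ⟨hD, hE, hne⟩
      exact ⟨hD, hE, (dirDeriv_dir_mk_ne_zero_iff _ _ _).2 hne⟩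
    · intro z' _
      exact (slope_mk _ _ _ _).trans (div_eq_mul_inv _ _)

variable (j)

/-- The affine chart of the projectivization consisting of the lines on which the `j`th coordinate
does not vanish. -/
abbrev nextAffine : AffineChart.{u, v} M.next.space where
  R := Polynomial Φ.R
  point := Φ.nextPoint j
  injective := Φ.nextPoint_injective
  isOpen_range := Φ.isOpen_range_nextPoint
  extend_mem_regAt := Φ.extend_nextPoint_mem_regAt
  hasFraction := Φ.hasFraction_nextPoint

theorem nextAffine_reg_C {z : Polynomial Φ.R →ₐ[K] K} {w : M.proj.Functional (Φ.nextPoint j z)}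
    (hw : w ∈ M.proj.tangent (Φ.nextPoint j z)) (a : Φ.R) :
    w ((Φ.nextAffine j).reg z (Polynomial.C a)) =
      M.dproj (Φ.nextPoint j z) w (Φ.reg (basePt z) a) := by
  refine tangent_congr hw ?_
  filter_upwards [(Φ.nextAffine j).isOpen_range.mem_nhds ⟨z, rfl⟩]
  rintro _ ⟨z', rfl⟩
  exact ((Φ.nextAffine j).ext_apply (Polynomial.C a) z').trans (Φ.ext_apply a (basePt z')).symm

/-- The chart of the projectivization with its focal bundle on which the `j`th coordinate is
retained. -/
abbrev next : Chart.{u, v} M.next where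
  toAffineChart := Φ.nextAffine j
  X := Φ.nextX j
  δ := Φ.nextδ j
  δ_X := Φ.nextδ_nextX j
  B_le _ := inf_le_left
  mem_B_iff {z w} hw := by
    have hline : M.line (Φ.nextPoint j z) = _ := line_mk _ (Φ.frame_ne_zero _ _ _)
    have hC := Φ.nextAffine_reg_C j hw
    refine (mem_next_B hw).trans <|
      (iff_of_eq (congrArg (M.dproj (Φ.nextPoint j z) w ∈ ·) hline)).trans <|
      (Φ.mem_span_frame_iff (j := j) (c := z Polynomial.X) (dproj_mem_tangent hw)).trans <|
      (forall_congr' fun a => ?_).trans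
      (Φ.forall_eq_sum_nextδ_iff j (comp_reg_mem_pointDerivations hw)).symm
    exact iff_of_eq (congrArg₂ (· = ·) (hC a).symm
      (congrArg (· * _) (hC (Φ.X j)).symm))

end Chart

theorem isStable_span {K : Type u} [Field K] {R : Type*} [CommRing R] [Algebra K R]
    {θ : Derivation K R R} {s : Set R} (h : ∀ a ∈ s, θ a ∈ Ideal.span s) :
    IsStable θ (Ideal.span s) := by
  intro a ha
  induction ha using Submodule.span_induction with
  | mem a ha => exact h a ha
  | zero => rw [map_zero]; exact zero_mem _
  | add a b _ _ ha hb => rw [map_add]; exact add_mem ha hb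
  | smul r a hr ha =>
    rw [smul_eq_mul, Derivation.leibniz, smul_eq_mul, smul_eq_mul]
    exact add_mem (Ideal.mul_mem_left _ _ ha) (Ideal.mul_mem_right _ _ hr)

namespace AffineChart

variable {K : Type u} [Field K] {S : FunSpace.{u, max u v} K} {Φ : AffineChart.{u, v} S}
  {y : Φ.R →ₐ[K] K} {C : Set S.carrier}

theorem mem_tangentTo_iff (hy : Φ.point y ∈ C) {w : S.Functional (Φ.point y)}
    (hw : w ∈ S.tangent (Φ.point y)) : w ∈ S.tangentTo C (Φ.point y) ↔
      ∀ a b, y b ≠ 0 → (∀ z, Φ.point z ∈ C → z b ≠ 0 → z a = 0) → w (Φ.reg y a) = 0 := by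
  constructor
  · intro h a b hb hab
    refine h.2 _ (eventually_nhdsWithin_iff.2 (eventually_of_forall hb fun z hz hzC => ?_))
    simpa using hab z hzC hz
  · refine fun h => ⟨hw, fun f hf => ?_⟩
    obtain ⟨b', hb', hf'⟩ := exists_of_eventually (eventually_nhdsWithin_iff.1 hf)
    obtain ⟨a, b, hab⟩ := hasFraction_of_mem_regAt f.2
    have hvanish (z) (hz : Φ.point z ∈ C) (hzb : z (b * b') ≠ 0) : z a = 0 := by
      rw [map_mul, mul_ne_zero_iff] at hzb
      have hdiv := (hab.eq z hzb.1).symm.trans (hf' z hzb.2 hz)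
      exact (div_eq_zero_iff.1 hdiv).resolve_right hzb.1
    have hbb' : y (b * b') ≠ 0 := by
      rw [map_mul]
      exact mul_ne_zero hab.ne_zero hb'
    rw [apply_eq_quotientRule hw f hab, quotientRule, LinearMap.comp_apply, h a _ hbb' hvanish,
      hvanish y hy hbb', mul_zero, zero_mul, sub_zero, zero_div]

theorem exists_of_mem_closure (hC : Φ.point y ∈ closure C) {b : Φ.R} (hb : y b ≠ 0) :
    ∃ z, Φ.point z ∈ C ∧ z b ≠ 0 := by
  obtain ⟨_, ⟨z, rfl, hz⟩, hC⟩ := mem_closure_iff_nhds.1 hC _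
    (eventually_of_forall (p := fun q => ∃ z, Φ.point z = q ∧ z b ≠ 0) hb fun z hz => ⟨z, rfl, hz⟩)
  exact ⟨z, hC, hz⟩

end AffineChart

namespace Chart

variable {K : Type u} [Field K] {M : Distribution.{u, max u v} K} (Φ : Chart.{u, v} M)

theorem line_nextPoint_eq_span_iff [IsAlgClosed K] [CharZero K] {j : Fin 2}
    {z : Polynomial Φ.R →ₐ[K] K} {w : M.space.Functional (Φ.point (basePt z))}
    (hw : w ∈ M.B (Φ.point (basePt z))) (hX : w (Φ.reg _ (Φ.X j)) ≠ 0) :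
    M.line (Φ.nextPoint j z) = Submodule.span K {w} ↔
      w (Φ.reg _ (Φ.X (j + 1))) = w (Φ.reg _ (Φ.X j)) * z Polynomial.X := by
  rw [line_mk _ (Φ.frame_ne_zero _ _ _)]
  constructor
  · intro h
    obtain ⟨c, hc⟩ := Submodule.mem_span_singleton.1 (h ▸ Submodule.mem_span_singleton_self w)
    rw [← hc, LinearMap.smul_apply, LinearMap.smul_apply, frame_apply_X, frame_apply_X_add_one,
      smul_eq_mul, smul_eq_mul, mul_one]
  · intro h
    rw [Φ.eq_smul_frame hw h, Submodule.span_singleton_smul_eq (IsUnit.mk0 _ hX)]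

/-- The Euler derivation of a chart: it multiplies the coordinates by the weights `m`. -/
def euler (m : Fin 2 → ℤ) : Derivation K Φ.R Φ.R := ∑ b, ((m b : Φ.R) * Φ.X b) • Φ.δ b

theorem euler_apply (m : Fin 2 → ℤ) (j : Fin 2) (a : Φ.R) :
    Φ.euler m a = m j * Φ.X j * Φ.δ j a + m (j + 1) * Φ.X (j + 1) * Φ.δ (j + 1) a := by
  simp [euler, sum_fin_two_eq_add j]

@[simp] theorem euler_X (m : Fin 2 → ℤ) (b : Fin 2) : Φ.euler m (Φ.X b) = m b * Φ.X b := by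
  simp [Φ.euler_apply m b, Φ.δ_X]

end Chart

/-! ### Charts of a family of curves -/

/-- A chart in which a family of curves `C t`, `t ≠ 0`, has a simple form. Its total space is the
zero locus of `ideal`, on which `param` is the parameter `t` of the family and `η` are derivations
dual to the coordinates. The curves are tangent to a diagonal vector field with weights of opposite
signs, and the parameter vanishes exactly where one of the coordinates does. -/
structure FamChart {K : Type u} [Field K] (M : Distribution.{u, max u v} K)
    (C : K → Set M.space.carrier) extends Chart.{u, v} M where
  weight : Fin 2 → ℤ
  weight_pos : 0 < weight 0
  weight_neg : weight 1 < 0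
  ideal : Ideal R
  param : R
  η : Fin 2 → Derivation K R R
  η_X : ∀ a b, η a (X b) = if a = b then 1 else 0
  isStable_η : ∀ b, IsStable (η b) ideal
  isStable_euler : IsStable (toChart.euler weight) ideal
  euler_param : toChart.euler weight param ∈ ideal
  unramified : ∀ y ∈ zeroLocus K ideal, y param ≠ 0 → ∀ d ∈ pointDerivations y,
    (∀ a ∈ ideal, d a = 0) → d param = 0 →
      ∃ c : K, d = c • (y.toLinearMap ∘ₗ (toChart.euler weight).toLinearMap)
  param_eq_zero_iff : ∀ y ∈ zeroLocus K ideal, y param = 0 ↔ ∃ b, y (X b) = 0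
  mem_curve_iff : ∀ t ≠ 0, ∀ y : R →ₐ[K] K, point y ∈ C t ↔ y ∈ zeroLocus K ideal ∧ y param = t

namespace FamChart

variable {K : Type u} [Field K] {M : Distribution.{u, max u v} K}
  {C : K → Set M.space.carrier} (Φ : FamChart.{u, v} M C)

theorem weight_ne_zero (b : Fin 2) : Φ.weight b ≠ 0 := by
  fin_cases b
  exacts [Φ.weight_pos.ne', Φ.weight_neg.ne]

section Tangent

variable {Φ} {t : K} {y : Φ.R →ₐ[K] K} {e : M.space.Functional (Φ.point y)}

theorem tangentTo_le_span (ht : t ≠ 0) (hy : Φ.point y ∈ C t) (he : e ∈ M.space.tangent (Φ.point y))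
    (heuler : ∀ a, e (Φ.reg y a) = y (Φ.euler Φ.weight a)) :
    M.space.tangentTo (C t) (Φ.point y) ≤ Submodule.span K {e} := by
  intro w hw
  have hd := comp_reg_mem_pointDerivations hw.1
  have hvanish (a) (ha : ∀ z, Φ.point z ∈ C t → z a = 0) : w (Φ.reg y a) = 0 :=
    (mem_tangentTo_iff hy hw.1).1 hw a 1 (by simp) fun z hz _ => ha z hz
  obtain ⟨hyJ, hyt⟩ := (Φ.mem_curve_iff t ht y).1 hy
  have hparam : w (Φ.reg y Φ.param) = 0 := by
    have hsub := hvanish (Φ.param - t • 1) fun z hz => by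
      simp [((Φ.mem_curve_iff t ht z).1 hz).2]
    rwa [map_sub, map_sub, map_smul, map_smul, ← LinearMap.comp_apply w _ 1,
      pointDerivations_one hd, smul_zero, sub_zero] at hsub
  obtain ⟨c, hc⟩ := Φ.unramified y hyJ (hyt ▸ ht) (w ∘ₗ Φ.reg y) hd
    (fun a ha => hvanish a fun z hz => ((Φ.mem_curve_iff t ht z).1 hz).1 a ha) hparam
  refine Submodule.mem_span_singleton.2
    ⟨c, tangent_ext (Submodule.smul_mem _ _ he) hw.1 fun a => ?_⟩
  rw [LinearMap.smul_apply, heuler]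
  exact (LinearMap.congr_fun hc a).symm

variable [IsAlgClosed K] [CharZero K]

theorem mem_tangentTo (ht : t ≠ 0) (hy : Φ.point y ∈ C t) (he : e ∈ M.space.tangent (Φ.point y))
    (heuler : ∀ a, e (Φ.reg y a) = y (Φ.euler Φ.weight a)) :
    e ∈ M.space.tangentTo (C t) (Φ.point y) := by
  set I : Ideal Φ.R := Ideal.span (insert (Φ.param - algebraMap K Φ.R t) Φ.ideal)
  have hI : Φ.ideal ≤ I := fun a ha => Ideal.subset_span (Set.mem_insert_of_mem _ ha)
  have hmem (z : Φ.R →ₐ[K] K) : z ∈ zeroLocus K I ↔ Φ.point z ∈ C t := by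
    rw [mem_zeroLocus_span, Set.forall_mem_insert, Φ.mem_curve_iff t ht, map_sub, AlgHom.commutes,
      sub_eq_zero, and_comm]
    rfl
  have hstable : IsStable (Φ.euler Φ.weight) I := by
    refine isStable_span (Set.forall_mem_insert.2 ⟨?_, fun a ha => hI (Φ.isStable_euler a ha)⟩)
    rw [map_sub, Derivation.map_algebraMap, sub_zero]
    exact hI Φ.euler_param
  refine (mem_tangentTo_iff hy he).2 fun a b hb hab => ?_
  rw [heuler]
  exact hstable.apply_eq_zero ((hmem y).2 hy) hb fun z hz => hab z ((hmem z).1 hz)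

theorem line_nextPoint_eq_tangentTo_iff {j : Fin 2} {z : Polynomial Φ.R →ₐ[K] K} (ht : t ≠ 0)
    (hz : Φ.point (basePt z) ∈ C t) :
    M.line (Φ.nextPoint j z) = M.space.tangentTo (C t) (Φ.point (basePt z)) ↔
      Φ.weight (j + 1) * basePt z (Φ.X (j + 1)) =
        Φ.weight j * basePt z (Φ.X j) * z Polynomial.X := by
  obtain ⟨e, he, heuler⟩ := exists_tangent (basePt z) (Φ.euler Φ.weight)
  obtain ⟨hzJ, hzt⟩ := (Φ.mem_curve_iff t ht _).1 hz
  have hX (b) : e (Φ.reg _ (Φ.X b)) = Φ.weight b * basePt z (Φ.X b) := by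
    rw [heuler, Chart.euler_X, map_mul, map_intCast]
  have heB : e ∈ M.B (Φ.point (basePt z)) := (Φ.mem_B_iff he).2 fun a => by
    rw [heuler, Φ.euler_apply _ 0, Fin.sum_univ_two, hX, hX]
    simp only [map_add, map_mul, map_intCast, zero_add]
  have hXj : e (Φ.reg _ (Φ.X j)) ≠ 0 := by
    rw [hX]
    refine mul_ne_zero (Int.cast_ne_zero.2 (Φ.weight_ne_zero j)) fun h => ht ?_
    rw [← hzt, (Φ.param_eq_zero_iff _ hzJ).2 ⟨j, h⟩]
  rw [le_antisymm (tangentTo_le_span ht hz he heuler)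
    ((Submodule.span_singleton_le_iff_mem _ _).2 (mem_tangentTo ht hz he heuler)),
    Φ.line_nextPoint_eq_span_iff heB hXj, hX, hX]

end Tangent

section Next

variable (j : Fin 2)

/-- The weights of the coordinates of the `j`th chart of the prolongation. -/
def nextWeight (b : Fin 2) : ℤ := if b = j then Φ.weight j else Φ.weight (j + 1) - Φ.weight j

/-- The slope of the diagonal vector field: along the curves of the family, the new coordinate `X`
satisfies `weight j * X j * X = weight (j + 1) * X (j + 1)`. -/
def relation : Polynomial Φ.R :=
  Polynomial.C (Φ.weight j * Φ.X j) * Polynomial.X -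
    Polynomial.C (Φ.weight (j + 1) * Φ.X (j + 1))

/-- The ideal of the total space of the prolonged family. -/
def nextIdeal : Ideal (Polynomial Φ.R) :=
  Ideal.span (insert (Φ.relation j) (Polynomial.C '' Φ.ideal))

/-- The quotient of the weights, by which `η` has to be corrected in order to preserve
`nextIdeal`. -/
def ratio : Polynomial Φ.R := algebraMap K _ ((Φ.weight j : K) / Φ.weight (j + 1))

/-- The derivations dual to the coordinates on the total space of the prolonged family: the
coordinate `X (j + 1)` is eliminated by means of `relation`. -/
def nextη (b : Fin 2) : Derivation K (Polynomial Φ.R) (Polynomial Φ.R) :=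
  if b = j then coeffDer (Φ.η j) + (Φ.ratio j * Polynomial.X) • coeffDer (Φ.η (j + 1))
  else (Φ.ratio j * Polynomial.C (Φ.X j)) • coeffDer (Φ.η (j + 1)) + varDer

variable {j}

@[simp] theorem nextWeight_self : Φ.nextWeight j j = Φ.weight j := by simp [nextWeight]

@[simp] theorem nextWeight_add_one :
    Φ.nextWeight j (j + 1) = Φ.weight (j + 1) - Φ.weight j := by simp [nextWeight]

theorem mem_zeroLocus_nextIdeal {z : Polynomial Φ.R →ₐ[K] K} :
    z ∈ zeroLocus K (Φ.nextIdeal j) ↔ basePt z ∈ zeroLocus K Φ.ideal ∧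
      Φ.weight j * basePt z (Φ.X j) * z Polynomial.X =
        Φ.weight (j + 1) * basePt z (Φ.X (j + 1)) := by
  rw [nextIdeal, mem_zeroLocus_span, Set.forall_mem_insert, Set.forall_mem_image, and_comm,
    relation, map_sub, sub_eq_zero]
  simp only [map_mul, apply_C, map_intCast]
  rfl

theorem relation_mem_nextIdeal : Φ.relation j ∈ Φ.nextIdeal j :=
  Ideal.subset_span (Set.mem_insert _ _)

theorem C_mem_nextIdeal {a : Φ.R} (ha : a ∈ Φ.ideal) : Polynomial.C a ∈ Φ.nextIdeal j :=
  Ideal.subset_span (Set.mem_insert_of_mem _ ⟨a, ha, rfl⟩)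

theorem nextη_self (P : Polynomial Φ.R) : Φ.nextη j j P =
    coeffDer (Φ.η j) P + Φ.ratio j * Polynomial.X * coeffDer (Φ.η (j + 1)) P := by
  simp [nextη]

theorem nextη_add_one (P : Polynomial Φ.R) : Φ.nextη j (j + 1) P =
    Φ.ratio j * Polynomial.C (Φ.X j) * coeffDer (Φ.η (j + 1)) P + varDer (K := K) P := by
  simp [nextη]

theorem nextη_nextX (j a b : Fin 2) :
    Φ.nextη j a (Φ.nextX j b) = if a = b then 1 else 0 := by
  obtain rfl | rfl := eq_or_add_one_eq j a <;> obtain rfl | rfl := eq_or_add_one_eq j b <;>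
    simp [nextη_self, nextη_add_one, Φ.η_X]

theorem ratio_mul [CharZero K] :
    Φ.ratio j * (Φ.weight (j + 1) : Polynomial Φ.R) = (Φ.weight j : Polynomial Φ.R) := by
  have hw : (Φ.weight (j + 1) : K) ≠ 0 := Int.cast_ne_zero.2 (Φ.weight_ne_zero _)
  rw [ratio, ← map_intCast (algebraMap K (Polynomial Φ.R)), ← map_mul, div_mul_cancel₀ _ hw,
    map_intCast]

theorem nextη_relation [CharZero K] (j b : Fin 2) : Φ.nextη j b (Φ.relation j) = 0 := by
  have h := Φ.ratio_mul (j := j)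
  obtain rfl | rfl := eq_or_add_one_eq j b
  · rw [nextη_self, relation]
    simp only [map_sub, map_mul, map_intCast, Derivation.leibniz, Derivation.map_intCast,
      coeffDer_C, coeffDer_X, Φ.η_X, (add_one_ne j).symm, add_one_ne j, if_true, if_false,
      smul_eq_mul, mul_one, mul_zero, add_zero, zero_add, sub_zero, zero_sub, map_one, map_zero]
    linear_combination (-Polynomial.X) * h
  · rw [nextη_add_one, relation]
    simp only [map_sub, map_mul, map_intCast, Derivation.leibniz, Derivation.map_intCast,
      coeffDer_C, coeffDer_X, varDer_C, varDer_X, Φ.η_X, add_one_ne j, if_true, if_false,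
      smul_eq_mul, mul_one, mul_zero, add_zero, sub_zero, zero_sub, map_one, map_zero]
    linear_combination (-Polynomial.C (Φ.X j)) * h

theorem isStable_nextη [CharZero K] (j b : Fin 2) : IsStable (Φ.nextη j b) (Φ.nextIdeal j) := by
  refine isStable_span (Set.forall_mem_insert.2 ⟨?_, Set.forall_mem_image.2 fun a ha => ?_⟩)
  · rw [nextη_relation]
    exact zero_mem _
  · have hη (i) : Polynomial.C (Φ.η i a) ∈ Φ.nextIdeal j :=
      Φ.C_mem_nextIdeal (Φ.isStable_η i a ha)
    obtain rfl | rfl := eq_or_add_one_eq j b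
    · rw [nextη_self, coeffDer_C, coeffDer_C]
      exact add_mem (hη j) (Ideal.mul_mem_left _ _ (hη (j + 1)))
    · rw [nextη_add_one, coeffDer_C, varDer_C, add_zero]
      exact Ideal.mul_mem_left _ _ (hη (j + 1))

theorem next_param_eq_zero_iff [CharZero K] (z : Polynomial Φ.R →ₐ[K] K)
    (hz : z ∈ zeroLocus K (Φ.nextIdeal j)) :
    z (Polynomial.C Φ.param) = 0 ↔ ∃ b, z (Φ.nextX j b) = 0 := by
  obtain ⟨hzJ, hrel⟩ := Φ.mem_zeroLocus_nextIdeal.1 hz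
  have hw (b) : (Φ.weight b : K) ≠ 0 := Int.cast_ne_zero.2 (Φ.weight_ne_zero b)
  rw [apply_C, Φ.param_eq_zero_iff _ hzJ, exists_fin_two_iff j, exists_fin_two_iff j,
    Chart.nextX_self, Chart.nextX_add_one, apply_C]
  have hiff (h : basePt z (Φ.X j) ≠ 0) : basePt z (Φ.X (j + 1)) = 0 ↔ z Polynomial.X = 0 := by
    rw [← mul_eq_zero_iff_left (hw (j + 1)), ← hrel, mul_eq_zero_iff_left (mul_ne_zero (hw j) h)]
  tauto

variable [IsAlgClosed K] [CharZero K]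

theorem next_euler (j : Fin 2) (P : Polynomial Φ.R) :
    (Φ.toChart.next j).euler (Φ.nextWeight j) P =
      (Φ.weight j : Polynomial Φ.R) * Polynomial.C (Φ.X j) * Φ.nextδ j j P +
        ((Φ.weight (j + 1) : Polynomial Φ.R) - (Φ.weight j : Polynomial Φ.R)) * Polynomial.X *
          Φ.nextδ j (j + 1) P := by
  refine (Chart.euler_apply (Φ.toChart.next j) _ j P).trans ?_
  change _ * Φ.nextX j j * _ + _ * Φ.nextX j (j + 1) * _ = _
  rw [nextWeight_self, nextWeight_add_one, Chart.nextX_self, Chart.nextX_add_one, Int.cast_sub]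

theorem next_euler_C (j : Fin 2) (a : Φ.R) :
    (Φ.toChart.next j).euler (Φ.nextWeight j) (Polynomial.C a) =
      Polynomial.C (Φ.euler Φ.weight a) + Φ.relation j * Polynomial.C (Φ.δ (j + 1) a) := by
  rw [next_euler, Φ.euler_apply _ j, Chart.nextδ_self_C, Chart.nextδ_add_one_C, relation]
  simp only [map_add, map_mul, map_intCast]
  ring

theorem next_euler_X (j : Fin 2) :
    (Φ.toChart.next j).euler (Φ.nextWeight j) Polynomial.X =
      ((Φ.weight (j + 1) : Polynomial Φ.R) - (Φ.weight j : Polynomial Φ.R)) * Polynomial.X := by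
  rw [next_euler, Chart.nextδ_self_X, Chart.nextδ_add_one_X, mul_zero, zero_add, mul_one]

theorem next_euler_relation (j : Fin 2) :
    (Φ.toChart.next j).euler (Φ.nextWeight j) (Φ.relation j) = 0 := by
  rw [next_euler, relation]
  simp only [map_mul, map_sub, map_intCast, Derivation.leibniz, Derivation.map_intCast,
    Chart.nextδ_self_C, Chart.nextδ_self_X, Chart.nextδ_add_one_C, Chart.nextδ_add_one_X,
    smul_eq_mul, Φ.δ_X, add_one_ne, (add_one_ne j).symm, if_true, if_false, map_zero, map_one]
  ring

theorem isStable_next_euler (j : Fin 2) :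
    IsStable ((Φ.toChart.next j).euler (Φ.nextWeight j)) (Φ.nextIdeal j) := by
  refine isStable_span (Set.forall_mem_insert.2 ⟨?_, Set.forall_mem_image.2 fun a ha => ?_⟩)
  · rw [next_euler_relation]
    exact zero_mem _
  · rw [next_euler_C]
    exact add_mem (Φ.C_mem_nextIdeal (Φ.isStable_euler a ha))
      (Ideal.mul_mem_right _ _ Φ.relation_mem_nextIdeal)

theorem next_unramified (z : Polynomial Φ.R →ₐ[K] K) (hz : z ∈ zeroLocus K (Φ.nextIdeal j))
    (ht : z (Polynomial.C Φ.param) ≠ 0) (d : Polynomial Φ.R →ₗ[K] K)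
    (hd : d ∈ pointDerivations z) (hdJ : ∀ a ∈ Φ.nextIdeal j, d a = 0)
    (hdt : d (Polynomial.C Φ.param) = 0) : ∃ c : K, d = c • (z.toLinearMap ∘ₗ
      ((Φ.toChart.next j).euler (Φ.nextWeight j)).toLinearMap) := by
  obtain ⟨hzJ, hrel⟩ := Φ.mem_zeroLocus_nextIdeal.1 hz
  obtain ⟨c, hc⟩ := Φ.unramified (basePt z) hzJ ht (d ∘ₗ Polynomial.CAlgHom.toLinearMap)
    (fun a b => by simpa using hd (Polynomial.C a) (Polynomial.C b))
    (fun a ha => hdJ _ (Φ.C_mem_nextIdeal ha)) hdt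
  have hdC (a) : d (Polynomial.C a) = c * basePt z (Φ.euler Φ.weight a) := LinearMap.congr_fun hc a
  refine ⟨c, pointDerivations_polynomial_ext hd
    (Submodule.smul_mem _ c (comp_mem_pointDerivations z _)) (fun a => ?_) ?_⟩
  · refine (hdC a).trans (congrArg (c * ·) ?_)
    refine Eq.trans ?_ (congrArg z (Φ.next_euler_C j a)).symm
    rw [map_add, map_mul, hz _ Φ.relation_mem_nextIdeal, zero_mul, add_zero, apply_C]
  · refine Eq.trans ?_ (congrArg (c * z ·) (Φ.next_euler_X j)).symm
    have hXj : basePt z (Φ.X j) ≠ 0 := fun h => ht ((Φ.param_eq_zero_iff _ hzJ).2 ⟨j, h⟩)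
    have hdrel := hdJ _ (Φ.relation_mem_nextIdeal (j := j))
    rw [relation, map_sub, hd, hdC, hdC] at hdrel
    simp only [Derivation.leibniz, Chart.euler_X, smul_eq_mul, Derivation.map_intCast, apply_C,
      map_mul, map_intCast, mul_zero, add_zero] at hdrel
    simp only [map_mul, map_sub, map_intCast]
    refine mul_left_cancel₀ (mul_ne_zero (Int.cast_ne_zero.2 (Φ.weight_ne_zero j)) hXj) ?_
    linear_combination hdrel - c * Φ.weight (j + 1) * hrel

theorem tangent_line_iff {t : K} (ht : t ≠ 0) (z : Polynomial Φ.R →ₐ[K] K) :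
    (Φ.point (basePt z) ∈ C t ∧
      M.line (Φ.nextPoint j z) = M.space.tangentTo (C t) (Φ.point (basePt z))) ↔
      z ∈ zeroLocus K (Φ.nextIdeal j) ∧ z (Polynomial.C Φ.param) = t := by
  rw [Φ.mem_zeroLocus_nextIdeal, apply_C, and_right_comm, ← Φ.mem_curve_iff t ht]
  exact and_congr_right fun hz => (line_nextPoint_eq_tangentTo_iff ht hz).trans eq_comm

theorem next_mem_curve_iff (t : K) (ht : t ≠ 0) (z : Polynomial Φ.R →ₐ[K] K) :
    Φ.nextPoint j z ∈ M.lift (C t) ↔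
      z ∈ zeroLocus K (Φ.nextIdeal j) ∧ z (Polynomial.C Φ.param) = t := by
  refine ⟨fun h => ?_, fun h => subset_closure ((Φ.tangent_line_iff ht z).2 h)⟩
  have hclosed (P : Polynomial Φ.R) (hP : ∀ z' : Polynomial Φ.R →ₐ[K] K,
      z' ∈ zeroLocus K (Φ.nextIdeal j) ∧ z' (Polynomial.C Φ.param) = t → z' P = 0) : z P = 0 := by
    by_contra h0
    obtain ⟨z', hz', hz0⟩ := exists_of_mem_closure (Φ := Φ.nextAffine j) h h0
    exact hz0 (hP z' ((Φ.tangent_line_iff ht z').1 hz'))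
  have hparam := hclosed (Polynomial.C Φ.param - algebraMap K _ t) fun z' hz' => by
    rw [map_sub, hz'.2, AlgHom.commutes]
    exact sub_self t
  rw [map_sub, AlgHom.commutes, sub_eq_zero] at hparam
  exact ⟨fun a ha => hclosed a fun z' hz' => hz'.1 a ha, hparam⟩

variable (j)

/-- The chart of the prolonged family on which the `j`th coordinate is retained. -/
abbrev next : FamChart.{u, v} M.next (fun t => M.lift (C t)) where
  toChart := Φ.toChart.next j
  weight := Φ.nextWeight j
  weight_pos := match j with
    | 0 => by simpa [nextWeight] using Φ.weight_pos
    | 1 => by simpa [nextWeight] using Φ.weight_neg.trans Φ.weight_pos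
  weight_neg := match j with
    | 0 => by simpa [nextWeight] using Φ.weight_neg.trans Φ.weight_pos
    | 1 => by simpa [nextWeight] using Φ.weight_neg
  ideal := Φ.nextIdeal j
  param := Polynomial.C Φ.param
  η := Φ.nextη j
  η_X := Φ.nextη_nextX j
  isStable_η := Φ.isStable_nextη j
  isStable_euler := Φ.isStable_next_euler j
  euler_param := by
    rw [next_euler_C]
    exact add_mem (Φ.C_mem_nextIdeal Φ.euler_param)
      (Ideal.mul_mem_right _ _ Φ.relation_mem_nextIdeal)
  unramified := Φ.next_unramified
  param_eq_zero_iff := Φ.next_param_eq_zero_iff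
  mem_curve_iff := Φ.next_mem_curve_iff

end Next

end FamChart

/-! ### Axes and fibres in the charts -/

section Evaluation

variable {K : Type u} [Field K] {R : Type v} [CommRing R] [Algebra K R] {z : Polynomial R →ₐ[K] K}

theorem apply_eq_coeff_zero (hz : z Polynomial.X = 0) (P : Polynomial R) :
    z P = basePt z (P.coeff 0) := by
  conv_lhs => rw [← P.divX_mul_X_add]
  rw [map_add, map_mul, hz, mul_zero, zero_add, apply_C]

theorem extPt_zero_apply (y : R →ₐ[K] K) (P : Polynomial R) : extPt y 0 P = y (P.coeff 0) := by
  rw [apply_eq_coeff_zero (extPt_X y 0), basePt_extPt]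

theorem apply_eq_eval_map (z : Polynomial R →ₐ[K] K) (P : Polynomial R) :
    z P = (P.map (basePt z : R →+* K)).eval (z Polynomial.X) := by
  conv_lhs => rw [← extPt_basePt z]
  rw [Polynomial.eval_map]
  rfl

theorem extPt_apply_eq_eval_map (y : R →ₐ[K] K) (c : K) (P : Polynomial R) :
    extPt y c P = (P.map (y : R →+* K)).eval c := by
  rw [apply_eq_eval_map, basePt_extPt, extPt_X]

theorem exists_eval_ne_zero [Infinite K] {p : Polynomial K} (hp : p ≠ 0) : ∃ c, p.eval c ≠ 0 := by
  by_contra! h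
  exact hp (Polynomial.funext fun c => by rw [h, Polynomial.eval_zero])

end Evaluation

namespace Distribution

variable {K : Type u} [Field K] {M : Distribution.{u, max u v} K}

/-- The projection from the projectivization. -/
def fst (M : Distribution.{u, max u v} K) (r : M.next.space.carrier) : M.space.carrier :=
  Sigma.fst (β := fun x => ℙ K (M.B x)) r

theorem isMorphismOn_fst (W : Set M.next.space.carrier) :
    IsMorphismOn (X := M.next.space) (Y := M.space) M.fst W :=
  ⟨continuous_fst.continuousOn, fun r _ g hg =>
    ⟨_, M.comp_fst_mem_regAt r ⟨g, hg⟩, Filter.Eventually.of_forall fun _ => rfl⟩⟩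

/-- The lift of a nonsingular curve `Z`: its tangent lines, without passing to the closure as in
`Distribution.lift`. -/
def tangentLift (M : Distribution.{u, max u v} K) (Z : Set M.space.carrier) :
    Set M.next.space.carrier :=
  {r | M.fst r ∈ Z ∧ M.line r = M.space.tangentTo Z (M.fst r)}

theorem tangentLift_injOn (Z : Set M.space.carrier) : Set.InjOn (fst M) (M.tangentLift Z) := by
  rintro ⟨x, ℓ⟩ ⟨-, h⟩ ⟨x', ℓ'⟩ ⟨-, h'⟩ (rfl : x = x')
  exact points_ext rfl (heq_of_eq (h.trans h'.symm))

end Distribution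

namespace Chart

variable {K : Type u} [Field K] {M : Distribution.{u, max u v} K}
  (Φ : Chart.{u, v} M)

/-- In the chart, the set `Z` is contained in the zero locus of the `i`th coordinate, and it is a
nonsingular curve whose tangent lines lie in the distribution. -/
def IsAxis (Z : Set M.space.carrier) (i : Fin 2) : Prop :=
  ∀ y, Φ.point y ∈ Z → y (Φ.X i) = 0 ∧
    ∀ w, w ∈ M.space.tangentTo Z (Φ.point y) ↔ w ∈ M.B (Φ.point y) ∧ w (Φ.reg y (Φ.X i)) = 0

variable [IsAlgClosed K] [CharZero K] {Φ} {Z : Set M.space.carrier} {j : Fin 2}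

theorem mk_mem_range_nextPoint {y : Φ.R →ₐ[K] K} {ℓ : ℙ K (M.B (Φ.point y))} :
    (⟨Φ.point y, ℓ⟩ : M.Points) ∈ Set.range (Φ.nextPoint j) ↔
      M.dir ⟨Φ.point y, ℓ⟩ (Φ.reg y (Φ.X j)) ≠ 0 := by
  refine Φ.mem_range_nextPoint.trans ?_
  rw [and_iff_right ⟨y, rfl⟩, dirDeriv_eq _ (Φ.ext_mem_regAt _ _)]
  rfl

theorem exists_mem_range_nextPoint {r : M.next.space.carrier} (hr : M.fst r ∈ Set.range Φ.point) :
    ∃ j, r ∈ Set.range (Φ.nextPoint j) := by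
  obtain ⟨x, ℓ⟩ := r
  obtain ⟨y, rfl : Φ.point y = x⟩ := hr
  by_contra! h
  have hdir : M.dir ⟨Φ.point y, ℓ⟩ = 0 := Φ.B_ext (dir_mem ⟨Φ.point y, ℓ⟩) (zero_mem _) fun b =>
    not_not.1 (mt mk_mem_range_nextPoint.2 (h b))
  exact ℓ.rep_nonzero (Subtype.ext hdir)

theorem nextPoint_mem_range_add_one {z : Polynomial Φ.R →ₐ[K] K} :
    Φ.nextPoint j z ∈ Set.range (Φ.nextPoint (j + 1)) ↔ z Polynomial.X ≠ 0 := by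
  rw [mem_range_nextPoint, and_iff_right ⟨_, rfl⟩, dirDeriv_dir_mk_ne_zero_iff,
    dirDeriv_eq _ (Φ.ext_mem_regAt _ _)]
  exact not_congr (Eq.congr_left (Φ.frame_apply_X_add_one _ _ _))

theorem nextPoint_mem_fiber {y : Φ.R →ₐ[K] K} {z : Polynomial Φ.R →ₐ[K] K} :
    Φ.nextPoint j z ∈ M.fst ⁻¹' {Φ.point y} ↔ basePt z = y :=
  Φ.injective.eq_iff

section Axis

theorem IsAxis.tangentTo_eq (h : Φ.IsAxis Z (j + 1)) {y : Φ.R →ₐ[K] K} (hy : Φ.point y ∈ Z) :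
    M.space.tangentTo Z (Φ.point y) = Submodule.span K {(Φ.frame j y 0).1} := by
  ext w
  rw [(h y hy).2, Submodule.mem_span_singleton]
  constructor
  · rintro ⟨hw, h0⟩
    exact ⟨_, (Φ.eq_smul_frame hw (by rw [h0, mul_zero])).symm⟩
  · rintro ⟨c, rfl⟩
    refine ⟨Submodule.smul_mem _ _ (Φ.frame j y 0).2, ?_⟩
    rw [LinearMap.smul_apply, frame_apply_X_add_one, smul_zero]

theorem IsAxis.nextPoint_mem_tangentLift (h : Φ.IsAxis Z (j + 1)) {z : Polynomial Φ.R →ₐ[K] K} :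
    Φ.nextPoint j z ∈ M.tangentLift Z ↔ Φ.point (basePt z) ∈ Z ∧ z Polynomial.X = 0 := by
  refine and_congr_right fun hz => ?_
  change M.line (Φ.nextPoint j z) = M.space.tangentTo Z (Φ.point (basePt z)) ↔ _
  rw [h.tangentTo_eq hz, line_nextPoint_eq_span_iff _ (Φ.frame j (basePt z) 0).2
    ((Φ.frame_apply_X _ _ _).trans_ne one_ne_zero), frame_apply_X, frame_apply_X_add_one, one_mul]
  exact eq_comm

theorem IsAxis.mem_range_of_mem_tangentLift (h : Φ.IsAxis Z (j + 1)) {r : M.next.space.carrier}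
    (hr : r ∈ M.tangentLift Z) (hfst : M.fst r ∈ Set.range Φ.point) :
    r ∈ Set.range (Φ.nextPoint j) := by
  obtain ⟨x, ℓ⟩ := r
  obtain ⟨y, rfl : Φ.point y = x⟩ := hfst
  obtain ⟨hZ, hline⟩ := hr
  have hdir : M.dir ⟨Φ.point y, ℓ⟩ ∈ M.space.tangentTo Z (Φ.point y) := by
    refine hline.le ?_
    rw [line_eq_span]
    exact Submodule.mem_span_singleton_self _
  have hdirX := (((h y hZ).2 _).1 hdir).2
  obtain ⟨b, hb⟩ := exists_mem_range_nextPoint (Φ := Φ) (r := ⟨Φ.point y, ℓ⟩) ⟨y, rfl⟩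
  obtain rfl | rfl := eq_or_add_one_eq j b
  · exact hb
  · exact absurd hdirX (mk_mem_range_nextPoint.1 hb)

theorem IsAxis.eq_nextPoint_of_mem_tangentLift (h : Φ.IsAxis Z (j + 1))
    {r : M.next.space.carrier} (hr : r ∈ M.tangentLift Z) {y : Φ.R →ₐ[K] K}
    (hfst : M.fst r = Φ.point y) : r = Φ.nextPoint j (extPt y 0) := by
  obtain ⟨z, rfl⟩ := h.mem_range_of_mem_tangentLift hr ⟨y, hfst.symm⟩
  rw [← Φ.injective hfst, ← (h.nextPoint_mem_tangentLift.1 hr).2, extPt_basePt]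

theorem IsAxis.nextPoint_extPt_mem (h : Φ.IsAxis Z (j + 1)) {y : Φ.R →ₐ[K] K}
    (hy : Φ.point y ∈ Z) : Φ.nextPoint j (extPt y 0) ∈ M.tangentLift Z :=
  h.nextPoint_mem_tangentLift.2 ⟨by rwa [basePt_extPt], extPt_X y 0⟩

variable {z : Polynomial Φ.R →ₐ[K] K} {w : M.next.space.Functional (Φ.nextPoint j z)}

theorem IsAxis.dproj_mem_tangentTo (h : Φ.IsAxis Z (j + 1))
    (hz : Φ.nextPoint j z ∈ M.tangentLift Z)
    (hw : w ∈ M.next.space.tangentTo (M.tangentLift Z) (Φ.nextPoint j z)) :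
    M.dproj (Φ.nextPoint j z) w ∈ M.space.tangentTo Z (Φ.point (basePt z)) := by
  have hwt := (mem_tangentTo_iff (Φ := Φ.nextAffine j) hz hw.1).1 hw
  refine (mem_tangentTo_iff hz.1 (dproj_mem_tangent hw.1)).2 fun a b hb hab => ?_
  rw [← Φ.nextAffine_reg_C j hw.1]
  exact hwt (Polynomial.C a) (Polynomial.C b) hb fun z' hz' hzb =>
    hab _ (h.nextPoint_mem_tangentLift.1 hz').1 hzb

theorem IsAxis.mem_tangentTo_tangentLift (h : Φ.IsAxis Z (j + 1))
    (hz : Φ.nextPoint j z ∈ M.tangentLift Z) (hw : w ∈ M.next.space.tangent (Φ.nextPoint j z))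
    (hproj : M.dproj (Φ.nextPoint j z) w ∈ M.space.tangentTo Z (Φ.point (basePt z)))
    (hX : w ((Φ.nextAffine j).reg z Polynomial.X) = 0) :
    w ∈ M.next.space.tangentTo (M.tangentLift Z) (Φ.nextPoint j z) := by
  have hzX := (h.nextPoint_mem_tangentLift.1 hz).2
  refine (mem_tangentTo_iff (Φ := Φ.nextAffine j) hz hw).2 fun P Q hQ hPQ => ?_
  have hcoeff : w ((Φ.nextAffine j).reg z P) =
      M.dproj (Φ.nextPoint j z) w (Φ.reg (basePt z) (P.coeff 0)) := by
    have hmul := comp_reg_mem_pointDerivations (Φ := Φ.nextAffine j) hw P.divX Polynomial.X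
    rw [← Φ.nextAffine_reg_C j hw]
    conv_lhs => rw [← P.divX_mul_X_add]
    rw [map_add, map_add]
    refine add_eq_right.2 (hmul.trans ?_)
    rw [LinearMap.comp_apply, hX, hzX, mul_zero, zero_mul, zero_add]
  rw [hcoeff]
  refine (mem_tangentTo_iff hz.1 hproj.1).1 hproj _ (Q.coeff 0) ?_ fun y hy hyQ => ?_
  · rwa [← apply_eq_coeff_zero hzX]
  · have hy0 := hPQ (extPt y 0) (h.nextPoint_extPt_mem hy)
    rw [extPt_zero_apply, extPt_zero_apply] at hy0
    exact hy0 hyQ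

theorem IsAxis.next (h : Φ.IsAxis Z (j + 1)) : (Φ.next j).IsAxis (M.tangentLift Z) (j + 1) := by
  intro z hz
  have hline : M.line (Φ.nextPoint j z) = M.space.tangentTo Z (Φ.point (basePt z)) := hz.2
  have hzX := (h.nextPoint_mem_tangentLift.1 hz).2
  have hX : (Φ.next j).X (j + 1) = Polynomial.X := Φ.nextX_add_one j
  rw [hX]
  refine ⟨hzX, fun w => ⟨fun hw => ⟨(mem_next_B hw.1).2 ?_, ?_⟩, fun ⟨hw, hwX⟩ => ?_⟩⟩
  · exact hline ▸ h.dproj_mem_tangentTo hz hw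
  · refine (mem_tangentTo_iff (Φ := Φ.nextAffine j) hz hw.1).1 hw Polynomial.X 1 ?_ fun z' hz' _ =>
      (h.nextPoint_mem_tangentLift.1 hz').2
    exact (map_one z).trans_ne one_ne_zero
  · have hwt := (Φ.next j).B_le _ hw
    exact h.mem_tangentTo_tangentLift hz hwt (hline ▸ (mem_next_B hwt).1 hw) hwX

end Axis

section Fiber

variable {y : Φ.R →ₐ[K] K} {z : Polynomial Φ.R →ₐ[K] K}
  {w : M.next.space.Functional (Φ.nextPoint j z)}

theorem apply_reg_C_eq_zero_of_mem_tangentTo_fiber (hz : basePt z = y)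
    (hw : w ∈ M.next.space.tangentTo (M.fst ⁻¹' {Φ.point y}) (Φ.nextPoint j z)) (a : Φ.R) :
    w ((Φ.nextAffine j).reg z (Polynomial.C a)) = 0 := by
  have hone : w ((Φ.nextAffine j).reg z 1) = 0 :=
    pointDerivations_one (comp_reg_mem_pointDerivations (Φ := Φ.nextAffine j) hw.1)
  have hconst := (mem_tangentTo_iff (Φ := Φ.nextAffine j) (nextPoint_mem_fiber.2 hz) hw.1).1 hw
    (Polynomial.C a - y a • 1) 1 ((map_one z).trans_ne one_ne_zero) fun z' hz' _ => by
      rw [map_sub, map_smul, map_one, apply_C, nextPoint_mem_fiber.1 hz', smul_eq_mul, mul_one,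
        sub_self]
  rwa [map_sub, map_sub, map_smul, map_smul, hone, smul_zero, sub_zero] at hconst

theorem mem_tangentTo_fiber (hz : basePt z = y) (hw : w ∈ M.next.B (Φ.nextPoint j z))
    (hX : w ((Φ.next j).reg z ((Φ.next j).X j)) = 0) :
    w ∈ M.next.space.tangentTo (M.fst ⁻¹' {Φ.point y}) (Φ.nextPoint j z) := by
  have hwt := (Φ.next j).B_le _ hw
  refine (mem_tangentTo_iff (Φ := Φ.nextAffine j) (nextPoint_mem_fiber.2 hz) hwt).2
    fun P Q hQ hPQ => ?_
  have hQ0 : Q.map (y : Φ.R →+* K) ≠ 0 := fun h0 => hQ <| by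
    rw [apply_eq_eval_map, hz, h0, Polynomial.eval_zero]
  have hP : P.map (y : Φ.R →+* K) = 0 := by
    refine (mul_eq_zero.1 (Polynomial.funext (q := 0) fun c => ?_)).resolve_right hQ0
    have hc := hPQ (extPt y c) (nextPoint_mem_fiber.2 (basePt_extPt y c))
    rw [extPt_apply_eq_eval_map, extPt_apply_eq_eval_map] at hc
    rw [Polynomial.eval_mul, Polynomial.eval_zero, mul_eq_zero, or_iff_not_imp_right]
    exact hc
  have hδ : (Φ.next j).δ (j + 1) P = Polynomial.derivative P := by
    change Φ.nextδ j (j + 1) P = _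
    simp only [nextδ, add_one_ne, if_false]
    rfl
  have hδz : z (Polynomial.derivative P) = 0 := by
    rw [apply_eq_eval_map, hz, ← Polynomial.derivative_map, hP, Polynomial.derivative_zero,
      Polynomial.eval_zero]
  refine (((Φ.next j).mem_B_iff hwt).1 hw P).trans ?_
  rw [sum_fin_two_eq_add j, hX, hδ, zero_mul, zero_add]
  exact (congrArg _ hδz).trans (mul_zero _)

theorem isAxis_fiber (hy : y (Φ.X j) = 0) : (Φ.next j).IsAxis (M.fst ⁻¹' {Φ.point y}) j := by
  intro z hz
  have hzy := nextPoint_mem_fiber.1 hz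
  have hX : (Φ.next j).X j = Polynomial.C (Φ.X j) := Φ.nextX_self j
  refine ⟨by rw [hX, apply_C, hzy, hy], fun w => ⟨fun hw => ?_, fun ⟨hw, hwX⟩ =>
    mem_tangentTo_fiber hzy hw hwX⟩⟩
  have hC := apply_reg_C_eq_zero_of_mem_tangentTo_fiber hzy hw
  have hproj : M.dproj (Φ.nextPoint j z) w = 0 :=
    tangent_ext (dproj_mem_tangent hw.1) (zero_mem _) fun a =>
      (Φ.nextAffine_reg_C j hw.1 a).symm.trans (hC a)
  refine ⟨(mem_next_B hw.1).2 ?_, hX ▸ hC _⟩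
  rw [hproj]
  exact zero_mem _

theorem exists_polynomial_of_mem_fiber {U : Set M.next.space.carrier} (hU : IsOpen U)
    {r : M.next.space.carrier} (hr : M.fst r = Φ.point y) (hrU : r ∈ U) (j : Fin 2) :
    ∃ p : Polynomial K, p ≠ 0 ∧ ∀ c, p.eval c ≠ 0 → Φ.nextPoint j (extPt y c) ∈ U := by
  have hchart (j : Fin 2) (c : K) (hc : Φ.nextPoint j (extPt y c) ∈ U) :
      ∃ p : Polynomial K, p ≠ 0 ∧ ∀ c, p.eval c ≠ 0 → Φ.nextPoint j (extPt y c) ∈ U := by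
    obtain ⟨b, hb, H⟩ := exists_of_eventually (Φ := Φ.nextAffine j) (hU.mem_nhds hc)
    refine ⟨b.map (y : Φ.R →+* K), fun h0 => hb ?_, fun c hc => H _ ?_⟩
    · rw [extPt_apply_eq_eval_map, h0, Polynomial.eval_zero]
    · rwa [extPt_apply_eq_eval_map]
  have hext {j : Fin 2} {r : M.next.space.carrier} (hr : M.fst r = Φ.point y)
      (hrj : r ∈ Set.range (Φ.nextPoint j)) : ∃ c, Φ.nextPoint j (extPt y c) = r := by
    obtain ⟨z, rfl⟩ := hrj
    exact ⟨z Polynomial.X, by rw [← Φ.injective hr, extPt_basePt]⟩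
  obtain ⟨j', hj'⟩ := exists_mem_range_nextPoint (Φ := Φ) ⟨y, hr.symm⟩
  obtain ⟨c', rfl⟩ := hext hr hj'
  obtain rfl | rfl := eq_or_add_one_eq j' j
  · exact hchart _ c' hrU
  · obtain ⟨p, hp, H⟩ := hchart j' c' hrU
    obtain ⟨c, hc⟩ := exists_eval_ne_zero (mul_ne_zero hp Polynomial.X_ne_zero)
    rw [Polynomial.eval_mul, Polynomial.eval_X, mul_ne_zero_iff] at hc
    obtain ⟨d, hd⟩ := hext (r := Φ.nextPoint j' (extPt y c)) (congrArg Φ.point (basePt_extPt y c))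
      (nextPoint_mem_range_add_one.2 ((extPt_X y c).trans_ne hc.2))
    exact hchart _ d (hd.symm ▸ H c hc.1)

theorem isIrreducible_fiber (Φ : Chart.{u, v} M) (y : Φ.R →ₐ[K] K) :
    IsIrreducible (M.fst ⁻¹' {Φ.point y}) := by
  refine ⟨⟨Φ.nextPoint 0 (extPt y 0), nextPoint_mem_fiber.2 (basePt_extPt y 0)⟩, ?_⟩
  rintro U V hU hV ⟨r, hr, hrU⟩ ⟨s, hs, hsV⟩
  obtain ⟨p, hp, hpU⟩ := exists_polynomial_of_mem_fiber hU hr hrU 0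
  obtain ⟨q, hq, hqV⟩ := exists_polynomial_of_mem_fiber hV hs hsV 0
  obtain ⟨c, hc⟩ := exists_eval_ne_zero (mul_ne_zero hp hq)
  rw [Polynomial.eval_mul, mul_ne_zero_iff] at hc
  exact ⟨_, nextPoint_mem_fiber.2 (basePt_extPt y c), hpU c hc.1, hqV c hc.2⟩

end Fiber

end Chart

/-- A closed set which is covered by charts in which it is an axis. -/
structure Axial {K : Type u} [Field K] (M : Distribution.{u, max u v} K)
    (Z : Set M.space.carrier) : Prop where
  isClosed : IsClosed Z
  exists_chart : ∀ q ∈ Z, ∃ (Φ : Chart.{u, v} M) (j : Fin 2), q ∈ Set.range Φ.point ∧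
    Φ.IsAxis Z (j + 1)

namespace Axial

open Chart

variable {K : Type u} [Field K] [IsAlgClosed K] [CharZero K] {M : Distribution.{u, max u v} K}
  {Z : Set M.space.carrier}

theorem image_tangentLift (hZ : Axial.{u, v} M Z) : M.fst '' M.tangentLift Z = Z := by
  refine Set.Subset.antisymm (Set.image_subset_iff.2 fun r hr => hr.1) fun q hq => ?_
  obtain ⟨Φ, j, ⟨y, rfl⟩, h⟩ := hZ.exists_chart q hq
  exact ⟨_, h.nextPoint_extPt_mem hq, congrArg Φ.point (basePt_extPt y 0)⟩

theorem isClosed_tangentLift (hZ : Axial.{u, v} M Z) : IsClosed (M.tangentLift Z) := by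
  rw [← isOpen_compl_iff, isOpen_iff_mem_nhds]
  intro r hr
  by_cases hrZ : M.fst r ∈ Z
  · obtain ⟨Φ, j, hrΦ, h⟩ := hZ.exists_chart _ hrZ
    have hr' : r ∈ Set.range (Φ.nextPoint (j + 1)) := by
      obtain ⟨b, hb⟩ := exists_mem_range_nextPoint hrΦ
      obtain rfl | rfl := eq_or_add_one_eq j b
      · obtain ⟨z, rfl⟩ := hb
        exact nextPoint_mem_range_add_one.2 fun hX => hr (h.nextPoint_mem_tangentLift.2 ⟨hrZ, hX⟩)
      · exact hb
    filter_upwards [Φ.isOpen_range_nextPoint.mem_nhds hr'] with s hs hsZ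
    obtain ⟨z, rfl⟩ := h.mem_range_of_mem_tangentLift hsZ (Φ.mem_range_nextPoint.1 hs).1
    exact nextPoint_mem_range_add_one.1 hs (h.nextPoint_mem_tangentLift.1 hsZ).2
  · have hopen := hZ.isClosed.isOpen_compl.preimage Distribution.continuous_fst
    exact Filter.mem_of_superset (hopen.mem_nhds hrZ) fun s hs hs' => hs hs'.1

theorem tangentLift (hZ : Axial.{u, v} M Z) : Axial.{u, v} M.next (M.tangentLift Z) where
  isClosed := hZ.isClosed_tangentLift
  exists_chart r hr := by
    obtain ⟨Φ, j, hrΦ, h⟩ := hZ.exists_chart _ hr.1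
    exact ⟨Φ.next j, j, h.mem_range_of_mem_tangentLift hr hrΦ, h.next⟩

theorem isMorphismOn_section (hZ : Axial.{u, v} M Z) {ψ : M.space.carrier → M.next.space.carrier}
    (hψ : Set.MapsTo ψ Z (M.tangentLift Z)) (hfst : ∀ q ∈ Z, M.fst (ψ q) = q) :
    IsMorphismOn (X := M.space) (Y := M.next.space) ψ Z := by
  have hloc {Φ : Chart.{u, v} M} {j} (h : Φ.IsAxis Z (j + 1)) (y : Φ.R →ₐ[K] K)
      (hy : Φ.point y ∈ Z) : ψ (Φ.point y) = Φ.nextPoint j (extPt y 0) :=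
    h.eq_nextPoint_of_mem_tangentLift (hψ hy) (hfst _ hy)
  refine ⟨fun q hq U hU => ?_, fun q hq g hg => ?_⟩
  · obtain ⟨Φ, j, ⟨y, rfl⟩, h⟩ := hZ.exists_chart q hq
    rw [hloc h y hq] at hU
    obtain ⟨b, hb, H⟩ := exists_of_eventually (Φ := Φ.nextAffine j) hU
    rw [extPt_zero_apply] at hb
    refine eventually_nhdsWithin_iff.2 (eventually_of_forall hb fun z hz hzZ => ?_)
    rw [hloc h z hzZ]
    exact H _ ((extPt_zero_apply z b).trans_ne hz)
  · obtain ⟨Φ, j, ⟨y, rfl⟩, h⟩ := hZ.exists_chart q hq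
    rw [hloc h y hq] at hg
    obtain ⟨a, b, hab⟩ := hasFraction_of_mem_regAt (Φ := Φ.nextAffine j) hg
    have hb : y (b.coeff 0) ≠ 0 := (extPt_zero_apply y b).symm.trans_ne hab.ne_zero
    refine ⟨fun q => Φ.ext (a.coeff 0) q * (Φ.ext (b.coeff 0) q)⁻¹, mul_mem (Φ.ext_mem_regAt _ y)
      (inv_mem_regAt (Φ.ext_mem_regAt _ y) ((Φ.ext_apply _ _).trans_ne hb)), ?_⟩
    refine eventually_nhdsWithin_iff.2 (eventually_of_forall hb fun z hz hzZ => ?_)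
    rw [hloc h z hzZ]
    refine (hab.eq _ ((extPt_zero_apply z b).trans_ne hz)).trans ?_
    change _ = Φ.ext _ _ * (Φ.ext _ _)⁻¹
    rw [extPt_zero_apply, extPt_zero_apply, ext_apply, ext_apply, div_eq_mul_inv]

theorem exists_section (hZ : Axial.{u, v} M Z) (hne : Z.Nonempty) :
    ∃ ψ : M.space.carrier → M.next.space.carrier,
      IsMorphismOn (X := M.space) (Y := M.next.space) ψ Z
      ∧ Set.MapsTo ψ Z (M.tangentLift Z) ∧ Set.InvOn ψ M.fst (M.tangentLift Z) Z := by
  have hsurj : ∀ q ∈ Z, ∃ r ∈ M.tangentLift Z, M.fst r = q := hZ.image_tangentLift.ge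
  obtain ⟨r₀, -⟩ := hsurj _ hne.choose_spec
  have : Nonempty M.next.space.carrier := ⟨r₀⟩
  choose! ψ hψ hfst using hsurj
  exact ⟨ψ, hZ.isMorphismOn_section hψ hfst, hψ,
    fun r hr => tangentLift_injOn Z (hψ _ hr.1) hr (hfst _ hr.1), hfst⟩

theorem isIsomorphismOn (hZ : Axial.{u, v} M Z) (hne : Z.Nonempty) :
    IsIsomorphismOn (X := M.next.space) (Y := M.space) M.fst (M.tangentLift Z) Z :=
  ⟨isMorphismOn_fst _, fun _ hr => hr.1, hZ.exists_section hne⟩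

theorem isIrreducible_tangentLift (hZ : Axial.{u, v} M Z) (hirr : IsIrreducible Z) :
    IsIrreducible (M.tangentLift Z) := by
  obtain ⟨ψ, hψ, hmaps, hinv⟩ := hZ.exists_section hirr.nonempty
  have himage : M.tangentLift Z = ψ '' Z :=
    Set.Subset.antisymm (fun r hr => ⟨M.fst r, hr.1, hinv.1 hr⟩) (Set.image_subset_iff.2 hmaps)
  rw [himage]
  exact hirr.image ψ hψ.1

theorem fiber (Φ : Chart.{u, v} M) {y : Φ.R →ₐ[K] K} (hy : ∀ b, y (Φ.X b) = 0)
    (hclosed : IsClosed {Φ.point y}) : Axial.{u, v} M.next (M.fst ⁻¹' {Φ.point y}) where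
  isClosed := hclosed.preimage Distribution.continuous_fst
  exists_chart r hr := by
    obtain ⟨j, hj⟩ := exists_mem_range_nextPoint (Φ := Φ) ⟨y, hr.symm⟩
    refine ⟨Φ.next j, j + 1, hj, ?_⟩
    rw [add_one_add_one]
    exact isAxis_fiber (hy j)

end Axial

/-! ### The node of the total space -/

theorem AffineChart.eventually_ne {K : Type u} [Field K] {S : FunSpace.{u, max u v} K}
    {Φ : AffineChart.{u, v} S} {y y' : Φ.R →ₐ[K] K} (h : y' ≠ y) :
    ∀ᶠ q in 𝓝 (Φ.point y'), q ≠ Φ.point y := by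
  obtain ⟨a, ha⟩ := DFunLike.ne_iff.1 h
  have hne (z : Φ.R →ₐ[K] K) : z (a - algebraMap K _ (y a)) = z a - y a := by
    rw [map_sub, AlgHom.commutes]
    rfl
  refine eventually_of_forall ((hne y').trans_ne (sub_ne_zero.2 ha)) fun z hz hzy => hz ?_
  rw [hne, Φ.injective hzy, sub_self]

/-- A chart of a family with an origin, through which pass two irreducible components `branch b` of
the central fibre, defined by the vanishing of the coordinates `X b`. The function `bound` cuts out
a neighbourhood of the origin in which the central fibre has no other points. -/
structure NodeChart {K : Type u} [Field K] (M : Distribution.{u, max u v} K)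
    (C : K → Set M.space.carrier) extends FamChart.{u, v} M C where
  origin : R →ₐ[K] K
  origin_X : ∀ b, origin (X b) = 0
  origin_mem : origin ∈ zeroLocus K ideal
  isClosed_origin : IsClosed {point origin}
  branch : Fin 2 → Set M.space.carrier
  axial : ∀ b, Axial.{u, v} M (branch b)
  isIrreducible_branch : ∀ b, IsIrreducible (branch b)
  isAxis : ∀ b, toChart.IsAxis (branch b) b
  mem_zeroLocus_of_mem_branch : ∀ b y, point y ∈ branch b → y ∈ zeroLocus K ideal
  origin_mem_branch : ∀ b, point origin ∈ branch b
  exists_ne : ∀ b, ∃ y, point y ∈ branch b ∧ y (X (b + 1)) ≠ 0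
  bound : R
  origin_bound : origin bound ≠ 0
  mem_branch : ∀ y ∈ zeroLocus K ideal, y bound ≠ 0 → ∀ b, y (X b) = 0 → point y ∈ branch b
  eq_origin : ∀ y ∈ zeroLocus K ideal, y bound ≠ 0 → (∀ b, y (X b) = 0) → y = origin

namespace NodeChart

section Next

variable {K : Type u} [Field K] {M : Distribution.{u, max u v} K}
  {C : K → Set M.space.carrier} (Φ : NodeChart.{u, v} M C) (j : Fin 2)

/-- The branches on the next level: the fibre over the origin and the lift of the branch on which
the retained coordinate does not vanish identically. -/
def nextBranch (b : Fin 2) : Set M.next.space.carrier :=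
  if b = j then M.fst ⁻¹' {Φ.point Φ.origin} else M.tangentLift (Φ.branch (j + 1))

@[simp] theorem nextBranch_self : Φ.nextBranch j j = M.fst ⁻¹' {Φ.point Φ.origin} := if_pos rfl

@[simp] theorem nextBranch_add_one :
    Φ.nextBranch j (j + 1) = M.tangentLift (Φ.branch (j + 1)) :=
  if_neg (add_one_ne j)

variable {j} {z : Polynomial Φ.R →ₐ[K] K}

variable [CharZero K]

theorem basePt_X_add_one_eq_zero (hz : z ∈ zeroLocus K (Φ.nextIdeal j))
    (h : basePt z (Φ.X j) * z Polynomial.X = 0) : basePt z (Φ.X (j + 1)) = 0 := by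
  obtain ⟨-, hrel⟩ := Φ.mem_zeroLocus_nextIdeal.1 hz
  rw [mul_assoc, h, mul_zero] at hrel
  exact (mul_eq_zero.1 hrel.symm).resolve_left (Int.cast_ne_zero.2 (Φ.weight_ne_zero _))

theorem basePt_eq_origin (hz : z ∈ zeroLocus K (Φ.nextIdeal j))
    (hbound : z (Polynomial.C Φ.bound) ≠ 0) (hX : z (Φ.nextX j j) = 0) :
    basePt z = Φ.origin := by
  rw [Chart.nextX_self, apply_C] at hX
  refine Φ.eq_origin _ (Φ.mem_zeroLocus_nextIdeal.1 hz).1 hbound fun b => ?_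
  obtain rfl | rfl := eq_or_add_one_eq j b
  · exact hX
  · exact Φ.basePt_X_add_one_eq_zero hz (by rw [hX, zero_mul])

theorem eq_extPt_origin (hz : z ∈ zeroLocus K (Φ.nextIdeal j))
    (hbound : z (Polynomial.C Φ.bound) ≠ 0) (hX : ∀ b, z (Φ.nextX j b) = 0) :
    z = extPt Φ.origin 0 := by
  have hX₁ := hX (j + 1)
  rw [Chart.nextX_add_one] at hX₁
  rw [← Φ.basePt_eq_origin hz hbound (hX j), ← hX₁, extPt_basePt]

variable [IsAlgClosed K]

variable (j) in
theorem isClosed_nextPoint_origin : IsClosed {Φ.nextPoint j (extPt Φ.origin 0)} := by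
  rw [← isOpen_compl_iff, isOpen_iff_mem_nhds]
  intro r hr
  by_cases hfst : M.fst r = Φ.point Φ.origin
  · obtain ⟨b, z, rfl⟩ := Chart.exists_mem_range_nextPoint (Φ := Φ.toChart) ⟨_, hfst.symm⟩
    obtain rfl | rfl := eq_or_add_one_eq j b
    · exact AffineChart.eventually_ne (Φ := Φ.nextAffine j) (y := extPt Φ.origin 0)
        fun h => hr (congrArg (Φ.nextPoint j) h)
    · refine Filter.mem_of_superset (Φ.isOpen_range_nextPoint.mem_nhds ⟨z, rfl⟩) ?_
      rintro _ hs rfl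
      exact Chart.nextPoint_mem_range_add_one.1 hs (extPt_X Φ.origin 0)
  · have hopen := Φ.isClosed_origin.isOpen_compl.preimage Distribution.continuous_fst
    refine Filter.mem_of_superset (hopen.mem_nhds hfst) ?_
    rintro _ hs rfl
    exact hs (congrArg Φ.point (basePt_extPt _ _))

variable (j) in
theorem isAxis_nextBranch (b : Fin 2) : (Φ.toChart.next j).IsAxis (Φ.nextBranch j b) b := by
  obtain rfl | rfl := eq_or_add_one_eq j b
  · rw [nextBranch_self]
    exact Chart.isAxis_fiber (Φ.origin_X j)
  · rw [nextBranch_add_one]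
    exact (Φ.isAxis _).next

variable (j) in
theorem axial_nextBranch (b : Fin 2) : Axial.{u, v} M.next (Φ.nextBranch j b) := by
  obtain rfl | rfl := eq_or_add_one_eq j b
  · rw [nextBranch_self]
    exact Axial.fiber Φ.toChart Φ.origin_X Φ.isClosed_origin
  · rw [nextBranch_add_one]
    exact (Φ.axial _).tangentLift

variable (j) in
theorem isIrreducible_nextBranch (b : Fin 2) : IsIrreducible (Φ.nextBranch j b) := by
  obtain rfl | rfl := eq_or_add_one_eq j b
  · rw [nextBranch_self]
    exact Φ.isIrreducible_fiber Φ.origin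
  · rw [nextBranch_add_one]
    exact (Φ.axial _).isIrreducible_tangentLift (Φ.isIrreducible_branch _)

theorem nextPoint_mem_nextBranch_self :
    Φ.nextPoint j z ∈ Φ.nextBranch j j ↔ basePt z = Φ.origin := by
  rw [nextBranch_self]
  exact Chart.nextPoint_mem_fiber

theorem nextPoint_mem_nextBranch_add_one :
    Φ.nextPoint j z ∈ Φ.nextBranch j (j + 1) ↔
      Φ.point (basePt z) ∈ Φ.branch (j + 1) ∧ z Polynomial.X = 0 := by
  rw [nextBranch_add_one]
  exact (Φ.isAxis _).nextPoint_mem_tangentLift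

theorem origin_mem_nextBranch (b : Fin 2) :
    Φ.nextPoint j (extPt Φ.origin 0) ∈ Φ.nextBranch j b := by
  obtain rfl | rfl := eq_or_add_one_eq j b
  · exact Φ.nextPoint_mem_nextBranch_self.2 (basePt_extPt _ _)
  · refine Φ.nextPoint_mem_nextBranch_add_one.2 ⟨?_, extPt_X _ _⟩
    rw [basePt_extPt]
    exact Φ.origin_mem_branch _

theorem nextBranch_exists_ne (b : Fin 2) :
    ∃ z, Φ.nextPoint j z ∈ Φ.nextBranch j b ∧ z (Φ.nextX j (b + 1)) ≠ 0 := by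
  obtain rfl | rfl := eq_or_add_one_eq j b
  · refine ⟨extPt Φ.origin 1, Φ.nextPoint_mem_nextBranch_self.2 (basePt_extPt _ _), ?_⟩
    rw [Chart.nextX_add_one, extPt_X]
    exact one_ne_zero
  · obtain ⟨y, hy, hne⟩ := Φ.exists_ne (j + 1)
    rw [add_one_add_one] at hne
    refine ⟨extPt y 0, Φ.nextPoint_mem_nextBranch_add_one.2 ⟨?_, extPt_X _ _⟩, ?_⟩
    · rwa [basePt_extPt]
    · rwa [add_one_add_one, Chart.nextX_self, extPt_C]

theorem mem_zeroLocus_of_mem_nextBranch (b : Fin 2) (z : Polynomial Φ.R →ₐ[K] K)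
    (hz : Φ.nextPoint j z ∈ Φ.nextBranch j b) : z ∈ zeroLocus K (Φ.nextIdeal j) := by
  rw [Φ.mem_zeroLocus_nextIdeal]
  obtain rfl | rfl := eq_or_add_one_eq j b
  · rw [Φ.nextPoint_mem_nextBranch_self.1 hz, Φ.origin_X, Φ.origin_X, mul_zero, mul_zero, zero_mul]
    exact ⟨Φ.origin_mem, rfl⟩
  · obtain ⟨hbranch, hX⟩ := Φ.nextPoint_mem_nextBranch_add_one.1 hz
    rw [hX, (Φ.isAxis _ _ hbranch).1, mul_zero, mul_zero]
    exact ⟨Φ.mem_zeroLocus_of_mem_branch _ _ hbranch, rfl⟩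

theorem mem_nextBranch (hz : z ∈ zeroLocus K (Φ.nextIdeal j))
    (hbound : z (Polynomial.C Φ.bound) ≠ 0) (b : Fin 2) (hX : z (Φ.nextX j b) = 0) :
    Φ.nextPoint j z ∈ Φ.nextBranch j b := by
  obtain rfl | rfl := eq_or_add_one_eq j b
  · exact Φ.nextPoint_mem_nextBranch_self.2 (Φ.basePt_eq_origin hz hbound hX)
  · rw [Chart.nextX_add_one] at hX
    exact Φ.nextPoint_mem_nextBranch_add_one.2 ⟨Φ.mem_branch _ (Φ.mem_zeroLocus_nextIdeal.1 hz).1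
      hbound _ (Φ.basePt_X_add_one_eq_zero hz (by rw [hX, mul_zero])), hX⟩

variable (j)

/-- The chart of the next level with its origin and branches. -/
abbrev next : NodeChart.{u, v} M.next (fun t => M.lift (C t)) where
  toFamChart := Φ.toFamChart.next j
  origin := extPt Φ.origin 0
  origin_X b := by
    refine ((Φ.isAxis_nextBranch j b) _ ?_).1
    exact Φ.origin_mem_nextBranch b
  origin_mem := Φ.mem_zeroLocus_of_mem_nextBranch j _ (Φ.origin_mem_nextBranch j)
  isClosed_origin := Φ.isClosed_nextPoint_origin j
  branch := Φ.nextBranch j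
  axial := Φ.axial_nextBranch j
  isIrreducible_branch := Φ.isIrreducible_nextBranch j
  isAxis := Φ.isAxis_nextBranch j
  mem_zeroLocus_of_mem_branch := Φ.mem_zeroLocus_of_mem_nextBranch
  origin_mem_branch := Φ.origin_mem_nextBranch
  exists_ne := Φ.nextBranch_exists_ne
  bound := Polynomial.C Φ.bound
  origin_bound := (extPt_C _ _ _).trans_ne Φ.origin_bound
  mem_branch _ := Φ.mem_nextBranch
  eq_origin _ := Φ.eq_extPt_origin

end Next

end NodeChart

/-! ### The central fibre -/

section TotalSpace

variable {K : Type u} [Field K] {S : FunSpace.{u, v} K} {T : Set K}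

theorem FunSpace.Local.prodLine_fst {D : Set S.carrier} {f : S.carrier → K} (h : S.Local D f) :
    (S.prodLine T).Local (Prod.fst ⁻¹' D) fun z => f z.1 :=
  Local.gen (Or.inl ⟨D, f, h, rfl⟩)

theorem continuous_prodLine_fst :
    @Continuous (S.prodLine T).carrier S.carrier _ _ Prod.fst :=
  continuous_of_local_comp fun h => h.prodLine_fst

theorem prodLine_fst_mem_regAt {z : (S.prodLine T).carrier} {f : S.carrier → K}
    (hf : f ∈ S.regAt (Prod.fst z)) :
    (fun w : (S.prodLine T).carrier => f (Prod.fst w)) ∈ (S.prodLine T).regAt z := by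
  obtain ⟨D, g, hg, hz, hD⟩ := hf
  exact ⟨_, _, hg.prodLine_fst, hz, fun w hw => hD w.1 hw⟩

theorem prodLine_snd_mem_regAt (z : (S.prodLine T).carrier) :
    (fun w : (S.prodLine T).carrier => ((Prod.snd w : T) : K)) ∈ (S.prodLine T).regAt z :=
  Local.mem_regAt (Local.gen (Or.inr rfl)) (Set.mem_univ _)

theorem FunSpace.Local.comp_prodLine_mk (t : T) {D : Set (S.prodLine T).carrier}
    {f : (S.prodLine T).carrier → K} (h : (S.prodLine T).Local D f) :
    S.Local {q | ((q, t) : S.carrier × T) ∈ D} fun q => f ((q, t) : S.carrier × T) := by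
  induction h with
  | gen h =>
    rcases h with ⟨D, f, hf, h⟩ | h <;> obtain ⟨rfl, rfl⟩ := Prod.mk.inj h
    exacts [hf, Local.const (t : K)]
  | const c => exact Local.const c
  | add _ _ ihf ihg => exact ihf.add ihg
  | mul _ _ ihf ihg => exact ihf.mul ihg
  | inv _ ih => exact ih.inv

theorem continuous_prodLine_mk (t : T) :
    @Continuous S.carrier (S.prodLine T).carrier _ _ fun q => (q, t) :=
  continuous_of_local_comp fun h => h.comp_prodLine_mk t

/-- The closure of the family of the curves `C t`, `t ≠ 0`, in the product with `T`. -/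
def totalSpace (C : K → Set S.carrier) (T : Set K) : Set (S.prodLine T).carrier :=
  closure {z : (S.prodLine T).carrier | (z.2 : K) ≠ 0 ∧ z.1 ∈ C (z.2 : K)}

/-- The limit for `t = 0` of the family of the curves `C t`. -/
def centralFiber (C : K → Set S.carrier) (T : Set K) : Set S.carrier :=
  {q | ∃ h : (0 : K) ∈ T, ((q, ⟨0, h⟩) : S.carrier × T) ∈ totalSpace C T}

theorem isClosed_centralFiber (C : K → Set S.carrier) (hT₀ : (0 : K) ∈ T) :
    IsClosed (centralFiber C T) := by
  have hclosed : IsClosed (totalSpace C T) := isClosed_closure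
  convert hclosed.preimage (continuous_prodLine_mk ⟨0, hT₀⟩) using 1
  exact Set.ext fun q => exists_prop_of_true hT₀

end TotalSpace

theorem exists_ne_zero_iff_apply_mem {K : Type u} [Field K] {R : Type*} [CommRing R]
    [Algebra K R] {T : Set K} (hT : Tᶜ.Finite) (a : R) :
    ∃ h : R, ∀ z : R →ₐ[K] K, z h ≠ 0 ↔ z a ∈ T := by
  refine ⟨∏ s ∈ hT.toFinset, (a - algebraMap K R s), fun z => ?_⟩
  simp only [map_prod, map_sub, AlgHom.commutes, Finset.prod_ne_zero_iff, sub_ne_zero,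
    Set.Finite.mem_toFinset, Algebra.algebraMap_self_apply]
  exact ⟨fun h => by_contra fun hz => h _ hz rfl, fun h s hs hz => hs (hz ▸ h)⟩

namespace FamChart

variable {K : Type u} [Field K] {M : Distribution.{u, max u v} K} {C : K → Set M.space.carrier}
  (Φ : FamChart.{u, v} M C) (T : Set K)

/-- The point of `S × T` given by a point of the chart and the value of `param` there. -/
def familyPoint (z : {z : Φ.R →ₐ[K] K // z Φ.param ∈ T}) : (M.space.prodLine T).carrier :=
  ((Φ.point z.1, ⟨z.1 Φ.param, z.2⟩) : M.space.carrier × T)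

variable {Φ T} {y : Φ.R →ₐ[K] K}

theorem hasFraction_familyPoint {D : Set (M.space.prodLine T).carrier}
    {f : (M.space.prodLine T).carrier → K} (h : (M.space.prodLine T).Local D f)
    {w : {z : Φ.R →ₐ[K] K // z Φ.param ∈ T}} (hw : Φ.familyPoint T w ∈ D) :
    HasFraction (fun z : {z : Φ.R →ₐ[K] K // z Φ.param ∈ T} => z.1) (Φ.familyPoint T) D f w := by
  refine h.hasFraction ?_ hw
  rintro D f (⟨D, f, hf, h⟩ | h) hw <;> obtain ⟨rfl, rfl⟩ := Prod.mk.inj h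
  · obtain ⟨a, b, hab⟩ := Φ.hasFraction hf hw
    exact ⟨a, b, hab.ne_zero, fun z => hab.mem z, fun z => hab.eq z⟩
  · refine ⟨Φ.param, 1, ?_, fun _ _ => Set.mem_univ _, fun z _ => ?_⟩
    · rw [map_one]
      exact one_ne_zero
    · rw [map_one, div_one]
      rfl

theorem exists_of_mem_totalSpace {p : (M.space.prodLine T).carrier} (hp : p ∈ totalSpace C T)
    (hy : Prod.fst p = Φ.point y) {f : (M.space.prodLine T).carrier → K}
    (hf : f ∈ (M.space.prodLine T).regAt p) (hfp : f p ≠ 0) :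
    ∃ z : {z : Φ.R →ₐ[K] K // z Φ.param ∈ T},
      z.1 ∈ zeroLocus K Φ.ideal ∧ f (Φ.familyPoint T z) ≠ 0 := by
  have hrange : ∀ᶠ q : (M.space.prodLine T).carrier in 𝓝 p, Prod.fst q ∈ Set.range Φ.point :=
    (Φ.isOpen_range.preimage continuous_prodLine_fst).mem_nhds ⟨y, hy.symm⟩
  obtain ⟨⟨_, t, htT⟩, ⟨hft, z, rfl⟩, ht, hz⟩ := mem_closure_iff_nhds.1 hp _
    ((eventually_ne_zero hf hfp).and hrange)
  obtain ⟨hzJ, rfl⟩ := (Φ.mem_curve_iff t ht z).1 hz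
  exact ⟨⟨z, htT⟩, hzJ, hft⟩

variable [IsAlgClosed K] [CharZero K]

theorem exists_param_ne_zero (hy : y ∈ zeroLocus K Φ.ideal) {g : Φ.R} (hg : y g ≠ 0) :
    ∃ z ∈ zeroLocus K Φ.ideal, z g ≠ 0 ∧ z Φ.param ≠ 0 := by
  obtain ⟨z, hz, hne⟩ : ∃ z ∈ zeroLocus K Φ.ideal, z (g * Φ.X 0 * Φ.X 1) ≠ 0 := by
    refine exists_mem_zeroLocus_ne_zero fun h => hg ?_
    have hη (b) : Φ.η b (Φ.X b) = 1 := by rw [Φ.η_X, if_pos rfl]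
    have hgX := (Φ.isStable_η 1).mem_radical_of_mul_mem (hη 1) h
    rw [← zeroLocus_radical] at hy
    exact hy g ((Φ.isStable_η 0).mem_radical_of_mul_mem (hη 0) hgX)
  rw [map_mul, map_mul, mul_ne_zero_iff, mul_ne_zero_iff] at hne
  refine ⟨z, hz, hne.1.1, fun h => ?_⟩
  obtain h | h := Fin.exists_fin_two.1 ((Φ.param_eq_zero_iff z hz).1 h)
  exacts [hne.1.2 h, hne.2 h]

theorem mem_totalSpace_iff (hT : Tᶜ.Finite) (t : T) :
    ((Φ.point y, t) : M.space.carrier × T) ∈ totalSpace C T ↔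
      y ∈ zeroLocus K Φ.ideal ∧ y Φ.param = t := by
  constructor
  · intro h
    have hreg (a) := prodLine_fst_mem_regAt (T := T) (z := ((Φ.point y, t) : M.space.carrier × T))
      (Φ.ext_mem_regAt a y)
    constructor
    · intro a ha
      by_contra hne
      obtain ⟨z, hz, hza⟩ :=
        exists_of_mem_totalSpace h rfl (hreg a) ((Φ.ext_apply a y).trans_ne hne)
      exact hza ((Φ.ext_apply a z.1).trans (hz a ha))
    · by_contra hne
      obtain ⟨z, -, hzt⟩ := exists_of_mem_totalSpace h rfl
        (sub_mem (hreg Φ.param) (prodLine_snd_mem_regAt _))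
        (sub_ne_zero.2 ((Φ.ext_apply Φ.param y).trans_ne hne))
      exact hzt (sub_eq_zero.2 (Φ.ext_apply Φ.param z.1))
  · rintro ⟨hy, ht⟩
    obtain ⟨t, htT⟩ := t
    obtain rfl : y Φ.param = t := ht
    refine (mem_closure_iff_nhds (X := (M.space.prodLine T).carrier)).2 fun U hU => ?_
    obtain ⟨D, f, hf, hyD, hDU⟩ :=
      exists_local_of_mem_nhds (X := M.space.prodLine T) hU
    obtain ⟨a, b, hab⟩ := hasFraction_familyPoint (w := ⟨y, htT⟩) hf hyD
    obtain ⟨c, hc⟩ := exists_ne_zero_iff_apply_mem hT Φ.param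
    have hbc : y (b * c) ≠ 0 := by
      rw [map_mul]
      exact mul_ne_zero hab.ne_zero ((hc y).2 htT)
    obtain ⟨z, hz, hzbc, hzt⟩ := exists_param_ne_zero hy hbc
    rw [map_mul, mul_ne_zero_iff, hc] at hzbc
    exact ⟨Φ.familyPoint T ⟨z, hzbc.2⟩, hDU (hab.mem ⟨z, hzbc.2⟩ hzbc.1), hzt,
      (Φ.mem_curve_iff _ hzt z).2 ⟨hz, rfl⟩⟩

theorem mem_centralFiber_iff (hT : Tᶜ.Finite) (hT₀ : (0 : K) ∈ T) :
    Φ.point y ∈ centralFiber C T ↔ y ∈ zeroLocus K Φ.ideal ∧ y Φ.param = 0 :=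
  (exists_prop_of_true hT₀).trans (mem_totalSpace_iff hT ⟨0, hT₀⟩)

end FamChart

namespace NodeChart

variable {K : Type u} [Field K] {M : Distribution.{u, max u v} K} {C : K → Set M.space.carrier}
  {T : Set K} (Φ : NodeChart.{u, v} M C)

theorem branch_subset_branch_iff {b b' : Fin 2} : Φ.branch b ⊆ Φ.branch b' ↔ b = b' := by
  refine ⟨fun h => ?_, fun h => h ▸ subset_rfl⟩
  obtain rfl | rfl := eq_or_add_one_eq b b'
  · rfl
  · obtain ⟨y, hy, hne⟩ := Φ.exists_ne b
    exact absurd (Φ.isAxis _ y (h hy)).1 hne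

variable [IsAlgClosed K] [CharZero K]

theorem branch_subset_centralFiber (hT : Tᶜ.Finite) (hT₀ : (0 : K) ∈ T) (b : Fin 2) :
    Φ.branch b ⊆ centralFiber C T := by
  have hcover : Φ.branch b ⊆ (Set.range Φ.point)ᶜ ∪ centralFiber C T := by
    intro q hq
    by_cases hrange : q ∈ Set.range Φ.point
    · obtain ⟨y, rfl⟩ := hrange
      have hy := Φ.mem_zeroLocus_of_mem_branch b y hq
      exact Or.inr ((Φ.mem_centralFiber_iff hT hT₀).2
        ⟨hy, (Φ.param_eq_zero_iff y hy).2 ⟨b, (Φ.isAxis b y hq).1⟩⟩)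
    · exact Or.inl hrange
  exact (isPreirreducible_iff_isClosed_union_isClosed.1 (Φ.isIrreducible_branch b).2 _ _
    Φ.isOpen_range.isClosed_compl (isClosed_centralFiber C hT₀) hcover).resolve_left
      fun h => h (Φ.origin_mem_branch b) ⟨_, rfl⟩

theorem eventually_exists_mem_branch (hT : Tᶜ.Finite) (hT₀ : (0 : K) ∈ T) :
    ∀ᶠ q in 𝓝 (Φ.point Φ.origin), q ∈ centralFiber C T → ∃ b, q ∈ Φ.branch b := by
  refine eventually_of_forall Φ.origin_bound fun y hy hyC => ?_
  obtain ⟨hyJ, hyt⟩ := (Φ.mem_centralFiber_iff hT hT₀).1 hyC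
  exact ((Φ.param_eq_zero_iff y hyJ).1 hyt).imp (Φ.mem_branch y hyJ hy)

theorem exists_subset_branch (hT : Tᶜ.Finite) (hT₀ : (0 : K) ∈ T) {Z : Set M.space.carrier}
    (hZ : IsIrreducible Z) (hZC : Z ⊆ centralFiber C T) (horigin : Φ.point Φ.origin ∈ Z) :
    ∃ b, Z ⊆ Φ.branch b := by
  obtain ⟨U, hU, hUo, hoU⟩ := eventually_nhds_iff.1 (Φ.eventually_exists_mem_branch hT hT₀)
  have hclosed (b) : IsClosed (Φ.branch b) := (Φ.axial b).isClosed
  have hcover : Z ⊆ Uᶜ ∪ (Φ.branch 0 ∪ Φ.branch 1) := fun q hq =>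
    or_iff_not_imp_left.2 fun hqU => Fin.exists_fin_two.1 (hU q (not_not.1 hqU) (hZC hq))
  have hsplit := isPreirreducible_iff_isClosed_union_isClosed.1 hZ.2
  have hZ' := (hsplit _ _ hUo.isClosed_compl ((hclosed 0).union (hclosed 1)) hcover).resolve_left
    fun h => h horigin hoU
  exact Fin.exists_fin_two.2 (hsplit _ _ (hclosed 0) (hclosed 1) hZ')

theorem maximal_and_mem_iff (hT : Tᶜ.Finite) (hT₀ : (0 : K) ∈ T) {Z : Set M.space.carrier} :
    (Maximal (fun Y => IsIrreducible Y ∧ Y ⊆ centralFiber C T) Z ∧ Φ.point Φ.origin ∈ Z) ↔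
      ∃ b, Z = Φ.branch b := by
  have hbranch (b) : IsIrreducible (Φ.branch b) ∧ Φ.branch b ⊆ centralFiber C T :=
    ⟨Φ.isIrreducible_branch b, Φ.branch_subset_centralFiber hT hT₀ b⟩
  constructor
  · rintro ⟨hZ, horigin⟩
    obtain ⟨b, hb⟩ := Φ.exists_subset_branch hT hT₀ hZ.1.1 hZ.1.2 horigin
    exact ⟨b, hZ.eq_of_le (hbranch b) hb⟩
  · rintro ⟨b, rfl⟩
    refine ⟨⟨hbranch b, fun Y hY hle => ?_⟩, Φ.origin_mem_branch b⟩
    obtain ⟨b', hb'⟩ := Φ.exists_subset_branch hT hT₀ hY.1 hY.2 (hle (Φ.origin_mem_branch b))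
    obtain rfl := Φ.branch_subset_branch_iff.1 (hle.trans hb')
    exact hb'

end NodeChart

/-! ### The base of the tower -/

section LocalAlgebra

variable {K : Type u} [Field K] {A : Type*} [CommRing A] [Algebra K A] {o : A →ₐ[K] K}

theorem finiteType_of_etale {σ : Type*} [Finite σ] {x : σ → A}
    (hx : (MvPolynomial.aeval x : MvPolynomial σ K →ₐ[K] A).toRingHom.Etale) :
    Algebra.FiniteType K A := by
  let P := MvPolynomial σ K
  let _ : Algebra P A := (MvPolynomial.aeval x : P →ₐ[K] A).toRingHom.toAlgebra
  have : IsScalarTower K P A := IsScalarTower.of_algebraMap_eq'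
    (AlgHom.comp_algebraMap (MvPolynomial.aeval x : P →ₐ[K] A)).symm
  have : Algebra.Etale P A := hx
  exact Algebra.FiniteType.trans (S := P) inferInstance inferInstance

theorem sub_algebraMap_mem_ker (o : A →ₐ[K] K) (a : A) :
    a - algebraMap K A (o a) ∈ RingHom.ker o := by
  rw [RingHom.mem_ker, map_sub, AlgHom.commutes]
  exact sub_self _

theorem mem_zeroLocus_ker {y : A →ₐ[K] K} : y ∈ zeroLocus K (RingHom.ker o) ↔ y = o := by
  constructor
  · intro h
    ext a
    have ha := h _ (sub_algebraMap_mem_ker o a)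
    rw [map_sub, AlgHom.commutes] at ha
    exact sub_eq_zero.1 ha
  · rintro rfl
    exact fun a ha => ha

theorem mem_zeroLocus_of_forall_mul_mem {I J : Ideal A} {e : A} (h : ∀ a ∈ J, e * a ∈ I)
    {y : A →ₐ[K] K} (hy : y ∈ zeroLocus K I) (he : y e ≠ 0) : y ∈ zeroLocus K J := by
  intro a ha
  have hea := hy _ (h a ha)
  rw [map_mul] at hea
  exact (mul_eq_zero.1 hea).resolve_left he

theorem exists_mul_mem_of_le_sup [IsNoetherianRing A] {I J : Ideal A}
    (h : J ≤ I ⊔ RingHom.ker o * J) : ∃ e : A, o e ≠ 0 ∧ ∀ a ∈ J, e * a ∈ I := by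
  obtain ⟨e, he, heJ⟩ := Submodule.exists_sub_one_mem_and_smul_le_of_fg_of_le_sup
    (IsNoetherian.noetherian J) le_rfl h
  refine ⟨e, ?_, fun a ha => heJ (Submodule.smul_mem_pointwise_smul _ _ _ ha)⟩
  rw [RingHom.mem_ker, map_sub, map_one, sub_eq_zero] at he
  rw [he]
  exact one_ne_zero

theorem sub_smul_mem_pointDerivations {φ : A →ₗ[K] K}
    (hφ : ∀ a ∈ RingHom.ker o * RingHom.ker o, φ a = 0) :
    φ - φ 1 • o.toLinearMap ∈ pointDerivations o := by
  intro a b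
  have hab := hφ _ (Ideal.mul_mem_mul (sub_algebraMap_mem_ker o a) (sub_algebraMap_mem_ker o b))
  have hexpand : (a - algebraMap K A (o a)) * (b - algebraMap K A (o b)) =
      a * b - o a • b - o b • a + (o a * o b) • 1 := by
    simp only [Algebra.smul_def, map_mul]
    ring
  rw [hexpand, map_add, map_sub, map_sub, map_smul, map_smul, map_smul] at hab
  simp only [LinearMap.sub_apply, LinearMap.smul_apply, AlgHom.toLinearMap_apply, map_mul,
    smul_eq_mul] at hab ⊢
  linear_combination hab

theorem exists_mul_mem_span_range [IsNoetherianRing A] {ι : Type*} {x : ι → A}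
    (ho : ∀ b, o (x b) = 0)
    (hd : ∀ d ∈ pointDerivations o, (∀ b, d (x b) = 0) → d = 0) :
    ∃ e : A, o e ≠ 0 ∧ ∀ a ∈ RingHom.ker o, e * a ∈ Ideal.span (Set.range x) := by
  refine exists_mul_mem_of_le_sup fun a ha => ?_
  by_contra hna
  let N : Ideal A := Ideal.span (Set.range x) ⊔ RingHom.ker o * RingHom.ker o
  obtain ⟨φ, hφa, hφ⟩ := Submodule.exists_dual_map_eq_bot_of_notMem
    (p := N.restrictScalars K) (x := a) hna inferInstance
  have hφN (b) (hb : b ∈ N) : φ b = 0 :=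
    (Submodule.mem_bot K).1 (hφ ▸ Submodule.mem_map_of_mem (p := N.restrictScalars K) hb)
  have hφ₀ := hd _ (sub_smul_mem_pointDerivations fun b hb => hφN b (Ideal.mem_sup_right hb))
    fun b => by simp [ho, hφN _ (Ideal.mem_sup_left (Ideal.subset_span ⟨b, rfl⟩))]
  have hφ₁ : φ a - φ 1 * o a = 0 := LinearMap.congr_fun hφ₀ a
  rw [RingHom.mem_ker.1 ha, mul_zero, sub_zero] at hφ₁
  exact hφa hφ₁

theorem exists_mul_mem_span_singleton [IsNoetherianRing A] {u v e : A} (hv : o v = 0)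
    (he : o e ≠ 0) (huv : ∀ a ∈ RingHom.ker o, e * a ∈ Ideal.span {u, v}) {P : Ideal A}
    [P.IsPrime] (hPo : P ≤ RingHom.ker o) (huP : u ∈ P) (hvP : v ∉ P) :
    ∃ s : A, o s ≠ 0 ∧ ∀ a ∈ P, s * a ∈ Ideal.span {u} := by
  refine exists_mul_mem_of_le_sup fun f hf => ?_
  obtain ⟨p, q, hpq⟩ := Ideal.mem_span_pair.1 (huv f (hPo hf))
  have hq : q ∈ P := by
    have hqv : q * v ∈ P := by
      rw [← add_sub_cancel_left (p * u) (q * v), hpq]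
      exact P.sub_mem (P.mul_mem_left _ hf) (P.mul_mem_left _ huP)
    exact (Ideal.IsPrime.mem_or_mem inferInstance hqv).resolve_right hvP
  let c : A := algebraMap K A (o e)⁻¹
  have hc : 1 - c * e ∈ RingHom.ker o := by
    rw [RingHom.mem_ker, map_sub, map_mul, map_one, AlgHom.commutes, Algebra.algebraMap_self_apply,
      inv_mul_cancel₀ he, sub_self]
  have hf_eq : f = c * p * u + (v * (c * q) + (1 - c * e) * f) := by
    linear_combination -c * hpq
  rw [hf_eq]
  exact Submodule.add_mem_sup (Ideal.mul_mem_left _ _ (Ideal.mem_span_singleton_self _))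
    (add_mem (Ideal.mul_mem_mul hv (P.mul_mem_left _ hq)) (Ideal.mul_mem_mul hc hf))

end LocalAlgebra

section BranchIdeal

variable {K : Type u} [Field K] {A : Type*} [CommRing A] [Algebra K A] {x : Fin 2 → A}
  {δ : Fin 2 → Derivation K A A} {o : A →ₐ[K] K}

/-- Prime ideals of the component through `o` of the curve `x b = 0`, where `x` are local
coordinates with dual derivations `δ`. -/
structure IsBranchIdeal (x : Fin 2 → A) (δ : Fin 2 → Derivation K A A) (o : A →ₐ[K] K)
    (b : Fin 2) (P : Ideal A) : Prop where
  isPrime : P.IsPrime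
  le_ker : P ≤ RingHom.ker o
  mem : x b ∈ P
  notMem : x (b + 1) ∉ P
  isStable : IsStable (δ (b + 1)) P

theorem exists_isBranchIdeal [CharZero K] (hδ : ∀ a b, δ a (x b) = if a = b then 1 else 0)
    (ho : ∀ b, o (x b) = 0) (b : Fin 2) : ∃ P, IsBranchIdeal x δ o b P := by
  have := RingHom.ker_isPrime o
  obtain ⟨P, hP, hPo⟩ := Ideal.exists_minimalPrimes_le (I := Ideal.span {x b})
    (J := RingHom.ker o) ((Ideal.span_singleton_le_iff_mem _).2 (ho b))
  have hstable : IsStable (δ (b + 1)) P := by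
    refine (isStable_span ?_).minimalPrime hP
    rintro _ rfl
    rw [hδ, if_neg (add_one_ne b)]
    exact zero_mem _
  refine ⟨P, hP.1.1, hPo, hP.1.2 (Ideal.mem_span_singleton_self _), fun h => ?_, hstable⟩
  have hone := hstable _ h
  rw [hδ, if_pos rfl] at hone
  exact hP.1.1.ne_top ((Ideal.eq_top_iff_one _).2 hone)

theorem IsBranchIdeal.exists_mul_mem_span [IsNoetherianRing A] {e : A} (he : o e ≠ 0)
    (hex : ∀ a ∈ RingHom.ker o, e * a ∈ Ideal.span (Set.range x)) (ho : ∀ b, o (x b) = 0)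
    {b : Fin 2} {P : Ideal A} (hP : IsBranchIdeal x δ o b P) :
    ∃ s : A, o s ≠ 0 ∧ ∀ a ∈ P, s * a ∈ Ideal.span {x b} := by
  have := hP.isPrime
  have hrange : Set.range x = {x b, x (b + 1)} := by
    ext a
    simp only [Set.mem_range, exists_fin_two_iff b, Set.mem_insert_iff, Set.mem_singleton_iff,
      eq_comm]
  rw [hrange] at hex
  exact exists_mul_mem_span_singleton (ho _) he hex hP.le_ker hP.mem hP.notMem

theorem exists_bound [IsNoetherianRing A]
    (hx : (MvPolynomial.aeval x : MvPolynomial (Fin 2) K →ₐ[K] A).toRingHom.FormallyUnramified)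
    (ho : ∀ b, o (x b) = 0) {P : Fin 2 → Ideal A} (hP : ∀ b, IsBranchIdeal x δ o b (P b)) :
    ∃ g : A, o g ≠ 0 ∧ ∀ y : A →ₐ[K] K, y g ≠ 0 →
      (∀ b, y (x b) = 0 → y ∈ zeroLocus K (P b)) ∧ ((∀ b, y (x b) = 0) → y = o) := by
  obtain ⟨e, he, hex⟩ := exists_mul_mem_span_range ho fun d => pointDerivations_eq_zero hx
  choose s hs hsP using fun b => (hP b).exists_mul_mem_span he hex ho
  refine ⟨e * ∏ b, s b, ?_, fun y hy => ?_⟩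
  · rw [map_mul, map_prod]
    exact mul_ne_zero he (Finset.prod_ne_zero_iff.2 fun b _ => hs b)
  · rw [map_mul, map_prod, mul_ne_zero_iff, Finset.prod_ne_zero_iff] at hy
    refine ⟨fun b hb => mem_zeroLocus_of_forall_mul_mem (hsP b) ?_ (hy.2 b (Finset.mem_univ b)),
      fun h => mem_zeroLocus_ker.1 (mem_zeroLocus_of_forall_mul_mem hex ?_ hy.1)⟩
    · exact mem_zeroLocus_span.2 (by rintro _ rfl; exact hb)
    · exact mem_zeroLocus_span.2 (Set.forall_mem_range.2 h)

end BranchIdeal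

theorem AffineChart.isPreirreducible_image_zeroLocus {K : Type u} [Field K] [IsAlgClosed K]
    {S : FunSpace.{u, max u v} K} (Φ : AffineChart.{u, v} S) {P : Ideal Φ.R} (hP : P.IsPrime) :
    IsPreirreducible (Φ.point '' zeroLocus K P) := by
  rintro U V hU hV ⟨_, ⟨y, hy, rfl⟩, hyU⟩ ⟨_, ⟨y', hy', rfl⟩, hyV⟩
  obtain ⟨b, hb, hbU⟩ := exists_of_eventually (hU.mem_nhds hyU)
  obtain ⟨b', hb', hbV⟩ := exists_of_eventually (hV.mem_nhds hyV)
  have hbb' : b * b' ∉ P.radical := by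
    rw [hP.isRadical.radical]
    exact hP.mul_notMem (fun h => hb (hy b h)) fun h => hb' (hy' b' h)
  obtain ⟨z, hz, hne⟩ := exists_mem_zeroLocus_ne_zero (K := K) hbb'
  rw [map_mul, mul_ne_zero_iff] at hne
  exact ⟨_, ⟨z, hz, rfl⟩, hbU z hne.1, hbV z hne.2⟩

theorem Chart.isAxis_of_isStable {K : Type u} [Field K] [IsAlgClosed K] [CharZero K]
    {M : Distribution.{u, max u v} K} (Φ : Chart.{u, v} M)
    (hB : ∀ y, M.space.tangent (Φ.point y) ≤ M.B (Φ.point y)) {Z : Set M.space.carrier}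
    {P : Ideal Φ.R} (hZ : ∀ y, Φ.point y ∈ Z ↔ y ∈ zeroLocus K P) {b : Fin 2} (hb : Φ.X b ∈ P)
    (hP : IsStable (Φ.δ (b + 1)) P) : Φ.IsAxis Z b := by
  intro y hy
  have hyP := (hZ y).1 hy
  refine ⟨hyP _ hb, fun w => ⟨fun hw => ⟨hB y hw.1, ?_⟩, ?_⟩⟩
  · exact (mem_tangentTo_iff hy hw.1).1 hw _ 1 (by simp) fun z hz _ => (hZ z).1 hz _ hb
  · rintro ⟨hw, h0⟩
    have hwt := Φ.B_le _ hw
    refine (mem_tangentTo_iff hy hwt).2 fun a c hc h => ?_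
    have hwa := (Φ.mem_B_iff hwt).1 hw a
    rw [sum_fin_two_eq_add b, h0, zero_mul, zero_add] at hwa
    exact hwa.trans (mul_eq_zero_of_right _
      (hP.apply_eq_zero hyP hc fun z hz => h z ((hZ z).2 hz)))

section Base

variable {K : Type u} [Field K] {A : Type v} [CommRing A] [Algebra K A]

theorem local_affine (a : A) : (affine K A).Local Set.univ fun y : A →ₐ[K] K => y a :=
  Local.gen ⟨a, rfl⟩

theorem isClosed_zeroLocus (I : Ideal A) :
    IsClosed (X := (affine K A).carrier) (zeroLocus K I) := by
  have h : zeroLocus K I = ⋂ a ∈ I, {y : A →ₐ[K] K | y a ≠ 0}ᶜ := by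
    ext y
    simp only [zeroLocus, Set.mem_ofPred_eq, Set.mem_iInter, Set.mem_compl_iff, not_not]
  rw [h]
  refine isClosed_biInter fun a _ => IsOpen.isClosed_compl (X := (affine K A).carrier) ?_
  have hopen := (local_affine (K := K) a).inv.isOpen
  rwa [Set.univ_inter] at hopen

/-- The tautological chart of an affine variety. -/
abbrev affineChart (hA : Algebra.FiniteType K A) : AffineChart.{u, v} (affine K A) where
  R := A
  point := id
  injective := Function.injective_id
  isOpen_range := (congrArg IsOpen Set.range_id).mpr isOpen_univ
  extend_mem_regAt a y := by
    refine regAt_congr ((local_affine (K := K) a).mem_regAt (Set.mem_univ y))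
      (Filter.Eventually.of_forall fun z => ?_)
    exact (Function.injective_id.extend_apply (fun z : A →ₐ[K] K => z a) _ z).symm
  hasFraction h hy := by
    refine h.hasFraction ?_ hy
    rintro D f ⟨a, h⟩ -
    obtain ⟨rfl, rfl⟩ := Prod.mk.inj h
    exact ⟨a, 1, by simp, fun _ _ => Set.mem_univ _, fun z _ => by simp⟩

theorem isIrreducible_zeroLocus [IsAlgClosed K] (hA : Algebra.FiniteType K A) {P : Ideal A}
    (hP : P.IsPrime) {o : A →ₐ[K] K} (ho : o ∈ zeroLocus K P) :
    IsIrreducible (X := (affine K A).carrier) (zeroLocus K P) :=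
  ⟨⟨o, ho⟩, (congrArg IsPreirreducible (Set.image_id _)).mp
    ((affineChart hA).isPreirreducible_image_zeroLocus hP)⟩

variable {x : Fin 2 → A} {δ : Fin 2 → Derivation K A A}
  (hx : (MvPolynomial.aeval x : MvPolynomial (Fin 2) K →ₐ[K] A).toRingHom.Etale)
  (hδ : ∀ a b, δ a (x b) = if a = b then 1 else 0)

/-- The chart of the base given by étale coordinates. -/
abbrev baseChart : Chart.{u, v} (tower K A 0) where
  toAffineChart := affineChart (finiteType_of_etale hx)
  X := x
  δ := δ
  δ_X := hδ
  B_le _ := le_rfl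
  mem_B_iff hw := iff_of_true hw fun a =>
    pointDerivations_eq_sum hx.formallyUnramified hδ (comp_reg_mem_pointDerivations hw) a

theorem exists_eq_smul_euler {y : A →ₐ[K] K} (hy : y (x 0 * x 1) ≠ 0) {d : A →ₗ[K] K}
    (hd : d ∈ pointDerivations y) (hd₀ : d (x 0 * x 1) = 0) :
    ∃ c : K, d = c • (y.toLinearMap ∘ₗ ((baseChart hx hδ).euler ![1, -1]).toLinearMap) := by
  rw [map_mul, mul_ne_zero_iff] at hy
  rw [hd] at hd₀
  have hy₀ := hy.1
  refine ⟨d (x 0) / y (x 0), LinearMap.ext fun a => ?_⟩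
  have heuler : (baseChart hx hδ).euler ![1, -1] a = x 0 * δ 0 a - x 1 * δ 1 a :=
    ((baseChart hx hδ).euler_apply _ 0 a).trans (by simp [sub_eq_add_neg])
  change d a = d (x 0) / y (x 0) * y ((baseChart hx hδ).euler ![1, -1] a)
  rw [heuler, pointDerivations_eq_sum hx.formallyUnramified hδ hd a, Fin.sum_univ_two, map_sub,
    map_mul, map_mul]
  field_simp
  linear_combination y (δ 1 a) * hd₀

theorem mem_zeroLocus_bot (y : A →ₐ[K] K) : y ∈ zeroLocus K (⊥ : Ideal A) :=
  fun a ha => by rw [Ideal.mem_bot.1 ha, map_zero]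

/-- The family of the curves `x 0 * x 1 = t` in the chart of the base. -/
abbrev baseFamChart : FamChart.{u, v} (tower K A 0) (fun t => X x t 0) where
  toChart := baseChart hx hδ
  weight := ![1, -1]
  weight_pos := one_pos
  weight_neg := neg_one_lt_zero
  ideal := ⊥
  param := x 0 * x 1
  η := δ
  η_X := hδ
  isStable_η b := isStable_bot (δ b)
  isStable_euler := isStable_bot _
  euler_param := by
    have h (b) : (baseChart hx hδ).euler ![1, -1] (x b) = _ := (baseChart hx hδ).euler_X _ b
    rw [Ideal.mem_bot, Derivation.leibniz, h, h]
    simp [mul_comm]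
  unramified y _ hy d hd _ hd₀ := exists_eq_smul_euler hx hδ hy hd hd₀
  param_eq_zero_iff y _ := by rw [map_mul, mul_eq_zero, Fin.exists_fin_two]
  mem_curve_iff t _ y := by
    rw [and_iff_right (mem_zeroLocus_bot y), map_mul]
    rfl

variable [IsAlgClosed K] [CharZero K]

variable {o : A →ₐ[K] K} {P : Fin 2 → Ideal A} {g : A}

theorem isAxis_base {b : Fin 2} (hP : IsBranchIdeal x δ o b (P b)) :
    (baseChart hx hδ).IsAxis (zeroLocus K (P b)) b :=
  (baseChart hx hδ).isAxis_of_isStable (fun _ => le_rfl) (fun _ => Iff.rfl) hP.mem hP.isStable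

/-- The base with its origin `o` and the two branches of the curve `x 0 * x 1 = 0` through `o`. -/
abbrev baseNodeChart (ho : ∀ b, o (x b) = 0) (hP : ∀ b, IsBranchIdeal x δ o b (P b))
    (hgo : o g ≠ 0) (hg : ∀ y : A →ₐ[K] K, y g ≠ 0 →
      (∀ b, y (x b) = 0 → y ∈ zeroLocus K (P b)) ∧ ((∀ b, y (x b) = 0) → y = o)) :
    NodeChart.{u, v} (tower K A 0) (fun t => X x t 0) where
  toFamChart := baseFamChart hx hδ
  origin := o
  origin_X := ho
  origin_mem := mem_zeroLocus_bot o
  isClosed_origin := by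
    have h : zeroLocus K (RingHom.ker o) = {o} := Set.ext fun _ => mem_zeroLocus_ker
    exact h ▸ isClosed_zeroLocus (RingHom.ker o)
  branch b := zeroLocus K (P b)
  axial b :=
    { isClosed := isClosed_zeroLocus (P b)
      exists_chart := fun q _ => ⟨baseChart hx hδ, b + 1, ⟨q, rfl⟩,
        (add_one_add_one b).symm ▸ isAxis_base hx hδ (hP b)⟩ }
  isIrreducible_branch b :=
    isIrreducible_zeroLocus (finiteType_of_etale hx) (hP b).isPrime (hP b).le_ker
  isAxis b := isAxis_base hx hδ (hP b)
  mem_zeroLocus_of_mem_branch _ y _ := mem_zeroLocus_bot y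
  origin_mem_branch b := (hP b).le_ker
  exists_ne b := by
    have := finiteType_of_etale hx
    refine exists_mem_zeroLocus_ne_zero ?_
    rw [(hP b).isPrime.isRadical.radical]
    exact (hP b).notMem
  bound := g
  origin_bound := hgo
  mem_branch y _ hy b := (hg y hy).1 b
  eq_origin y _ hy := (hg y hy).2

end Base

/-! ### The charts of the tower -/

section Tower

variable {K : Type u} [Field K] {A : Type v} [CommRing A] [Algebra K A] {x : Fin 2 → A}

/-- The chart `Φ` is the chart `C(p)` of the monster tower, with its coordinates, and its origin is
the node `N(p)` over `o`. -/
structure NodeChart.Represents {k : ℕ} (Φ : NodeChart.{u, v} (tower K A k) (fun t => X x t k))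
    (o : A →ₐ[K] K) (p : Fin k → Fin 2) : Prop where
  mem_range_iff : ∀ q, q ∈ Set.range Φ.point ↔ q ∈ chart x k p
  coord_eq : ∀ i y, coord x k p i (Φ.point y) = y (Φ.X i)
  isNode_iff : ∀ q, IsNode x o k p q ↔ q = Φ.point Φ.origin

/-- `NodeChart.next` for the monster tower, with `tower K A (k + 1)` and `X x t (k + 1)` in place of
the prolongations to which they unfold. -/
abbrev NodeChart.nextTower [IsAlgClosed K] [CharZero K] {k : ℕ}
    (Φ : NodeChart.{u, v} (tower K A k) (fun t => X x t k)) (j : Fin 2) :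
    NodeChart.{u, v} (tower K A (k + 1)) (fun t => X x t (k + 1)) :=
  Φ.next j

variable {k : ℕ} {Φ : NodeChart.{u, v} (tower K A k) (fun t => X x t k)} {o : A →ₐ[K] K}

namespace NodeChart.Represents

section Coord

variable {p : Fin k → Fin 2}

theorem eventually_ext_eq_coord (h : Φ.Represents o p) (i : Fin 2) (y : Φ.R →ₐ[K] K) :
    ∀ᶠ q in 𝓝 (Φ.point y), Φ.ext (Φ.X i) q = coord x k p i q := by
  filter_upwards [Φ.isOpen_range.mem_nhds ⟨y, rfl⟩]
  rintro _ ⟨z, rfl⟩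
  rw [h.coord_eq, ext_apply]

theorem dirDeriv_coord (h : Φ.Represents o p) (i : Fin 2) {q : (tower K A k).Points}
    (hq : q.1 ∈ Set.range Φ.point) :
    dirDeriv ((tower K A k).dir q) (coord x k p i) =
      dirDeriv ((tower K A k).dir q) (Φ.ext (Φ.X i)) := by
  obtain ⟨q, ℓ⟩ := q
  obtain ⟨y, rfl⟩ := hq
  exact (dirDeriv_congr (Φ.B_le _ ((tower K A k).dir_mem _)) (Φ.ext_mem_regAt _ y)
    (h.eventually_ext_eq_coord i y)).symm

end Coord

variable [IsAlgClosed K] [CharZero K] {p : Fin (k + 1) → Fin 2}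

theorem mem_range_next_iff (h : Φ.Represents o (Fin.init p)) (q : (S K A (k + 1)).carrier) :
    q ∈ Set.range (Φ.nextPoint (p (Fin.last k))) ↔ q ∈ chart x (k + 1) p := by
  refine Φ.mem_range_nextPoint.trans (Iff.trans ?_ (and_congr_left' (h.mem_range_iff (π k q))))
  exact and_congr_right fun hq => by rw [h.dirDeriv_coord _ hq]

theorem coord_next (h : Φ.Represents o (Fin.init p)) (i : Fin 2) (z : Polynomial Φ.R →ₐ[K] K) :
    coord x (k + 1) p i (Φ.nextPoint (p (Fin.last k)) z) = z (Φ.nextX (p (Fin.last k)) i) := by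
  obtain rfl | rfl := eq_or_add_one_eq (p (Fin.last k)) i
  · refine (congrFun (if_pos rfl) _).trans ?_
    rw [Chart.nextX_self, apply_C]
    exact h.coord_eq _ _
  · refine (congrFun (if_neg (add_one_ne _)) _).trans ?_
    rw [Chart.nextX_add_one]
    refine Eq.trans ?_ (Φ.slope_nextPoint (j := p (Fin.last k)) z)
    exact congrArg₂ _ (h.dirDeriv_coord _ ⟨_, rfl⟩) (h.dirDeriv_coord _ ⟨_, rfl⟩)

theorem isNode_next_iff (h : Φ.Represents o (Fin.init p)) (q : (S K A (k + 1)).carrier) :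
    IsNode x o (k + 1) p q ↔ q = Φ.nextPoint (p (Fin.last k)) (extPt Φ.origin 0) := by
  rw [IsNode, h.isNode_iff, ← h.mem_range_next_iff]
  constructor
  · rintro ⟨hπ, ⟨z, rfl⟩, hX⟩
    have hbase : basePt z = Φ.origin := Φ.injective hπ
    have hslope := hX (p (Fin.last k) + 1)
    rw [h.coord_next, Chart.nextX_add_one] at hslope
    rw [← hbase, ← hslope, extPt_basePt]
  · rintro rfl
    refine ⟨congrArg Φ.point (basePt_extPt _ _), ⟨_, rfl⟩, fun i => ?_⟩
    rw [h.coord_next]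
    exact (Φ.next (p (Fin.last k))).origin_X i

theorem next (h : Φ.Represents o (Fin.init p)) :
    (Φ.nextTower (p (Fin.last k))).Represents o p where
  mem_range_iff := h.mem_range_next_iff
  coord_eq := h.coord_next
  isNode_iff := h.isNode_next_iff

end NodeChart.Represents

variable [IsAlgClosed K] [CharZero K]

theorem exists_represents_zero
    (hx : (MvPolynomial.aeval x : MvPolynomial (Fin 2) K →ₐ[K] A).toRingHom.Etale)
    (ho : ∀ i, o (x i) = 0) (p : Fin 0 → Fin 2) :
    ∃ Φ : NodeChart.{u, v} (tower K A 0) (fun t => X x t 0), Φ.Represents o p := by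
  have := finiteType_of_etale hx
  have := Algebra.FiniteType.isNoetherianRing K A
  obtain ⟨δ, hδ⟩ := exists_dual_derivations hx.formallyEtale
  choose P hP using exists_isBranchIdeal hδ ho
  obtain ⟨g, hgo, hg⟩ := exists_bound hx.formallyUnramified ho hP
  exact ⟨baseNodeChart hx hδ ho hP hgo hg, fun q => iff_of_true ⟨q, rfl⟩ trivial,
    fun _ _ => rfl, fun _ => Iff.rfl⟩

theorem exists_represents
    (hx : (MvPolynomial.aeval x : MvPolynomial (Fin 2) K →ₐ[K] A).toRingHom.Etale)
    (ho : ∀ i, o (x i) = 0) : ∀ (k : ℕ) (p : Fin k → Fin 2),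
    ∃ Φ : NodeChart.{u, v} (tower K A k) (fun t => X x t k), Φ.Represents o p
  | 0, p => exists_represents_zero hx ho p
  | k + 1, p =>
    have ⟨_, h⟩ := exists_represents hx ho k (Fin.init p)
    ⟨_, h.next⟩

variable (Φ) (j : Fin 2)

theorem image_π_branch_self : π k '' (Φ.nextTower j).branch j = {Φ.point Φ.origin} := by
  have h : (Φ.nextTower j).branch j = (tower K A k).fst ⁻¹' {Φ.point Φ.origin} :=
    Φ.nextBranch_self j
  refine Set.eq_singleton_iff_unique_mem.2 ⟨⟨_, (Φ.nextTower j).origin_mem_branch j, ?_⟩, ?_⟩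
  · exact congrArg Φ.point (basePt_extPt _ _)
  · rintro _ ⟨q, hq, rfl⟩
    rwa [h] at hq

theorem image_π_branch_add_one : π k '' (Φ.nextTower j).branch (j + 1) = Φ.branch (j + 1) :=
  (congrArg _ (Φ.nextBranch_add_one j)).trans (Φ.axial (j + 1)).image_tangentLift

theorem isIsomorphismOn_π_branch_add_one :
    IsIsomorphismOn (π k) ((Φ.nextTower j).branch (j + 1)) (Φ.branch (j + 1)) := by
  have h := (Φ.axial (j + 1)).isIsomorphismOn (Φ.isIrreducible_branch (j + 1)).1
  rwa [← Φ.nextBranch_add_one j] at h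

end Tower

end Monster

end

theorem theorem4p2 {K : Type u} [Field K] [IsAlgClosed K] [CharZero K]
    {A : Type v} [CommRing A] [Algebra K A] (x : Fin 2 → A)
    (hx : (MvPolynomial.aeval x : MvPolynomial (Fin 2) K →ₐ[K] A).toRingHom.Etale)
    (o : A →ₐ[K] K) (ho : ∀ i, o (x i) = 0)
    (T : Set K) (hT : Tᶜ.Finite) (hT0 : (0 : K) ∈ T)
    (k : ℕ) (p : Fin (k + 1) → Fin 2) :
    ∃ (N : (Monster.S K A (k + 1)).carrier) (N' : (Monster.S K A k).carrier),
      (∀ q, Monster.IsNode x o (k + 1) p q ↔ q = N) ∧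
      (∀ q, Monster.IsNode x o k (Fin.init p) q ↔ q = N') ∧
      ∃ E R : Set (Monster.S K A (k + 1)).carrier,
        E ≠ R ∧
        (∀ Z, (Monster.IsTwig x T (k + 1) Z ∧ N ∈ Z) ↔ (Z = E ∨ Z = R)) ∧
        Monster.π k '' E = {N'} ∧
        Monster.IsTwig x T k (Monster.π k '' R) ∧
        Monster.FunSpace.IsIsomorphismOn (Monster.π k) R (Monster.π k '' R) := by
  obtain ⟨Φ, h⟩ := Monster.exists_represents hx ho k (Fin.init p)
  let j := p (Fin.last k)
  let Ψ := Φ.nextTower j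
  refine ⟨Ψ.point Ψ.origin, Φ.point Φ.origin, h.next.isNode_iff, h.isNode_iff, Ψ.branch j,
    Ψ.branch (j + 1), fun hER => ?_, fun Z => ?_, Monster.image_π_branch_self Φ j, ?_⟩
  · exact Monster.add_one_ne j (Ψ.branch_subset_branch_iff.1 hER.le).symm
  · exact (Ψ.maximal_and_mem_iff hT hT0).trans (Monster.exists_fin_two_iff j)
  · rw [Monster.image_π_branch_add_one]
    exact ⟨((Φ.maximal_and_mem_iff hT hT0).2 ⟨_, rfl⟩).1,
      Monster.isIsomorphismOn_π_branch_add_one Φ j⟩
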